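/- Let $k$ be a field of characteristic zero. By a dg coalgebra over $k$ we mean a $\mathbb{Z}$-graded (with differential of degree $-1$) coassociative, counital, coaugmented, conilpotent differential graded $k$-coalgebra; morphisms preserve all of this structure. Let $\mathrm{CDGC}_k$ be the full subcategory of those dg coalgebras whose coproduct is graded cocommutative. For a dg coalgebra $C$ with differential $\partial$ and coproduct $\Delta$, let $\Omega C=(T(s^{-1}\bar C),D)$ be its cobar construction, where $\bar C$ is the cokernel of the coaugmentation and $D$ is the derivation extending $-s^{-1}\partial s+(s^{-1}\otimes s^{-1})\Delta s$. A morphism $f$ of dg coalgebras is an $\Omega$-quasi-isomorphism if $\Omega f$ induces an isomorphism on homology, and two dg coalgebras are $\Omega$-quasi-isomorphic if they are connected by a finite zig-zag of $\Omega$-quasi-isomorphisms of dg coalgebras. For a pointed path-connected topological space $(X,b)$, let $C_*(X,b;k)$ be the dg coalgebra of pointed normalized singular chains: the $k$-module generated by the singular simplices $\Delta^n\to X$ that send all vertices of $\Delta^n$ to $b$, modulo degenerate simplices, with the usual boundary and the Alexander–Whitney coproduct. Let $\mathrm{Top}_*$ be either the category of all pointed path-connected topological spaces and base point preserving continuous maps,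 or its full subcategory on those spaces that are locally path-connected and semi-locally simply connected. Then in either case there is no functor $\mathcal{C}\colon \mathrm{Top}_*\to \mathrm{CDGC}_k$ such that for every $(X,b)\in\mathrm{Top}_*$ the dg coalgebra $\mathcal{C}(X,b)$ is $\Omega$-quasi-isomorphic to $C_*(X,b;k)$. -/

import Mathlib

open CategoryTheory Opposite
open scoped TensorProduct DirectSum

universe u v w

/-! ### Graded modules -/

section Graded

variable {k : Type u} [CommRing k] {V : Type v} [AddCommGroup V] [Module k V]

/-- The sign `(-1)^n` as a scalar. -/
def koszulSign (k : Type u) [CommRing k] (n : ℤ) : k := ((n.negOnePow : ℤ) : k)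

theorem koszulSign_add (m n : ℤ) : koszulSign k (m + n) = koszulSign k m * koszulSign k n := by
  simp [koszulSign, Int.negOnePow_add]

theorem koszulSign_mul_self (m : ℤ) : koszulSign k m * koszulSign k m = 1 := by
  rw [← koszulSign_add]
  simp [koszulSign, Int.negOnePow_even _ (Even.add_self m)]

@[simp] theorem koszulSign_zero : koszulSign k 0 = 1 := by simp [koszulSign]

theorem koszulSign_sub_one (m : ℤ) : koszulSign k (m - 1) = - koszulSign k m := by
  simp [koszulSign, Int.negOnePow_sub]

theorem koszulSign_natCast (m : ℕ) : koszulSign k (m : ℤ) = (-1) ^ m := by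
  induction m with
  | zero => simp
  | succ m ih =>
    have := koszulSign_sub_one (k := k) ((m : ℤ) + 1)
    rw [add_sub_cancel_right, ih] at this
    rw [pow_succ, this]
    push_cast
    ring

variable {gr : ℤ → Submodule k V}

/-- The identification of a graded module with the direct sum of its homogeneous parts. -/
noncomputable def sumEquiv (h : DirectSum.IsInternal gr) : (⨁ n, gr n) ≃ₗ[k] V :=
  LinearEquiv.ofBijective (DirectSum.coeLinearMap gr) h

theorem sumEquiv_symm_of_mem (h : DirectSum.IsInternal gr) {n : ℤ} {x : V} (hx : x ∈ gr n) :
    (sumEquiv h).symm x = DirectSum.lof k ℤ (fun i => gr i) n ⟨x, hx⟩ := by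
  rw [LinearEquiv.symm_apply_eq]
  exact (DirectSum.coeLinearMap_lof gr n ⟨x, hx⟩).symm

/-- The linear endomorphism of a graded module that multiplies each element of degree `n`
by `c n`. -/
noncomputable def scaleDeg (h : DirectSum.IsInternal gr) (c : ℤ → k) : V →ₗ[k] V :=
  (DirectSum.toModule k ℤ V (fun n => c n • (gr n).subtype)) ∘ₗ (sumEquiv h).symm.toLinearMap

theorem scaleDeg_of_mem (h : DirectSum.IsInternal gr) (c : ℤ → k) {n : ℤ} {x : V}
    (hx : x ∈ gr n) : scaleDeg h c x = c n • x := by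
  simp [scaleDeg, sumEquiv_symm_of_mem h hx]

/-- The sign involution `x ↦ (-1)^|x| x` of a graded module. -/
noncomputable def signInv (h : DirectSum.IsInternal gr) : V →ₗ[k] V := scaleDeg h (koszulSign k)

/-- The projection of a graded module onto its odd part. -/
noncomputable def oddPart (h : DirectSum.IsInternal gr) : V →ₗ[k] V :=
  scaleDeg h (fun n => if Odd n then 1 else 0)

/-- The graded interchange map `x ⊗ y ↦ (-1)^(|x||y|) y ⊗ x`
(see `gradedSwap_tmul`). -/
noncomputable def gradedSwap (h : DirectSum.IsInternal gr) : V ⊗[k] V →ₗ[k] V ⊗[k] V :=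
  (TensorProduct.comm k V V).toLinearMap ∘ₗ
    (LinearMap.id - (2 : k) • TensorProduct.map (oddPart h) (oddPart h))

theorem gradedSwap_tmul (h : DirectSum.IsInternal gr) {m n : ℤ} {x y : V}
    (hx : x ∈ gr m) (hy : y ∈ gr n) :
    gradedSwap h (x ⊗ₜ y) = koszulSign k (m * n) • (y ⊗ₜ[k] x) := by
  have hs : koszulSign k (m * n) = 1 - 2 * ((if Odd m then 1 else 0) * (if Odd n then 1 else 0)) := by
    by_cases hm : Odd m
    · by_cases hn : Odd n
      · simp only [koszulSign, Int.negOnePow_odd _ (hm.mul hn), hm, hn, if_true]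
        push_cast
        ring
      · have hn' : Even n := Int.not_odd_iff_even.mp hn
        simp [koszulSign, Int.negOnePow_even _ (hn'.mul_left m), hn]
    · have hm' : Even m := Int.not_odd_iff_even.mp hm
      simp [koszulSign, Int.negOnePow_even _ (hm'.mul_right n), hm]
  simp only [gradedSwap, oddPart, LinearMap.comp_apply, LinearMap.sub_apply, LinearMap.smul_apply,
    LinearMap.id_apply, TensorProduct.map_tmul, scaleDeg_of_mem h _ hx, scaleDeg_of_mem h _ hy,
    TensorProduct.smul_tmul_smul, map_sub, map_smul, LinearEquiv.coe_coe, TensorProduct.comm_tmul,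
    hs, sub_smul, one_smul, mul_smul]

/-- The degree `n` part of `V ⊗ V` for a graded module `V`. -/
def tensorDeg (gr : ℤ → Submodule k V) (n : ℤ) : Submodule k (V ⊗[k] V) :=
  ⨆ p : ℤ, LinearMap.range (TensorProduct.mapIncl (gr p) (gr (n - p)))

theorem graded_induction (h : DirectSum.IsInternal gr) {P : V → Prop}
    (hom : ∀ n x, x ∈ gr n → P x) (add : ∀ x y, P x → P y → P (x + y)) (x : V) : P x := by
  have hx : x ∈ ⨆ i, gr i := by rw [h.submodule_iSup_eq_top]; trivial
  induction hx using Submodule.iSup_induction' with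
  | mem i x hx => exact hom i x hx
  | zero => exact hom 0 0 (zero_mem _)
  | add x y _ _ h1 h2 => exact add x y h1 h2

theorem tmul_mem_tensorDeg {p q n : ℤ} (hn : p + q = n) {x y : V} (hx : x ∈ gr p) (hy : y ∈ gr q) :
    x ⊗ₜ[k] y ∈ tensorDeg gr n := by
  obtain rfl : q = n - p := by omega
  exact Submodule.mem_iSup_of_mem p ⟨(⟨x, hx⟩ : gr p) ⊗ₜ (⟨y, hy⟩ : gr (n - p)), rfl⟩

theorem tensorDeg_induction {n : ℤ} {P : ∀ t : V ⊗[k] V, t ∈ tensorDeg gr n → Prop}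
    (hom : ∀ p x y (hx : x ∈ gr p) (hy : y ∈ gr (n - p)),
      P (x ⊗ₜ y) (tmul_mem_tensorDeg (by omega) hx hy))
    (h0 : P 0 (zero_mem _))
    (add : ∀ x y hx hy, P x hx → P y hy → P (x + y) (add_mem hx hy))
    {t : V ⊗[k] V} (ht : t ∈ tensorDeg gr n) : P t ht := by
  have key : ∃ h, P t h := by
    induction ht using Submodule.iSup_induction' with
    | mem i x hx =>
      obtain ⟨y, rfl⟩ := hx
      induction y using TensorProduct.induction_on with
      | zero => exact ⟨by rw [map_zero]; exact zero_mem _, by simpa using h0⟩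
      | tmul a b => exact ⟨_, hom i _ _ a.2 b.2⟩
      | add a b ha hb =>
        obtain ⟨ha1, ha2⟩ := ha
        obtain ⟨hb1, hb2⟩ := hb
        simp only [map_add]
        exact ⟨add_mem ha1 hb1, add _ _ _ _ ha2 hb2⟩
    | zero => exact ⟨_, h0⟩
    | add x y _ _ h1 h2 => exact ⟨_, add x y _ _ h1.2 h2.2⟩
  exact key.2

theorem isInternal_of_decomp (δ : V →ₗ[k] ⨁ n, gr n)
    (h1 : ∀ x, DirectSum.coeLinearMap gr (δ x) = x)
    (h2 : ∀ n (x : V) (hx : x ∈ gr n), δ x = DirectSum.lof k ℤ (fun i => gr i) n ⟨x, hx⟩) :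
    DirectSum.IsInternal gr := by
  have : DirectSum.Decomposition gr := DirectSum.Decomposition.ofLinearMap gr δ
    (LinearMap.ext h1) (by
      ext n x
      simp [h2 n x.1 x.2])
  exact DirectSum.Decomposition.isInternal gr

theorem isInternal_map_of_surjective {W : Type w} [AddCommGroup W] [Module k W]
    (h : DirectSum.IsInternal gr) {e : V} {m : ℤ} (he : e ∈ gr m)
    (q : V →ₗ[k] W) (hq : Function.Surjective q) (hk : LinearMap.ker q = Submodule.span k {e}) :
    DirectSum.IsInternal (fun n => (gr n).map q) := by
  let φ : (⨁ n, gr n) →ₗ[k] ⨁ n, (gr n).map q :=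
    DirectSum.toModule k ℤ _ (fun n => DirectSum.lof k ℤ (fun i => (gr i).map q) n ∘ₗ
      (q.restrict (fun x hx => Submodule.mem_map_of_mem hx) : gr n →ₗ[k] (gr n).map q))
  let ψ : V →ₗ[k] ⨁ n, (gr n).map q := φ ∘ₗ (sumEquiv h).symm.toLinearMap
  have key : ∀ n (x : V) (hx : x ∈ gr n), ψ x =
      DirectSum.lof k ℤ (fun i => (gr i).map q) n ⟨q x, Submodule.mem_map_of_mem hx⟩ := by
    intro n x hx
    simp only [ψ, φ, LinearMap.comp_apply, LinearEquiv.coe_coe, sumEquiv_symm_of_mem h hx,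
      DirectSum.toModule_lof]
    rfl
  have he0 : q e = 0 := by
    rw [← LinearMap.mem_ker, hk]; exact Submodule.mem_span_singleton_self e
  have hz : LinearMap.ker q ≤ LinearMap.ker ψ := by
    rw [hk, Submodule.span_singleton_le_iff_mem, LinearMap.mem_ker, key m e he]
    simp only [he0]
    exact map_zero _
  let δ : W →ₗ[k] ⨁ n, (gr n).map q :=
    (Submodule.liftQ _ ψ hz) ∘ₗ (q.quotKerEquivOfSurjective hq).symm.toLinearMap
  have hδ : ∀ x, δ (q x) = ψ x := by
    intro x
    have : (q.quotKerEquivOfSurjective hq).symm (q x) = Submodule.Quotient.mk x := by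
      rw [LinearEquiv.symm_apply_eq]; rfl
    simp only [δ, LinearMap.comp_apply, LinearEquiv.coe_coe, this, Submodule.liftQ_apply]
  refine isInternal_of_decomp δ ?_ ?_
  · intro x
    obtain ⟨x, rfl⟩ := hq x
    rw [hδ]
    induction x using graded_induction h with
    | hom n x hx => rw [key n x hx, DirectSum.coeLinearMap_lof]
    | add x y h1 h2 => rw [map_add, map_add, map_add, h1, h2]
  · rintro n _ ⟨x, hx, rfl⟩
    rw [hδ]
    exact key n x hx

end Graded

/-! ### Coaugmented coalgebras -/

section Reduced

variable {k : Type u} [CommRing k] {C : Type v} [AddCommGroup C] [Module k C] [Coalgebra k C]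

/-- The coproduct induced on the cokernel of the coaugmentation determined by `e`. -/
noncomputable def reducedComul (e : C) (he : IsGroupLikeElem k e) :
    (C ⧸ Submodule.span k {e}) →ₗ[k]
      (C ⧸ Submodule.span k {e}) ⊗[k] (C ⧸ Submodule.span k {e}) :=
  Submodule.liftQ _ (TensorProduct.map (Submodule.mkQ _) (Submodule.mkQ _) ∘ₗ Coalgebra.comul) (by
    rw [Submodule.span_singleton_le_iff_mem, LinearMap.mem_ker, LinearMap.comp_apply,
      he.comul_eq_tmul_self, TensorProduct.map_tmul]
    have : (Submodule.span k {e}).mkQ e = 0 := by simp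
    rw [this, TensorProduct.tmul_zero])

theorem reducedComul_mkQ (e : C) (he : IsGroupLikeElem k e) (x : C) :
    reducedComul e he ((Submodule.span k {e}).mkQ x) =
      TensorProduct.map (Submodule.mkQ _) (Submodule.mkQ _) (Coalgebra.comul (R := k) x) := rfl

/-- The `n`-fold iterated reduced coproduct `C̄ → C̄^{⊗ (n + 1)}`, where `C̄^{⊗ (n + 1)}` is
regarded as a direct summand of the tensor algebra of `C̄`. -/
noncomputable def iterReducedComul (e : C) (he : IsGroupLikeElem k e) :
    ℕ → (C ⧸ Submodule.span k {e}) →ₗ[k] TensorAlgebra k (C ⧸ Submodule.span k {e})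
  | 0 => TensorAlgebra.ι k
  | n + 1 => LinearMap.mul' k _ ∘ₗ
      TensorProduct.map (TensorAlgebra.ι k) (iterReducedComul e he n) ∘ₗ reducedComul e he

theorem reducedComul_coassoc (e : C) (he : IsGroupLikeElem k e) (x : C ⧸ Submodule.span k {e}) :
    TensorProduct.assoc k _ _ _ (TensorProduct.map (reducedComul e he) LinearMap.id
      (reducedComul e he x)) =
    TensorProduct.map LinearMap.id (reducedComul e he) (reducedComul e he x) := by
  obtain ⟨x, rfl⟩ := Submodule.mkQ_surjective _ x
  set q := (Submodule.span k {e}).mkQ with hq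
  rw [reducedComul_mkQ]
  have h1 : ∀ t : C ⊗[k] C, TensorProduct.assoc k _ _ _
      (TensorProduct.map (reducedComul e he) LinearMap.id (TensorProduct.map q q t)) =
      TensorProduct.map q (TensorProduct.map q q)
        (TensorProduct.assoc k _ _ _ (Coalgebra.comul.rTensor C t)) := by
    intro t
    induction t using TensorProduct.induction_on with
    | zero => simp
    | add a b ha hb => simp only [map_add, ha, hb]
    | tmul a b =>
      simp only [TensorProduct.map_tmul, LinearMap.rTensor_tmul, LinearMap.id_apply, hq,
        reducedComul_mkQ]
      generalize (Coalgebra.comul a : C ⊗[k] C) = s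
      induction s using TensorProduct.induction_on with
      | zero => simp
      | add c d hc hd => simp only [map_add, TensorProduct.add_tmul, hc, hd]
      | tmul c d => simp
  have h2 : ∀ t : C ⊗[k] C,
      TensorProduct.map LinearMap.id (reducedComul e he) (TensorProduct.map q q t) =
      TensorProduct.map q (TensorProduct.map q q) (Coalgebra.comul.lTensor C t) := by
    intro t
    induction t using TensorProduct.induction_on with
    | zero => simp
    | add a b ha hb => simp only [map_add, ha, hb]
    | tmul a b =>
      simp only [TensorProduct.map_tmul, LinearMap.lTensor_tmul, LinearMap.id_apply, hq,
        reducedComul_mkQ]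
  rw [h1, h2, Coalgebra.coassoc_apply]

end Reduced

/-- A differential graded coalgebra over `k`: `ℤ`-graded, with differential of degree `-1`,
coassociative, counital, coaugmented (by the degree-zero group-like cycle `one`)
and conilpotent. -/
structure DGC (k : Type u) [CommRing k] where
  carrier : Type v
  [addCommGroup : AddCommGroup carrier]
  [module : Module k carrier]
  [coalgebra : Coalgebra k carrier]
  gr : ℤ → Submodule k carrier
  isInternal : DirectSum.IsInternal gr
  d : carrier →ₗ[k] carrier
  d_mem : ∀ n x, x ∈ gr n → d x ∈ gr (n - 1)
  d_d : ∀ x, d (d x) = 0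
  comul_mem : ∀ n x, x ∈ gr n → Coalgebra.comul (R := k) x ∈ tensorDeg gr n
  counit_of_mem : ∀ n x, n ≠ 0 → x ∈ gr n → Coalgebra.counit (R := k) x = 0
  comul_d : ∀ x, Coalgebra.comul (R := k) (d x) =
    TensorProduct.map d LinearMap.id (Coalgebra.comul (R := k) x) +
      TensorProduct.map (signInv isInternal) d (Coalgebra.comul (R := k) x)
  counit_d : ∀ x, Coalgebra.counit (R := k) (d x) = 0
  one : carrier
  one_groupLike : IsGroupLikeElem k one
  one_mem : one ∈ gr 0
  d_one : d one = 0
  conilpotent : ∀ x, ∃ n, iterReducedComul one one_groupLike n x = 0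

attribute [instance] DGC.addCommGroup DGC.module DGC.coalgebra

namespace DGC

variable {k : Type u} [CommRing k]

/-- Morphisms of coaugmented dg coalgebras. -/
@[ext] structure Hom (C D : DGC.{u, v} k) where
  toLinearMap : C.carrier →ₗ[k] D.carrier
  map_mem : ∀ n x, x ∈ C.gr n → toLinearMap x ∈ D.gr n
  map_d : ∀ x, toLinearMap (C.d x) = D.d (toLinearMap x)
  map_comul : ∀ x, Coalgebra.comul (R := k) (toLinearMap x) =
    TensorProduct.map toLinearMap toLinearMap (Coalgebra.comul (R := k) x)
  map_counit : ∀ x, Coalgebra.counit (R := k) (toLinearMap x) = Coalgebra.counit (R := k) x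
  map_one : toLinearMap C.one = D.one

instance : Category (DGC.{u, v} k) where
  Hom := Hom
  id C :=
    { toLinearMap := LinearMap.id
      map_mem := fun _ _ h => h
      map_d := fun _ => rfl
      map_comul := fun x => by simp
      map_counit := fun _ => rfl
      map_one := rfl }
  comp f g :=
    { toLinearMap := g.toLinearMap ∘ₗ f.toLinearMap
      map_mem := fun n x h => g.map_mem n _ (f.map_mem n x h)
      map_d := fun x => by simp [f.map_d, g.map_d]
      map_comul := fun x => by
        rw [LinearMap.comp_apply, g.map_comul, f.map_comul, TensorProduct.map_comp,
          LinearMap.comp_apply]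
      map_counit := fun x => by simp [f.map_counit, g.map_counit]
      map_one := by simp [f.map_one, g.map_one] }

/-- Graded cocommutativity: the coproduct is invariant under the graded interchange. -/
def IsCocommutative : ObjectProperty (DGC.{u, v} k) := fun C =>
  ∀ x, gradedSwap C.isInternal (Coalgebra.comul (R := k) x) = Coalgebra.comul (R := k) x

end DGC

/-- The category of cocommutative dg coalgebras, a full subcategory of dg coalgebras. -/
abbrev CDGC (k : Type u) [CommRing k] := (DGC.IsCocommutative (k := k)).FullSubcategory

/-- A unital augmented differential graded associative algebra over `k`, `ℤ`-graded with
differential of degree `-1`. -/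
structure DGA (k : Type u) [CommRing k] where
  carrier : Type v
  [ring : Ring carrier]
  [algebra : Algebra k carrier]
  gr : ℤ → Submodule k carrier
  isInternal : DirectSum.IsInternal gr
  one_mem : 1 ∈ gr 0
  mul_mem : ∀ m n a b, a ∈ gr m → b ∈ gr n → a * b ∈ gr (m + n)
  d : carrier →ₗ[k] carrier
  d_mem : ∀ n a, a ∈ gr n → d a ∈ gr (n - 1)
  d_d : ∀ a, d (d a) = 0
  leibniz : ∀ n a b, a ∈ gr n → d (a * b) = d a * b + koszulSign k n • (a * d b)
  aug : carrier →ₐ[k] k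
  aug_of_mem : ∀ n a, n ≠ 0 → a ∈ gr n → aug a = 0
  aug_d : ∀ a, aug (d a) = 0

attribute [instance] DGA.ring DGA.algebra

namespace DGA

variable {k : Type u} [CommRing k]

/-- Morphisms of augmented dg algebras. -/
@[ext] structure Hom (A B : DGA.{u, v} k) where
  toAlgHom : A.carrier →ₐ[k] B.carrier
  map_mem : ∀ n a, a ∈ A.gr n → toAlgHom a ∈ B.gr n
  map_d : ∀ a, toAlgHom (A.d a) = B.d (toAlgHom a)
  map_aug : ∀ a, B.aug (toAlgHom a) = A.aug a

instance : Category (DGA.{u, v} k) where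
  Hom := Hom
  id A :=
    { toAlgHom := AlgHom.id k _
      map_mem := fun _ _ h => h
      map_d := fun _ => rfl
      map_aug := fun _ => rfl }
  comp f g :=
    { toAlgHom := g.toAlgHom.comp f.toAlgHom
      map_mem := fun n x h => g.map_mem n _ (f.map_mem n x h)
      map_d := fun x => by simp [f.map_d, g.map_d]
      map_aug := fun x => by simp [f.map_aug, g.map_aug] }

/-- Cycles of degree `n`. -/
def cycles (A : DGA.{u, v} k) (n : ℤ) : Submodule k A.carrier := A.gr n ⊓ LinearMap.ker A.d

/-- Boundaries of degree `n`. -/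
def boundaries (A : DGA.{u, v} k) (n : ℤ) : Submodule k A.carrier := (A.gr (n + 1)).map A.d

/-- The homology of a dg algebra in degree `n`. -/
abbrev homology (A : DGA.{u, v} k) (n : ℤ) : Type v :=
  A.cycles n ⧸ (A.boundaries n).submoduleOf (A.cycles n)

/-- The map induced by a morphism of dg algebras on homology in degree `n`. -/
def homologyMap {A B : DGA.{u, v} k} (f : A ⟶ B) (n : ℤ) : A.homology n →ₗ[k] B.homology n :=
  Submodule.mapQ _ _
    ((Hom.toAlgHom f).toLinearMap.restrict (p := A.cycles n) (q := B.cycles n) (by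
      rintro x ⟨hx, hd⟩
      refine ⟨Hom.map_mem f n x hx, ?_⟩
      have hd : A.d x = 0 := hd
      change B.d (Hom.toAlgHom f x) = 0
      rw [← Hom.map_d f, hd, map_zero]))
    (by
      rintro ⟨x, hx⟩ ⟨y, hy, hyx⟩
      refine ⟨Hom.toAlgHom f y, Hom.map_mem f _ y hy, ?_⟩
      rw [← Hom.map_d f, hyx]
      rfl)

/-- A quasi-isomorphism is a morphism inducing isomorphisms on homology in all degrees. -/
def IsQuasiIso {A B : DGA.{u, v} k} (f : A ⟶ B) : Prop :=
  ∀ n, Function.Bijective (homologyMap f n)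

end DGA

/-! ### The cobar construction -/

namespace DGC

variable {k : Type u} [CommRing k]

section Objects

variable (C : DGC.{u, v} k)

/-- The cokernel of the coaugmentation. -/
abbrev bar : Type v := C.carrier ⧸ Submodule.span k {C.one}

/-- The projection onto the cokernel of the coaugmentation. -/
abbrev proj : C.carrier →ₗ[k] C.bar := (Submodule.span k {C.one}).mkQ

theorem proj_one : C.proj C.one = 0 := by simp [proj]

/-- The grading of the cokernel of the coaugmentation. -/
def barGr (n : ℤ) : Submodule k C.bar := (C.gr n).map C.proj

theorem barGr_isInternal : DirectSum.IsInternal C.barGr :=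
  isInternal_map_of_surjective C.isInternal C.one_mem C.proj (Submodule.mkQ_surjective _)
    (Submodule.ker_mkQ _)

/-- The differential of the cokernel of the coaugmentation. -/
def barD : C.bar →ₗ[k] C.bar :=
  Submodule.mapQ _ _ C.d (by
    rw [Submodule.span_singleton_le_iff_mem, Submodule.mem_comap, C.d_one]
    exact zero_mem _)

theorem barD_proj (x : C.carrier) : C.barD (C.proj x) = C.proj (C.d x) := rfl

/-- The coproduct of the cokernel of the coaugmentation. -/
noncomputable def barComul : C.bar →ₗ[k] C.bar ⊗[k] C.bar := reducedComul C.one C.one_groupLike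

theorem barComul_proj (x : C.carrier) : C.barComul (C.proj x) =
    TensorProduct.map C.proj C.proj (Coalgebra.comul (R := k) x) := rfl

/-- The sign involution of the cokernel of the coaugmentation. -/
noncomputable def barSign : C.bar →ₗ[k] C.bar := signInv C.barGr_isInternal

theorem barSign_of_mem {n : ℤ} {x : C.bar} (hx : x ∈ C.barGr n) :
    C.barSign x = koszulSign k n • x := scaleDeg_of_mem _ _ hx

theorem barSign_proj (x : C.carrier) :
    C.barSign (C.proj x) = C.proj (signInv C.isInternal x) := by
  induction x using graded_induction C.isInternal with
  | hom n x hx =>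
    rw [C.barSign_of_mem (Submodule.mem_map_of_mem hx), signInv, scaleDeg_of_mem _ _ hx, map_smul]
  | add x y h1 h2 => simp only [map_add, h1, h2]

theorem barD_mem {n : ℤ} {x : C.bar} (hx : x ∈ C.barGr n) : C.barD x ∈ C.barGr (n - 1) := by
  obtain ⟨x, hx, rfl⟩ := hx
  exact Submodule.mem_map_of_mem (C.d_mem n x hx)

theorem barD_barD (x : C.bar) : C.barD (C.barD x) = 0 := by
  obtain ⟨x, rfl⟩ := Submodule.mkQ_surjective _ x
  rw [barD_proj, barD_proj, C.d_d, map_zero]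

theorem barComul_mem {n : ℤ} {x : C.bar} (hx : x ∈ C.barGr n) :
    C.barComul x ∈ tensorDeg C.barGr n := by
  obtain ⟨x, hx, rfl⟩ := hx
  rw [barComul_proj]
  have ht := C.comul_mem n x hx
  generalize (Coalgebra.comul x : C.carrier ⊗[k] C.carrier) = t at ht ⊢
  induction ht using tensorDeg_induction with
  | hom p a b ha hb =>
    rw [TensorProduct.map_tmul]
    exact tmul_mem_tensorDeg (by omega) (Submodule.mem_map_of_mem ha) (Submodule.mem_map_of_mem hb)
  | h0 => rw [map_zero]; exact zero_mem _
  | add s t _ _ h1 h2 => rw [map_add]; exact add_mem h1 h2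

theorem barComul_barD (x : C.bar) : C.barComul (C.barD x) =
    TensorProduct.map C.barD LinearMap.id (C.barComul x) +
      TensorProduct.map C.barSign C.barD (C.barComul x) := by
  obtain ⟨x, rfl⟩ := Submodule.mkQ_surjective _ x
  rw [barD_proj, barComul_proj, barComul_proj, C.comul_d, map_add]
  generalize (Coalgebra.comul x : C.carrier ⊗[k] C.carrier) = t
  induction t using TensorProduct.induction_on with
  | zero => simp only [map_zero]
  | tmul a b => simp only [TensorProduct.map_tmul, barD_proj, barSign_proj, LinearMap.id_apply]
  | add s t hs ht =>
    simp only [map_add]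
    rw [add_add_add_comm, hs, ht, add_add_add_comm]

theorem barSign_barSign (x : C.bar) : C.barSign (C.barSign x) = x := by
  induction x using graded_induction C.barGr_isInternal with
  | hom n x hx =>
    rw [C.barSign_of_mem hx, map_smul, C.barSign_of_mem hx, smul_smul, koszulSign_mul_self, one_smul]
  | add x y h1 h2 => rw [map_add, map_add, h1, h2]

theorem barD_barSign (x : C.bar) : C.barD (C.barSign x) = - C.barSign (C.barD x) := by
  induction x using graded_induction C.barGr_isInternal with
  | hom n x hx =>
    rw [C.barSign_of_mem hx, C.barSign_of_mem (C.barD_mem hx), map_smul, koszulSign_sub_one,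
      neg_smul, neg_neg]
  | add x y h1 h2 => simp only [map_add, h1, h2, neg_add]

theorem barComul_barSign (x : C.bar) : C.barComul (C.barSign x) =
    TensorProduct.map C.barSign C.barSign (C.barComul x) := by
  induction x using graded_induction C.barGr_isInternal with
  | hom n x hx =>
    rw [C.barSign_of_mem hx, map_smul]
    have ht := C.barComul_mem hx
    generalize C.barComul x = t at ht ⊢
    induction ht using tensorDeg_induction with
    | hom p a b ha hb =>
      rw [TensorProduct.map_tmul, C.barSign_of_mem ha, C.barSign_of_mem hb,
        TensorProduct.smul_tmul_smul, ← koszulSign_add, add_sub_cancel]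
    | h0 => simp only [map_zero, smul_zero]
    | add s t _ _ h1 h2 => rw [smul_add, map_add, h1, h2]
  | add x y h1 h2 => simp only [map_add, h1, h2]

/-- The tensor algebra on the desuspension of the cokernel of the coaugmentation. The
desuspension does not change the underlying module; it is accounted for in `cobarGr`. -/
abbrev cobarAlg : Type (max u v) := TensorAlgebra k C.bar

/-- The canonical inclusion of generators `x ↦ s⁻¹ x`. -/
noncomputable abbrev gen : C.bar →ₗ[k] C.cobarAlg := TensorAlgebra.ι k

/-- `C.IsWord n w` means that `w` is a product `s⁻¹ x₁ ⋯ s⁻¹ x_r` of desuspended homogeneous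
elements with `∑ (|x_i| - 1) = n`. -/
inductive IsWord : ℤ → C.cobarAlg → Prop
  | one : IsWord 0 1
  | cons {m n : ℤ} {x : C.bar} {w : C.cobarAlg} (hx : x ∈ C.barGr m) (hw : IsWord n w) :
      IsWord (m - 1 + n) (C.gen x * w)

/-- The grading of the cobar construction. -/
def cobarGr (n : ℤ) : Submodule k C.cobarAlg := Submodule.span k {w | C.IsWord n w}

/-- The sign involution of the cobar construction: the algebra map with
`s⁻¹ x ↦ (-1)^(|x| - 1) s⁻¹ x`. -/
noncomputable def cobarSign : C.cobarAlg →ₐ[k] C.cobarAlg :=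
  TensorAlgebra.lift k (- (C.gen ∘ₗ C.barSign))

/-- The cobar differential on generators:
`s⁻¹ x ↦ - s⁻¹ ∂ x + ∑ (-1)^|x'| s⁻¹ x' ⊗ s⁻¹ x''`. -/
noncomputable def cobarDGen : C.bar →ₗ[k] C.cobarAlg :=
  - (C.gen ∘ₗ C.barD) +
    LinearMap.mul' k _ ∘ₗ TensorProduct.map (C.gen ∘ₗ C.barSign) C.gen ∘ₗ C.barComul

/-- The algebra map to `2 × 2` matrices that encodes the extension of `cobarDGen`
to a derivation. -/
noncomputable def cobarMat : C.cobarAlg →ₐ[k] Matrix (Fin 2) (Fin 2) C.cobarAlg :=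
  TensorAlgebra.lift k
    { toFun := fun x => !![C.cobarSign (C.gen x), C.cobarDGen x; 0, C.gen x]
      map_add' := fun x y => by
        ext i j; fin_cases i <;> fin_cases j <;> simp
      map_smul' := fun c x => by
        ext i j; fin_cases i <;> fin_cases j <;> simp }

/-- The cobar differential: the derivation extending `cobarDGen`
(see `cobarD_gen` and `cobarD_mul`). -/
noncomputable def cobarD : C.cobarAlg →ₗ[k] C.cobarAlg where
  toFun a := C.cobarMat a 0 1
  map_add' a b := by simp
  map_smul' c a := by simp

theorem cobarMat_gen (x : C.bar) :
    C.cobarMat (C.gen x) = !![C.cobarSign (C.gen x), C.cobarDGen x; 0, C.gen x] := by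
  simp [cobarMat]

theorem cobarMat_eq (a : C.cobarAlg) :
    C.cobarMat a 0 0 = C.cobarSign a ∧ C.cobarMat a 1 0 = 0 ∧ C.cobarMat a 1 1 = a := by
  induction a using TensorAlgebra.induction with
  | algebraMap r => simp [AlgHom.commutes, Matrix.algebraMap_matrix_apply]
  | ι x =>
    have := C.cobarMat_gen x
    rw [gen] at this
    simp [this]
  | mul a b ha hb =>
    simp [map_mul, Matrix.mul_apply, ha, hb]
  | add a b ha hb => simp [map_add, ha, hb]

theorem cobarD_gen (x : C.bar) : C.cobarD (C.gen x) = C.cobarDGen x := by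
  change C.cobarMat (C.gen x) 0 1 = _
  rw [cobarMat_gen]; rfl

theorem cobarD_mul (a b : C.cobarAlg) :
    C.cobarD (a * b) = C.cobarD a * b + C.cobarSign a * C.cobarD b := by
  change C.cobarMat (a * b) 0 1 = C.cobarMat a 0 1 * b + C.cobarSign a * C.cobarMat b 0 1
  rw [map_mul, Matrix.mul_apply, Fin.sum_univ_two, (C.cobarMat_eq a).1, (C.cobarMat_eq b).2.2,
    add_comm]

theorem cobarD_algebraMap (r : k) : C.cobarD (algebraMap k _ r) = 0 := by
  change C.cobarMat (algebraMap k _ r) 0 1 = 0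
  rw [AlgHom.commutes]
  simp [Matrix.algebraMap_matrix_apply]

theorem cobarD_one : C.cobarD 1 = 0 := by
  rw [← map_one (algebraMap k C.cobarAlg), cobarD_algebraMap]

theorem cobarSign_gen (x : C.bar) : C.cobarSign (C.gen x) = - C.gen (C.barSign x) := by
  simp [cobarSign]

theorem cobarDGen_apply (x : C.bar) : C.cobarDGen x = - C.gen (C.barD x) +
    LinearMap.mul' k _ (TensorProduct.map (C.gen ∘ₗ C.barSign) C.gen (C.barComul x)) := rfl

theorem cobarSign_cobarSign (a : C.cobarAlg) : C.cobarSign (C.cobarSign a) = a := by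
  induction a using TensorAlgebra.induction with
  | algebraMap r => simp [AlgHom.commutes]
  | ι x =>
    change C.cobarSign (C.cobarSign (C.gen x)) = C.gen x
    rw [cobarSign_gen, map_neg, cobarSign_gen, neg_neg, barSign_barSign]
  | mul a b ha hb => rw [map_mul, map_mul, ha, hb]
  | add a b ha hb => rw [map_add, map_add, ha, hb]

theorem cobarD_cobarSign (a : C.cobarAlg) :
    C.cobarD (C.cobarSign a) = - C.cobarSign (C.cobarD a) := by
  induction a using TensorAlgebra.induction with
  | algebraMap r => simp [AlgHom.commutes, cobarD_algebraMap]
  | ι x =>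
    change C.cobarD (C.cobarSign (C.gen x)) = - C.cobarSign (C.cobarD (C.gen x))
    rw [cobarSign_gen, map_neg, cobarD_gen, cobarD_gen, cobarDGen_apply, cobarDGen_apply,
      barD_barSign, barComul_barSign, map_add, map_neg, map_neg, cobarSign_gen]
    generalize C.barComul x = t
    congr 2
    induction t using TensorProduct.induction_on with
    | zero => simp only [map_zero]
    | tmul a b =>
      simp only [TensorProduct.map_tmul, LinearMap.comp_apply, LinearMap.mul'_apply, map_mul,
        cobarSign_gen, neg_mul_neg]
    | add s t hs ht => simp only [map_add, hs, ht]
  | mul a b ha hb =>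
    rw [map_mul, cobarD_mul, cobarD_mul, map_add, map_mul, map_mul, ha, hb]
    simp only [neg_mul, mul_neg, neg_add]
  | add a b ha hb => simp only [map_add, ha, hb, neg_add]

theorem cobarD_cobarD_gen (x : C.bar) : C.cobarD (C.cobarD (C.gen x)) = 0 := by
  rw [cobarD_gen, cobarDGen_apply, map_add, map_neg, cobarD_gen, cobarDGen_apply, barD_barD,
    map_zero, neg_zero, zero_add, barComul_barD]
  have h1 : ∀ t : C.bar ⊗[k] C.bar,
      C.cobarD (LinearMap.mul' k _ (TensorProduct.map (C.gen ∘ₗ C.barSign) C.gen t)) =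
      LinearMap.mul' k _ (TensorProduct.map (C.gen ∘ₗ C.barSign) C.gen
        (TensorProduct.map C.barD LinearMap.id t + TensorProduct.map C.barSign C.barD t)) +
      (LinearMap.mul' k _ (TensorProduct.map
        (LinearMap.mul' k _ ∘ₗ TensorProduct.map C.gen (C.gen ∘ₗ C.barSign)) C.gen
        (TensorProduct.map C.barComul LinearMap.id t)) -
      LinearMap.mul' k _ (TensorProduct.map C.gen
        (LinearMap.mul' k _ ∘ₗ TensorProduct.map (C.gen ∘ₗ C.barSign) C.gen)
        (TensorProduct.map LinearMap.id C.barComul t))) := by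
    intro t
    induction t using TensorProduct.induction_on with
    | zero => simp only [map_zero, add_zero, sub_zero]
    | add s t hs ht =>
      simp only [map_add] at hs ht ⊢
      rw [hs, ht]
      abel
    | tmul a b =>
      have h3 : LinearMap.mul' k _ (TensorProduct.map (C.gen ∘ₗ C.barSign) C.gen
          (TensorProduct.map C.barSign C.barSign (C.barComul a))) =
          LinearMap.mul' k _ (TensorProduct.map C.gen (C.gen ∘ₗ C.barSign) (C.barComul a)) := by
        generalize C.barComul a = s
        induction s using TensorProduct.induction_on with
        | zero => simp only [map_zero]
        | add s t hs ht => simp only [map_add, hs, ht]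
        | tmul c d =>
          simp only [TensorProduct.map_tmul, LinearMap.comp_apply, barSign_barSign]
      simp only [TensorProduct.map_tmul, LinearMap.comp_apply, LinearMap.mul'_apply,
        LinearMap.id_apply, cobarD_mul, cobarD_gen, cobarSign_gen, barSign_barSign, map_add,
        cobarDGen_apply, barD_barSign, barComul_barSign, map_neg, h3]
      noncomm_ring
  have h2 : LinearMap.mul' k _ (TensorProduct.map
        (LinearMap.mul' k _ ∘ₗ TensorProduct.map C.gen (C.gen ∘ₗ C.barSign)) C.gen
        (TensorProduct.map C.barComul LinearMap.id (C.barComul x))) =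
      LinearMap.mul' k _ (TensorProduct.map C.gen
        (LinearMap.mul' k _ ∘ₗ TensorProduct.map (C.gen ∘ₗ C.barSign) C.gen)
        (TensorProduct.map LinearMap.id C.barComul (C.barComul x))) := by
    rw [← show _ = TensorProduct.map LinearMap.id C.barComul (C.barComul x) from
      reducedComul_coassoc C.one C.one_groupLike x]
    change _ = LinearMap.mul' k _ (TensorProduct.map C.gen
        (LinearMap.mul' k _ ∘ₗ TensorProduct.map (C.gen ∘ₗ C.barSign) C.gen)
        (TensorProduct.assoc k _ _ _ (TensorProduct.map C.barComul LinearMap.id (C.barComul x))))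
    generalize TensorProduct.map C.barComul LinearMap.id (C.barComul x) = t
    induction t using TensorProduct.induction_on with
    | zero => simp only [map_zero]
    | add s t hs ht => simp only [map_add, hs, ht]
    | tmul a b =>
      induction a using TensorProduct.induction_on with
      | zero => simp only [map_zero, TensorProduct.zero_tmul]
      | add s t hs ht => simp only [map_add, TensorProduct.add_tmul, hs, ht]
      | tmul c d =>
        simp only [TensorProduct.map_tmul, LinearMap.comp_apply, LinearMap.mul'_apply,
          TensorProduct.assoc_tmul, mul_assoc]
  rw [h1, h2, sub_self, add_zero, neg_add_cancel]

theorem cobarD_cobarD (a : C.cobarAlg) : C.cobarD (C.cobarD a) = 0 := by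
  induction a using TensorAlgebra.induction with
  | algebraMap r => rw [cobarD_algebraMap, map_zero]
  | ι x => exact C.cobarD_cobarD_gen x
  | mul a b ha hb =>
    rw [cobarD_mul, map_add, cobarD_mul, cobarD_mul, ha, hb, cobarD_cobarSign]
    simp
  | add a b ha hb => rw [map_add, map_add, ha, hb, add_zero]

theorem IsWord.mul {C : DGC.{u, v} k} {m n : ℤ} {a b : C.cobarAlg} (ha : C.IsWord m a)
    (hb : C.IsWord n b) : C.IsWord (m + n) (a * b) := by
  induction ha with
  | one => simpa using hb
  | cons hx hw ih =>
    rw [mul_assoc, add_assoc]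
    exact IsWord.cons hx ih

theorem cobarGr_one : (1 : C.cobarAlg) ∈ C.cobarGr 0 := Submodule.subset_span IsWord.one

theorem cobarGr_gen {n : ℤ} {x : C.bar} (hx : x ∈ C.barGr n) : C.gen x ∈ C.cobarGr (n - 1) := by
  have := IsWord.cons hx (IsWord.one (C := C))
  rw [add_zero, mul_one] at this
  exact Submodule.subset_span this

theorem cobarGr_mul {m n : ℤ} {a b : C.cobarAlg} (ha : a ∈ C.cobarGr m) (hb : b ∈ C.cobarGr n) :
    a * b ∈ C.cobarGr (m + n) := by
  have := Submodule.mul_mem_mul ha hb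
  rw [cobarGr, cobarGr, Submodule.span_mul_span] at this
  refine Submodule.span_mono ?_ this
  rintro _ ⟨a, ha, b, hb, rfl⟩
  exact IsWord.mul ha hb

theorem cobarGr_induction {C : DGC.{u, v} k} {n : ℤ} {P : ∀ a : C.cobarAlg, a ∈ C.cobarGr n → Prop}
    (word : ∀ w (hw : C.IsWord n w), P w (Submodule.subset_span hw))
    (zero : P 0 (zero_mem _))
    (add : ∀ a b ha hb, P a ha → P b hb → P (a + b) (add_mem ha hb))
    (smul : ∀ (c : k) a ha, P a ha → P (c • a) (Submodule.smul_mem _ c ha))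
    {a : C.cobarAlg} (ha : a ∈ C.cobarGr n) : P a ha := by
  induction ha using Submodule.span_induction with
  | mem x h => exact word x h
  | zero => exact zero
  | add x y hx hy h1 h2 => exact add x y hx hy h1 h2
  | smul c x hx h1 => exact smul c x hx h1

instance cobarGr_gradedMonoid : SetLike.GradedMonoid C.cobarGr where
  one_mem := C.cobarGr_one
  mul_mem _ _ _ _ ha hb := C.cobarGr_mul ha hb

/-- The decomposition of a generator into homogeneous components. -/
noncomputable def cobarSplitGen : C.bar →ₗ[k] ⨁ n, C.cobarGr n :=
  DirectSum.toModule k ℤ _ (fun n => DirectSum.lof k ℤ (fun i => C.cobarGr i) (n - 1) ∘ₗ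
    (C.gen.restrict (fun _ hx => C.cobarGr_gen hx) : C.barGr n →ₗ[k] C.cobarGr (n - 1))) ∘ₗ
    (sumEquiv C.barGr_isInternal).symm.toLinearMap

theorem cobarSplitGen_of_mem {n : ℤ} {x : C.bar} (hx : x ∈ C.barGr n) : C.cobarSplitGen x =
    DirectSum.of (fun i => C.cobarGr i) (n - 1) ⟨C.gen x, C.cobarGr_gen hx⟩ := by
  simp only [cobarSplitGen, LinearMap.comp_apply, LinearEquiv.coe_coe,
    sumEquiv_symm_of_mem C.barGr_isInternal hx, DirectSum.toModule_lof]
  rfl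

theorem cobarSplit_word {n : ℤ} {w : C.cobarAlg} (hw : C.IsWord n w) :
    TensorAlgebra.lift k C.cobarSplitGen w =
      DirectSum.of (fun i => C.cobarGr i) n ⟨w, Submodule.subset_span hw⟩ := by
  induction hw with
  | one => rw [map_one]; rfl
  | cons hx hw ih =>
    rw [map_mul, TensorAlgebra.lift_ι_apply, cobarSplitGen_of_mem C hx, ih, DirectSum.of_mul_of]
    rfl

theorem cobarGr_isInternal : DirectSum.IsInternal C.cobarGr := by
  refine isInternal_of_decomp (TensorAlgebra.lift k C.cobarSplitGen).toLinearMap ?_ ?_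
  · intro a
    have : (DirectSum.coeAlgHom C.cobarGr).comp (TensorAlgebra.lift k C.cobarSplitGen) =
        AlgHom.id k _ := by
      apply TensorAlgebra.hom_ext
      ext x
      simp only [LinearMap.comp_apply, AlgHom.toLinearMap_apply, AlgHom.comp_apply,
        TensorAlgebra.lift_ι_apply, AlgHom.id_apply]
      induction C.proj x using graded_induction C.barGr_isInternal with
      | hom n x hx => rw [cobarSplitGen_of_mem C hx, DirectSum.coeAlgHom_of]
      | add x y h1 h2 => rw [map_add, map_add, map_add, h1, h2]
    exact AlgHom.congr_fun this a
  · intro n a ha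
    have h : ∃ ha : a ∈ C.cobarGr n, (TensorAlgebra.lift k C.cobarSplitGen) a =
        DirectSum.lof k ℤ (fun i => C.cobarGr i) n ⟨a, ha⟩ := by
      induction ha using cobarGr_induction with
      | word w hw => exact ⟨_, C.cobarSplit_word hw⟩
      | zero => exact ⟨zero_mem _, by rw [map_zero]; exact (map_zero _).symm⟩
      | add a b _ _ ha hb =>
        obtain ⟨ha, h1⟩ := ha
        obtain ⟨hb, h2⟩ := hb
        exact ⟨add_mem ha hb, by rw [map_add, h1, h2, ← map_add]; rfl⟩
      | smul c a _ ha =>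
        obtain ⟨ha, h1⟩ := ha
        exact ⟨Submodule.smul_mem _ c ha, by rw [map_smul, h1, ← map_smul]; rfl⟩
    exact h.2

theorem cobarSign_of_mem {n : ℤ} {a : C.cobarAlg} (ha : a ∈ C.cobarGr n) :
    C.cobarSign a = koszulSign k n • a := by
  induction ha using cobarGr_induction with
  | word w hw =>
    induction hw with
    | one => simp
    | cons hx hw ih =>
      rw [map_mul, cobarSign_gen, C.barSign_of_mem hx, ih, koszulSign_add, koszulSign_sub_one,
        map_smul, ← neg_smul, smul_mul_smul_comm]
  | zero => simp
  | add a b _ _ ha hb => rw [map_add, ha, hb, smul_add]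
  | smul c a _ ha => rw [map_smul, ha, smul_comm]

theorem cobarD_gen_mem {n : ℤ} {x : C.bar} (hx : x ∈ C.barGr n) :
    C.cobarD (C.gen x) ∈ C.cobarGr (n - 1 - 1) := by
  rw [cobarD_gen, cobarDGen_apply]
  refine add_mem (neg_mem (C.cobarGr_gen (C.barD_mem hx))) ?_
  have ht := C.barComul_mem hx
  generalize C.barComul x = t at ht ⊢
  induction ht using tensorDeg_induction with
  | hom p a b ha hb =>
    rw [TensorProduct.map_tmul, LinearMap.mul'_apply, LinearMap.comp_apply, C.barSign_of_mem ha,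
      map_smul, smul_mul_assoc]
    have := C.cobarGr_mul (C.cobarGr_gen ha) (C.cobarGr_gen hb)
    rw [show p - 1 + (n - p - 1) = n - 1 - 1 by ring] at this
    exact Submodule.smul_mem _ _ this
  | h0 => simp only [map_zero]; exact zero_mem _
  | add s t _ _ h1 h2 => simp only [map_add]; exact add_mem h1 h2

theorem cobarD_mem {n : ℤ} {a : C.cobarAlg} (ha : a ∈ C.cobarGr n) :
    C.cobarD a ∈ C.cobarGr (n - 1) := by
  induction ha using cobarGr_induction with
  | word w hw =>
    induction hw with
    | one => rw [cobarD_one]; exact zero_mem _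
    | @cons m n x w hx hw ih =>
      rw [cobarD_mul]
      refine add_mem ?_ ?_
      · have := C.cobarGr_mul (C.cobarD_gen_mem hx) (Submodule.subset_span hw)
        rwa [show m - 1 - 1 + n = m - 1 + n - 1 by ring] at this
      · rw [C.cobarSign_of_mem (C.cobarGr_gen hx), smul_mul_assoc]
        have := C.cobarGr_mul (C.cobarGr_gen hx) ih
        rw [show m - 1 + (n - 1) = m - 1 + n - 1 by ring] at this
        exact Submodule.smul_mem _ _ this
  | zero => rw [map_zero]; exact zero_mem _
  | add a b _ _ ha hb => rw [map_add]; exact add_mem ha hb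
  | smul c a _ ha => rw [map_smul]; exact Submodule.smul_mem _ c ha

/-- The augmentation of the cobar construction, vanishing on generators. -/
noncomputable def cobarAug : C.cobarAlg →ₐ[k] k := TensorAlgebra.algebraMapInv

theorem cobarAug_gen (x : C.bar) : C.cobarAug (C.gen x) = 0 := by
  simp [cobarAug, TensorAlgebra.algebraMapInv]

theorem cobarAug_cobarD (a : C.cobarAlg) : C.cobarAug (C.cobarD a) = 0 := by
  have hs : ∀ a, C.cobarAug (C.cobarSign a) = C.cobarAug a := by
    intro a
    induction a using TensorAlgebra.induction with
    | algebraMap r => rw [AlgHom.commutes]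
    | ι x =>
      change C.cobarAug (C.cobarSign (C.gen x)) = C.cobarAug (C.gen x)
      rw [cobarSign_gen, map_neg, cobarAug_gen, cobarAug_gen, neg_zero]
    | mul a b ha hb => rw [map_mul, map_mul, map_mul, ha, hb]
    | add a b ha hb => rw [map_add, map_add, map_add, ha, hb]
  induction a using TensorAlgebra.induction with
  | algebraMap r => rw [cobarD_algebraMap, map_zero]
  | ι x =>
    change C.cobarAug (C.cobarD (C.gen x)) = 0
    rw [cobarD_gen, cobarDGen_apply, map_add, map_neg, cobarAug_gen, neg_zero, zero_add]
    generalize C.barComul x = t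
    induction t using TensorProduct.induction_on with
    | zero => simp only [map_zero]
    | tmul a b =>
      rw [TensorProduct.map_tmul, LinearMap.mul'_apply, map_mul, cobarAug_gen, mul_zero]
    | add s t hs ht => simp only [map_add, hs, ht, add_zero]
  | mul a b ha hb => rw [cobarD_mul, map_add, map_mul, map_mul, ha, hb, zero_mul, mul_zero, add_zero]
  | add a b ha hb => rw [map_add, map_add, ha, hb, add_zero]

theorem cobarAug_of_mem {n : ℤ} (hn : n ≠ 0) {a : C.cobarAlg} (ha : a ∈ C.cobarGr n) :
    C.cobarAug a = 0 := by
  induction ha using cobarGr_induction with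
  | word w hw =>
    cases hw with
    | one => exact absurd rfl hn
    | cons hx hw => rw [map_mul, cobarAug_gen, zero_mul]
  | zero => rw [map_zero]
  | add a b _ _ ha hb => rw [map_add, ha, hb, add_zero]
  | smul c a _ ha => rw [map_smul, ha, smul_zero]

/-- The cobar construction `Ω C = (T(s⁻¹ C̄), D)` of a dg coalgebra. -/
noncomputable def cobarObj : DGA.{u, max u v} k where
  carrier := C.cobarAlg
  gr := C.cobarGr
  isInternal := C.cobarGr_isInternal
  one_mem := C.cobarGr_one
  mul_mem _ _ _ _ ha hb := C.cobarGr_mul ha hb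
  d := C.cobarD
  d_mem _ _ ha := C.cobarD_mem ha
  d_d := C.cobarD_cobarD
  leibniz n a b ha := by rw [cobarD_mul, C.cobarSign_of_mem ha, smul_mul_assoc]
  aug := C.cobarAug
  aug_of_mem _ _ hn ha := C.cobarAug_of_mem hn ha
  aug_d := C.cobarAug_cobarD

end Objects

section Maps

variable {C D : DGC.{u, v} k}

/-- The map induced by a morphism of dg coalgebras on cokernels of the coaugmentations. -/
def barMap (f : C ⟶ D) : C.bar →ₗ[k] D.bar :=
  Submodule.mapQ _ _ (Hom.toLinearMap f) (by
    rw [Submodule.span_singleton_le_iff_mem, Submodule.mem_comap, Hom.map_one f]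
    exact Submodule.mem_span_singleton_self _)

theorem barMap_proj (f : C ⟶ D) (x : C.carrier) :
    barMap f (C.proj x) = D.proj (Hom.toLinearMap f x) := rfl

theorem barMap_mem (f : C ⟶ D) {n : ℤ} {x : C.bar} (hx : x ∈ C.barGr n) :
    barMap f x ∈ D.barGr n := by
  obtain ⟨x, hx, rfl⟩ := hx
  exact Submodule.mem_map_of_mem (Hom.map_mem f n x hx)

theorem barMap_barSign (f : C ⟶ D) (x : C.bar) :
    barMap f (C.barSign x) = D.barSign (barMap f x) := by
  induction x using graded_induction C.barGr_isInternal with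
  | hom n x hx => rw [C.barSign_of_mem hx, map_smul, D.barSign_of_mem (barMap_mem f hx)]
  | add x y h1 h2 => simp only [map_add, h1, h2]

theorem barMap_barD (f : C ⟶ D) (x : C.bar) : barMap f (C.barD x) = D.barD (barMap f x) := by
  obtain ⟨x, rfl⟩ := Submodule.mkQ_surjective _ x
  rw [barD_proj, barMap_proj, barMap_proj, barD_proj, Hom.map_d f]

theorem barMap_barComul (f : C ⟶ D) (x : C.bar) : D.barComul (barMap f x) =
    TensorProduct.map (barMap f) (barMap f) (C.barComul x) := by
  obtain ⟨x, rfl⟩ := Submodule.mkQ_surjective _ x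
  rw [barMap_proj, barComul_proj, barComul_proj, Hom.map_comul f]
  generalize (Coalgebra.comul x : C.carrier ⊗[k] C.carrier) = t
  induction t using TensorProduct.induction_on with
  | zero => simp only [map_zero]
  | tmul a b => simp only [TensorProduct.map_tmul, barMap_proj]
  | add s t hs ht => simp only [map_add, hs, ht]

/-- The algebra map `T(s⁻¹ C̄) → T(s⁻¹ D̄)` induced by a morphism of dg coalgebras. -/
noncomputable def cobarAlgMap (f : C ⟶ D) : C.cobarAlg →ₐ[k] D.cobarAlg :=
  TensorAlgebra.lift k (D.gen ∘ₗ barMap f)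

theorem cobarAlgMap_gen (f : C ⟶ D) (x : C.bar) :
    cobarAlgMap f (C.gen x) = D.gen (barMap f x) := by simp [cobarAlgMap]

theorem cobarAlgMap_cobarSign (f : C ⟶ D) (a : C.cobarAlg) :
    cobarAlgMap f (C.cobarSign a) = D.cobarSign (cobarAlgMap f a) := by
  induction a using TensorAlgebra.induction with
  | algebraMap r => simp only [AlgHom.commutes]
  | ι x =>
    change cobarAlgMap f (C.cobarSign (C.gen x)) = D.cobarSign (cobarAlgMap f (C.gen x))
    rw [cobarSign_gen, map_neg, cobarAlgMap_gen, cobarAlgMap_gen, cobarSign_gen, barMap_barSign]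
  | mul a b ha hb => simp only [map_mul, ha, hb]
  | add a b ha hb => simp only [map_add, ha, hb]

theorem cobarAlgMap_cobarD (f : C ⟶ D) (a : C.cobarAlg) :
    cobarAlgMap f (C.cobarD a) = D.cobarD (cobarAlgMap f a) := by
  induction a using TensorAlgebra.induction with
  | algebraMap r => rw [cobarD_algebraMap, AlgHom.commutes, cobarD_algebraMap, map_zero]
  | ι x =>
    change cobarAlgMap f (C.cobarD (C.gen x)) = D.cobarD (cobarAlgMap f (C.gen x))
    rw [cobarD_gen, cobarAlgMap_gen, cobarD_gen, cobarDGen_apply, cobarDGen_apply, map_add,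
      map_neg, cobarAlgMap_gen, barMap_barD, barMap_barComul]
    congr 1
    generalize C.barComul x = t
    induction t using TensorProduct.induction_on with
    | zero => simp only [map_zero]
    | tmul a b =>
      simp only [TensorProduct.map_tmul, LinearMap.mul'_apply, LinearMap.comp_apply, map_mul,
        cobarAlgMap_gen, barMap_barSign]
    | add s t hs ht => simp only [map_add, hs, ht]
  | mul a b ha hb =>
    rw [cobarD_mul, map_add, map_mul, map_mul, map_mul, cobarD_mul, ha, hb, cobarAlgMap_cobarSign]
  | add a b ha hb => simp only [map_add, ha, hb]

theorem cobarAlgMap_mem (f : C ⟶ D) {n : ℤ} {a : C.cobarAlg} (ha : a ∈ C.cobarGr n) :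
    cobarAlgMap f a ∈ D.cobarGr n := by
  induction ha using cobarGr_induction with
  | word w hw =>
    induction hw with
    | one => rw [map_one]; exact D.cobarGr_one
    | cons hx hw ih =>
      rw [map_mul, cobarAlgMap_gen]
      exact D.cobarGr_mul (D.cobarGr_gen (barMap_mem f hx)) ih
  | zero => rw [map_zero]; exact zero_mem _
  | add a b _ _ ha hb => rw [map_add]; exact add_mem ha hb
  | smul c a _ ha => rw [map_smul]; exact Submodule.smul_mem _ c ha

theorem cobarAlgMap_aug (f : C ⟶ D) (a : C.cobarAlg) :
    D.cobarAug (cobarAlgMap f a) = C.cobarAug a := by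
  induction a using TensorAlgebra.induction with
  | algebraMap r => simp only [AlgHom.commutes]
  | ι x =>
    change D.cobarAug (cobarAlgMap f (C.gen x)) = C.cobarAug (C.gen x)
    rw [cobarAlgMap_gen, cobarAug_gen, cobarAug_gen]
  | mul a b ha hb => simp only [map_mul, ha, hb]
  | add a b ha hb => simp only [map_add, ha, hb]

end Maps

/-- The cobar functor `Ω` from dg coalgebras to augmented dg algebras. -/
noncomputable def cobar (k : Type u) [CommRing k] : DGC.{u, v} k ⥤ DGA.{u, max u v} k where
  obj C := C.cobarObj
  map f :=
    { toAlgHom := cobarAlgMap f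
      map_mem := fun _ _ ha => cobarAlgMap_mem f ha
      map_d := cobarAlgMap_cobarD f
      map_aug := cobarAlgMap_aug f }
  map_id C := by
    apply DGA.Hom.ext
    apply TensorAlgebra.hom_ext
    apply LinearMap.ext
    intro x
    obtain ⟨x, rfl⟩ := Submodule.mkQ_surjective _ x
    exact cobarAlgMap_gen (𝟙 C) _
  map_comp {C D E} f g := by
    apply DGA.Hom.ext
    apply TensorAlgebra.hom_ext
    apply LinearMap.ext
    intro x
    obtain ⟨x, rfl⟩ := Submodule.mkQ_surjective _ x
    change cobarAlgMap (f ≫ g) (C.gen (C.proj x)) =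
      cobarAlgMap g (cobarAlgMap f (C.gen (C.proj x)))
    simp only [cobarAlgMap_gen]
    rfl

/-- A morphism of dg coalgebras is an `Ω`-quasi-isomorphism if its image under the cobar
functor is a quasi-isomorphism. -/
def IsOmegaQuasiIso {C D : DGC.{u, v} k} (f : C ⟶ D) : Prop :=
  DGA.IsQuasiIso ((cobar k).map f)

/-- Two dg coalgebras are `Ω`-quasi-isomorphic if they are connected by a finite zig-zag of
`Ω`-quasi-isomorphisms of dg coalgebras. -/
def OmegaQuasiIsomorphic (C D : DGC.{u, v} k) : Prop :=
  Relation.EqvGen (fun C' D' : DGC.{u, v} k => ∃ f : C' ⟶ D', IsOmegaQuasiIso f) C D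

end DGC

/-! ### Normalized chains on a simplicial set -/

namespace NormChains

/-- The `n`-simplices of a simplicial set. -/
abbrev Simplex (S : SSet.{w}) (n : ℕ) : Type w := S.obj (op (SimplexCategory.mk n))

variable (k : Type u) [CommRing k] (S : SSet.{w})

/-- The module of normalized chains (in all degrees): the free module on all simplices modulo
the submodule generated by the degenerate ones. -/
def Carrier : Type (max u w) :=
  ((Σ n : ℕ, Simplex S n) →₀ k) ⧸ Submodule.span k
    {c : (Σ n : ℕ, Simplex S n) →₀ k | ∃ (n : ℕ) (x : Simplex S n), x ∈ S.degenerate n ∧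
      c = Finsupp.single ⟨n, x⟩ 1}

noncomputable instance : AddCommGroup (Carrier k S) :=
  inferInstanceAs (AddCommGroup (_ ⧸ Submodule.span k _))

noncomputable instance : Module k (Carrier k S) :=
  inferInstanceAs (Module k (_ ⧸ Submodule.span k _))

variable {S}

/-- The class of a simplex. -/
noncomputable def cls (n : ℕ) (x : Simplex S n) : Carrier k S :=
  Submodule.Quotient.mk (Finsupp.single ⟨n, x⟩ 1)

theorem cls_degenerate {n : ℕ} {x : Simplex S n} (hx : x ∈ S.degenerate n) : cls k n x = 0 :=
  (Submodule.Quotient.mk_eq_zero _).mpr (Submodule.subset_span ⟨n, x, hx, rfl⟩)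

variable {k}
variable {W : Type*} [AddCommGroup W] [Module k W]

/-- A linear map out of the normalized chains is given by its values on simplices,
which have to vanish on degenerate simplices. -/
noncomputable def lift (f : ∀ n, Simplex S n → W) (hf : ∀ n x, x ∈ S.degenerate n → f n x = 0) :
    Carrier k S →ₗ[k] W :=
  Submodule.liftQ _ (Finsupp.linearCombination k (fun p : Σ n : ℕ, Simplex S n => f p.1 p.2)) (by
    rw [Submodule.span_le]
    rintro _ ⟨n, x, hx, rfl⟩
    simp [hf n x hx])

theorem lift_cls (f : ∀ n, Simplex S n → W) (hf : ∀ n x, x ∈ S.degenerate n → f n x = 0)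
    (n : ℕ) (x : Simplex S n) : lift f hf (cls k n x) = f n x := by
  change Finsupp.linearCombination k _ _ = _
  simp

theorem induction {P : Carrier k S → Prop} (cl : ∀ n x, P (cls k n x)) (zero : P 0)
    (add : ∀ a b, P a → P b → P (a + b)) (smul : ∀ (c : k) a, P a → P (c • a))
    (a : Carrier k S) : P a := by
  obtain ⟨a, rfl⟩ := Submodule.Quotient.mk_surjective _ a
  induction a using Finsupp.induction_linear with
  | zero => exact zero
  | add f g hf hg => exact add _ _ hf hg
  | single p c =>
    have h : Finsupp.single p c = c • Finsupp.single p (1 : k) := by simp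
    rw [h]
    exact smul c (cls k p.1 p.2) (cl p.1 p.2)

theorem hom_ext {f g : Carrier k S →ₗ[k] W} (h : ∀ n x, f (cls k n x) = g (cls k n x)) : f = g := by
  ext a
  induction a using induction with
  | cl n x => exact h n x
  | zero => simp
  | add a b ha hb => rw [map_add, map_add, ha, hb]
  | smul c a ha => rw [map_smul, map_smul, ha]

/-- The inclusion of the front face spanned by the vertices `0, …, p`. -/
def front (n : ℕ) (p : Fin (n + 1)) : SimplexCategory.mk ((p : ℕ)) ⟶ SimplexCategory.mk n :=
  SimplexCategory.mkHom
    { toFun := fun j => ⟨j, by have := j.2; have := p.2; omega⟩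
      monotone' := fun _ _ h => h }

/-- The inclusion of the back face spanned by the vertices `p, …, n`. -/
def back (n : ℕ) (p : Fin (n + 1)) : SimplexCategory.mk (n - (p : ℕ)) ⟶ SimplexCategory.mk n :=
  SimplexCategory.mkHom
    { toFun := fun j => ⟨p + j, by have := j.2; have := p.2; omega⟩
      monotone' := fun a b h => by
        have h : (a : ℕ) ≤ b := h
        simp only [Fin.mk_le_mk]
        omega }

variable (k)

/-- The boundary of a simplex: the alternating sum of its faces. -/
noncomputable def bdry : ∀ n : ℕ, Simplex S n → Carrier k S
  | 0, _ => 0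
  | n + 1, x => ∑ i : Fin (n + 2), (-1 : k) ^ (i : ℕ) • cls k n (S.δ i x)

/-- The Alexander-Whitney diagonal of a simplex. -/
noncomputable def diag (n : ℕ) (x : Simplex S n) : Carrier k S ⊗[k] Carrier k S :=
  ∑ p : Fin (n + 1), cls k p (S.map (front n p).op x) ⊗ₜ cls k (n - p) (S.map (back n p).op x)

/-! Auxiliary: faces of `x` indexed by functions on natural numbers. -/

/-- `f` restricts to a monotone map `{0, …, m} → {0, …, n}`. -/
def Valid (m n : ℕ) (f : ℕ → ℕ) : Prop := ∀ i j, i ≤ j → j ≤ m → f i ≤ f j ∧ f j ≤ n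

/-- The map of simplices given by a valid function. -/
def toHom {m n : ℕ} {f : ℕ → ℕ} (h : Valid m n f) : SimplexCategory.mk m ⟶ SimplexCategory.mk n :=
  SimplexCategory.mkHom
    { toFun := fun j => ⟨f j, by have := (h j j le_rfl (by have := j.2; omega)).2; omega⟩
      monotone' := fun a b hab => (h a b hab (by have := b.2; omega)).1 }

open Classical in
/-- The simplex of the normalized chains obtained from `x` along `f`. -/
noncomputable def cell {n : ℕ} (x : Simplex S n) (m : ℕ) (f : ℕ → ℕ) : Carrier k S :=
  if h : Valid m n f then cls k m (S.map (toHom h).op x) else 0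

/-- The function on natural numbers underlying a map of simplices. -/
def fn {m n : ℕ} (φ : SimplexCategory.mk m ⟶ SimplexCategory.mk n) (i : ℕ) : ℕ :=
  if h : i < m + 1 then (φ.toOrderHom ⟨i, h⟩ : ℕ) else 0

theorem valid_fn {m n : ℕ} (φ : SimplexCategory.mk m ⟶ SimplexCategory.mk n) : Valid m n (fn φ) := by
  intro i j hij hj
  have hi' : i < m + 1 := by omega
  have hj' : j < m + 1 := by omega
  simp only [fn, hi', hj', dif_pos]
  refine ⟨φ.toOrderHom.monotone (show (⟨i, hi'⟩ : Fin (m + 1)) ≤ ⟨j, hj'⟩ from hij), ?_⟩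
  have := (φ.toOrderHom ⟨j, hj'⟩).2
  exact Nat.lt_succ_iff.mp this

theorem toHom_fn {m n : ℕ} (φ : SimplexCategory.mk m ⟶ SimplexCategory.mk n) : toHom (valid_fn φ) = φ := by
  ext j
  change fn φ (j : ℕ) = (φ.toOrderHom j : ℕ)
  rw [fn, dif_pos (show (j : ℕ) < m + 1 from j.2)]

theorem valid_congr {m n : ℕ} {f g : ℕ → ℕ} (h : ∀ j ≤ m, f j = g j) (hf : Valid m n f) :
    Valid m n g := by
  intro i j hij hj
  rw [← h i (by omega), ← h j hj]
  exact hf i j hij hj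

theorem cell_congr {n : ℕ} (x : Simplex S n) {m m' : ℕ} {f g : ℕ → ℕ} (hm : m = m')
    (h : ∀ j ≤ m, f j = g j) : cell k x m f = cell k x m' g := by
  subst hm
  by_cases hf : Valid m n f
  · have hg := valid_congr h hf
    have he : toHom hf = toHom hg := by
      ext j
      exact h j (Nat.lt_succ_iff.mp j.2)
    rw [cell, dif_pos hf, cell, dif_pos hg, he]
  · have hg : ¬ Valid m n g := fun hg => hf (valid_congr (fun j hj => (h j hj).symm) hg)
    rw [cell, dif_neg hf, cell, dif_neg hg]

theorem cls_map {n m : ℕ} (x : Simplex S n) (φ : SimplexCategory.mk m ⟶ SimplexCategory.mk n) :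
    cls k m (S.map φ.op x) = cell k x m (fn φ) := by
  rw [cell, dif_pos (valid_fn φ), toHom_fn]

theorem cls_eq {n : ℕ} (x : Simplex S n) : cls k n x = cell k x n (fun j => j) := by
  have h : cls k n x = cell k x n (fn (𝟙 (SimplexCategory.mk n))) := by
    rw [← cls_map]
    simp
  refine h.trans (cell_congr k x rfl fun j hj => ?_)
  simp only [fn, Nat.lt_succ_of_le hj, dif_pos]
  rfl

theorem cell_map {n m p : ℕ} (x : Simplex S n) (φ : SimplexCategory.mk m ⟶ SimplexCategory.mk n) {f : ℕ → ℕ} (hf : Valid p m f) :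
    cell k (S.map φ.op x) p f = cell k x p (fun j => fn φ (f j)) := by
  rw [cell, dif_pos hf]
  have : S.map (toHom hf).op (S.map φ.op x) = S.map (toHom hf ≫ φ).op x := by simp
  rw [this, cls_map]
  refine cell_congr k x rfl fun j hj => ?_
  have h1 := (hf j j le_rfl hj).2
  simp only [fn, Nat.lt_succ_of_le hj, Nat.lt_succ_of_le h1, dif_pos]
  rfl

theorem cell_degenerate {n m : ℕ} (x : Simplex S n) {f : ℕ → ℕ} {i : ℕ} (hi : i + 1 ≤ m)
    (h : f i = f (i + 1)) : cell k x m f = 0 := by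
  by_cases hf : Valid m n f
  · obtain ⟨m, rfl⟩ : ∃ m', m = m' + 1 := ⟨m - 1, by omega⟩
    rw [cell, dif_pos hf]
    apply cls_degenerate
    have hg : Valid m n (fun j => if j ≤ i then f j else f (j + 1)) := by
      intro a b hab hb
      by_cases h1 : a ≤ i <;> by_cases h2 : b ≤ i <;> simp only [h1, h2, if_true, if_false]
      · exact hf a b hab (by omega)
      · exact hf a (b + 1) (by omega) (by omega)
      · omega
      · exact hf (a + 1) (b + 1) (by omega) (by omega)
    have hs : Valid (m + 1) m (fun j => if j ≤ i then j else j - 1) := by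
      intro a b hab hb
      by_cases h1 : a ≤ i <;> by_cases h2 : b ≤ i <;> simp only [h1, h2, if_true, if_false] <;> omega
    have hcalc : ∀ j : ℕ, (if (if j ≤ i then j else j - 1) ≤ i then
        f (if j ≤ i then j else j - 1) else f ((if j ≤ i then j else j - 1) + 1)) = f j := by
      intro j
      by_cases h1 : j ≤ i
      · simp only [h1, if_true]
      · by_cases h2 : j = i + 1
        · simp [h2, h]
        · have h3 : ¬ (j - 1 ≤ i) := by omega
          simp only [h1, h3, if_false]
          congr 1
          omega
    refine ⟨m, by omega, toHom hs, S.map (toHom hg).op x, ?_⟩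
    have : S.map (toHom hs).op (S.map (toHom hg).op x) = S.map (toHom hs ≫ toHom hg).op x := by simp
    rw [this]
    have he : toHom hs ≫ toHom hg = toHom hf := by
      ext j
      exact hcalc j
    rw [he]
  · rw [cell, dif_neg hf]
/-- The function skipping the value `i`. -/
def skip (i j : ℕ) : ℕ := if j < i then j else j + 1

theorem valid_skip (n i : ℕ) : Valid n (n + 1) (skip i) := by
  intro a b hab hb
  simp only [skip]
  split_ifs <;> omega

theorem valid_id {p n : ℕ} (h : p ≤ n) : Valid p n (fun j => j) :=
  fun _ _ hij hj => ⟨hij, le_trans hj h⟩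

theorem valid_shift {p m n : ℕ} (h : p + m ≤ n) : Valid m n (fun j => p + j) :=
  fun _ _ _ _ => ⟨by dsimp only; omega, by dsimp only; omega⟩

theorem bdry_succ {n : ℕ} (x : Simplex S (n + 1)) :
    bdry k (n + 1) x = ∑ i ∈ Finset.range (n + 2), (-1 : k) ^ i • cell k x n (skip i) := by
  rw [bdry, Finset.sum_range]
  refine Finset.sum_congr rfl fun i _ => ?_
  congr 1
  change cls k n (S.map (SimplexCategory.δ i).op x) = _
  rw [cls_map]
  refine cell_congr k x rfl fun j hj => ?_
  simp only [fn, Nat.lt_succ_of_le hj, dif_pos, skip]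
  change ((Fin.succAbove i ⟨j, Nat.lt_succ_of_le hj⟩ : Fin (n + 2)) : ℕ) = _
  simp only [Fin.succAbove, Fin.lt_def, Fin.val_castSucc]
  split_ifs <;> rfl

theorem diag_eq {n : ℕ} (x : Simplex S n) :
    diag k n x = ∑ p ∈ Finset.range (n + 1),
      cell k x p (fun j => j) ⊗ₜ cell k x (n - p) (fun j => p + j) := by
  rw [diag, Finset.sum_range]
  refine Finset.sum_congr rfl fun p _ => ?_
  rw [cls_map, cls_map]
  congr 1
  · refine cell_congr k x rfl fun j hj => ?_
    simp only [fn, Nat.lt_succ_of_le hj, dif_pos]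
    rfl
  · refine cell_congr k x rfl fun j hj => ?_
    simp only [fn, Nat.lt_succ_of_le hj, dif_pos]
    rfl

theorem exists_stationary {n m : ℕ} (h : m < n) {f : ℕ → ℕ} (hf : Valid n m f) :
    ∃ i, i + 1 ≤ n ∧ f i = f (i + 1) := by
  by_contra hc
  push Not at hc
  have : ∀ i ≤ n, i ≤ f i := by
    intro i
    induction i with
    | zero => intro _; omega
    | succ i ih =>
      intro hi
      have h1 := ih (by omega)
      have h2 := hc i hi
      have h3 := (hf i (i + 1) (by omega) hi).1
      omega
  have h1 := this n le_rfl
  have h2 := (hf n n le_rfl le_rfl).2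
  omega

theorem bdry_degenerate (n : ℕ) (x : Simplex S n) (hx : x ∈ S.degenerate n) : bdry k n x = 0 := by
  obtain ⟨m, hm, φ, y, rfl⟩ := hx
  obtain ⟨i, hi, hs⟩ := exists_stationary hm (valid_fn φ)
  obtain ⟨n, rfl⟩ : ∃ n', n = n' + 1 := ⟨n - 1, by omega⟩
  rw [bdry_succ]
  simp only [cell_map k y φ (valid_skip n _)]
  rw [← Finset.sum_subset (s₁ := {i, i + 1})]
  · rw [Finset.sum_pair (by omega), pow_succ]
    rw [cell_congr k y rfl (g := fun j => fn φ (skip (i + 1) j))]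
    · simp
    · intro j hj
      simp only [skip]
      rcases lt_trichotomy j i with h | h | h
      · rw [if_pos h, if_pos (by omega)]
      · subst h
        simp [hs]
      · rw [if_neg (by omega), if_neg (by omega)]
  · intro j hj
    simp only [Finset.mem_insert, Finset.mem_singleton, Finset.mem_range] at hj ⊢
    omega
  · intro j hj hj'
    simp only [Finset.mem_insert, Finset.mem_singleton, Finset.mem_range, not_or] at hj hj'
    rcases lt_or_gt_of_ne hj'.1 with h | h
    · rw [cell_degenerate k y (i := i - 1), smul_zero]
      · omega
      · simp only [skip]
        rw [if_neg (by omega), if_neg (by omega), show i - 1 + 1 = i by omega, hs]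
    · rw [cell_degenerate k y (i := i), smul_zero]
      · omega
      · simp only [skip]
        rw [if_pos (by omega), if_pos (by omega), hs]

theorem diag_degenerate (n : ℕ) (x : Simplex S n) (hx : x ∈ S.degenerate n) : diag k n x = 0 := by
  obtain ⟨m, hm, φ, y, rfl⟩ := hx
  obtain ⟨i, hi, hs⟩ := exists_stationary hm (valid_fn φ)
  rw [diag_eq]
  refine Finset.sum_eq_zero fun p hp => ?_
  rw [Finset.mem_range] at hp
  rw [cell_map k y φ (valid_id (by omega)), cell_map k y φ (valid_shift (by omega))]
  by_cases h : i + 1 ≤ p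
  · rw [cell_degenerate k y h hs, TensorProduct.zero_tmul]
  · rw [cell_degenerate k y (i := i - p) (m := n - p), TensorProduct.tmul_zero]
    · omega
    · rw [show p + (i - p) = i by omega, show p + (i - p + 1) = i + 1 by omega, hs]

variable (S)

/-- The differential on normalized chains. -/
noncomputable def d : Carrier k S →ₗ[k] Carrier k S := lift (bdry k) (bdry_degenerate k)

/-- The Alexander-Whitney coproduct on normalized chains. -/
noncomputable def comul : Carrier k S →ₗ[k] Carrier k S ⊗[k] Carrier k S :=
  lift (diag k) (diag_degenerate k)

/-- The counit on normalized chains: `0`-simplices go to `1`, all others to `0`. -/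
noncomputable def counit : Carrier k S →ₗ[k] k :=
  lift (fun n _ => if n = 0 then 1 else 0) (by
    intro n x hx
    rw [if_neg]
    rintro rfl
    rw [SSet.degenerate_zero] at hx
    exact hx)

/-- The grading of normalized chains by dimension. -/
noncomputable def gr (n : ℤ) : Submodule k (Carrier k S) :=
  Submodule.span k {c | ∃ (m : ℕ) (x : Simplex S m), (m : ℤ) = n ∧ c = cls k m x}

variable {S}

theorem d_cls (n : ℕ) (x : Simplex S n) : d k S (cls k n x) = bdry k n x := lift_cls _ _ _ _

theorem comul_cls (n : ℕ) (x : Simplex S n) : comul k S (cls k n x) = diag k n x := lift_cls _ _ _ _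

theorem counit_cls (n : ℕ) (x : Simplex S n) : counit k S (cls k n x) = if n = 0 then 1 else 0 :=
  lift_cls _ _ _ _

theorem cls_mem (n : ℕ) (x : Simplex S n) : cls k n x ∈ gr k S n :=
  Submodule.subset_span ⟨n, x, rfl, rfl⟩

theorem cell_mem {n : ℕ} (x : Simplex S n) (m : ℕ) (f : ℕ → ℕ) : cell k x m f ∈ gr k S m := by
  by_cases hf : Valid m n f
  · rw [cell, dif_pos hf]; exact cls_mem k _ _
  · rw [cell, dif_neg hf]; exact zero_mem _

theorem d_cell_zero {n : ℕ} (x : Simplex S n) (f : ℕ → ℕ) : d k S (cell k x 0 f) = 0 := by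
  by_cases hf : Valid 0 n f
  · rw [cell, dif_pos hf, d_cls]; rfl
  · rw [cell, dif_neg hf, map_zero]

theorem d_cell_succ {n m : ℕ} (x : Simplex S n) {f : ℕ → ℕ} (hf : Valid (m + 1) n f) :
    d k S (cell k x (m + 1) f) =
      ∑ i ∈ Finset.range (m + 2), (-1 : k) ^ i • cell k x m (fun j => f (skip i j)) := by
  rw [cell, dif_pos hf, d_cls, bdry_succ]
  refine Finset.sum_congr rfl fun i _ => ?_
  rw [cell_map k x _ (valid_skip m i)]
  congr 1
  refine cell_congr k x rfl fun j hj => ?_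
  have := (valid_skip m i j j le_rfl hj).2
  simp only [fn, Nat.lt_succ_of_le this, dif_pos]
  rfl

theorem comul_cell {n m : ℕ} (x : Simplex S n) {f : ℕ → ℕ} (hf : Valid m n f) :
    comul k S (cell k x m f) = ∑ p ∈ Finset.range (m + 1),
      cell k x p f ⊗ₜ cell k x (m - p) (fun j => f (p + j)) := by
  rw [cell, dif_pos hf, comul_cls, diag_eq]
  refine Finset.sum_congr rfl fun p hp => ?_
  rw [Finset.mem_range] at hp
  rw [cell_map k x _ (valid_id (by omega)), cell_map k x _ (valid_shift (by omega))]
  congr 1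
  · refine cell_congr k x rfl fun j hj => ?_
    have : j < m + 1 := by omega
    simp only [fn, this, dif_pos]
    rfl
  · refine cell_congr k x rfl fun j hj => ?_
    have : p + j < m + 1 := by omega
    simp only [fn, this, dif_pos]
    rfl

theorem counit_cell {n m : ℕ} (x : Simplex S n) {f : ℕ → ℕ} (hf : Valid m n f) :
    counit k S (cell k x m f) = if m = 0 then 1 else 0 := by
  rw [cell, dif_pos hf, counit_cls]

theorem d_d (a : Carrier k S) : d k S (d k S a) = 0 := by
  suffices h : d k S ∘ₗ d k S = 0 from LinearMap.congr_fun h a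
  refine hom_ext fun n x => ?_
  rw [LinearMap.comp_apply, LinearMap.zero_apply, d_cls]
  match n, x with
  | 0, x => exact map_zero _
  | 1, x =>
    rw [bdry_succ, map_sum]
    exact Finset.sum_eq_zero fun i _ => by rw [map_smul, d_cell_zero, smul_zero]
  | n + 2, x =>
    rw [bdry_succ, map_sum]
    simp only [map_smul, d_cell_succ k x (valid_skip (n + 1) _), Finset.smul_sum, smul_smul,
      ← pow_add]
    rw [← Finset.sum_product']
    refine Finset.sum_involution
      (fun p _ => if p.2 < p.1 then (p.2, p.1 - 1) else (p.2 + 1, p.1)) ?_ ?_ ?_ ?_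
    · rintro ⟨i, j⟩ hij
      simp only
      split_ifs with h
      · rw [cell_congr k x rfl (g := fun l => skip j (skip (i - 1) l))]
        · rw [show i + j = (j + (i - 1)) + 1 by omega, pow_succ]
          simp
        · intro l _
          simp only [skip]
          split_ifs <;> omega
      · rw [cell_congr k x rfl (g := fun l => skip (j + 1) (skip i l))]
        · rw [show j + 1 + i = (i + j) + 1 by omega, pow_succ]
          simp
        · intro l _
          simp only [skip]
          split_ifs <;> omega
    · rintro ⟨i, j⟩ hij _
      simp only
      split_ifs with h
      · intro he
        simp only [Prod.mk.injEq] at he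
        omega
      · intro he
        simp only [Prod.mk.injEq] at he
        omega
    · rintro ⟨i, j⟩ hij
      simp only [Finset.mem_product, Finset.mem_range] at hij ⊢
      split_ifs with h
      · dsimp only; omega
      · dsimp only; omega
    · rintro ⟨i, j⟩ hij
      simp only
      split_ifs with h1 h2 h2
      · dsimp only at h2; omega
      · ext
        · dsimp only; omega
        · rfl
      · ext
        · rfl
        · dsimp only; omega
      · dsimp only at h2; omega

theorem isInternal : DirectSum.IsInternal (gr k S) := by
  refine isInternal_of_decomp
    (lift (fun n x => DirectSum.lof k ℤ (fun i => gr k S i) n ⟨cls k n x, cls_mem k n x⟩) ?_) ?_ ?_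
  · intro n x hx
    have : (⟨cls k n x, cls_mem k n x⟩ : gr k S n) = 0 := Subtype.ext (cls_degenerate k hx)
    rw [this, map_zero]
  · intro a
    induction a using induction with
    | cl n x => rw [lift_cls, DirectSum.coeLinearMap_lof]
    | zero => rw [map_zero, map_zero]
    | add a b ha hb => rw [map_add, map_add, ha, hb]
    | smul c a ha => rw [map_smul, map_smul, ha]
  · intro n a ha
    induction ha using Submodule.span_induction with
    | mem a h =>
      obtain ⟨m, x, rfl, rfl⟩ := h
      exact lift_cls _ _ _ _
    | zero => rw [map_zero]; exact (map_zero _).symm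
    | add a b _ _ ha hb => rw [map_add, ha, hb, ← map_add]; rfl
    | smul c a _ ha => rw [map_smul, ha, ← map_smul]; rfl

theorem counit_rTensor : (counit k S).rTensor _ ∘ₗ comul k S = TensorProduct.mk k k _ 1 := by
  refine hom_ext fun n x => ?_
  rw [LinearMap.comp_apply, comul_cls, diag_eq, map_sum, Finset.sum_eq_single 0]
  · rw [LinearMap.rTensor_tmul, counit_cell k x (valid_id (by omega)), if_pos rfl]
    rw [TensorProduct.mk_apply, cls_eq k x]
    congr 1
    exact cell_congr k x (by omega) fun j _ => by omega
  · intro p hp hp0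
    rw [Finset.mem_range] at hp
    rw [LinearMap.rTensor_tmul, counit_cell k x (valid_id (by omega)), if_neg hp0,
      TensorProduct.zero_tmul]
  · intro h
    exact absurd (Finset.mem_range.mpr (by omega)) h

theorem counit_lTensor : (counit k S).lTensor _ ∘ₗ comul k S = (TensorProduct.mk k _ k).flip 1 := by
  refine hom_ext fun n x => ?_
  rw [LinearMap.comp_apply, comul_cls, diag_eq, map_sum, Finset.sum_eq_single n]
  · rw [LinearMap.lTensor_tmul, counit_cell k x (valid_shift (by omega)), if_pos (by omega)]
    rw [LinearMap.flip_apply, TensorProduct.mk_apply, cls_eq k x]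
  · intro p hp hp0
    rw [Finset.mem_range] at hp
    rw [LinearMap.lTensor_tmul, counit_cell k x (valid_shift (by omega)), if_neg (by omega),
      TensorProduct.tmul_zero]
  · intro h
    exact absurd (Finset.mem_range.mpr (by omega)) h

theorem coassoc : (TensorProduct.assoc k (Carrier k S) (Carrier k S) (Carrier k S)).toLinearMap ∘ₗ
      (comul k S).rTensor _ ∘ₗ comul k S =
    (comul k S).lTensor _ ∘ₗ comul k S := by
  refine hom_ext fun n x => ?_
  simp only [LinearMap.comp_apply, comul_cls, diag_eq, map_sum, LinearMap.rTensor_tmul,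
    LinearMap.lTensor_tmul]
  have h1 : ∀ p ∈ Finset.range (n + 1),
      (TensorProduct.assoc k (Carrier k S) (Carrier k S) (Carrier k S)).toLinearMap
        (comul k S (cell k x p fun j => j) ⊗ₜ[k] cell k x (n - p) fun j => p + j) =
      ∑ q ∈ Finset.range (p + 1), cell k x q (fun j => j) ⊗ₜ[k]
        (cell k x (p - q) (fun j => q + j) ⊗ₜ[k] cell k x (n - p) fun j => p + j) := by
    intro p hp
    rw [Finset.mem_range] at hp
    rw [comul_cell k x (valid_id (by omega)), TensorProduct.sum_tmul, map_sum]
    rfl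
  have h2 : ∀ q ∈ Finset.range (n + 1),
      (cell k x q (fun j => j) ⊗ₜ[k] comul k S (cell k x (n - q) fun j => q + j)) =
      ∑ r ∈ Finset.range (n - q + 1), cell k x q (fun j => j) ⊗ₜ[k]
        (cell k x r (fun j => q + j) ⊗ₜ[k] cell k x (n - q - r) fun j => q + (r + j)) := by
    intro q hq
    rw [Finset.mem_range] at hq
    rw [comul_cell k x (valid_shift (by omega)), TensorProduct.tmul_sum]
  rw [Finset.sum_congr rfl h1, Finset.sum_congr rfl h2, Finset.sum_sigma', Finset.sum_sigma']
  refine Finset.sum_bij' (fun a _ => ⟨a.2, a.1 - a.2⟩) (fun a _ => ⟨a.1 + a.2, a.1⟩) ?_ ?_ ?_ ?_ ?_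
  · rintro ⟨p, q⟩ h
    simp only [Finset.mem_sigma, Finset.mem_range] at h ⊢
    omega
  · rintro ⟨p, q⟩ h
    simp only [Finset.mem_sigma, Finset.mem_range] at h ⊢
    omega
  · rintro ⟨p, q⟩ h
    simp only [Finset.mem_sigma, Finset.mem_range] at h
    have : q + (p - q) = p := by omega
    simp [this]
  · rintro ⟨p, q⟩ h
    simp
  · rintro ⟨p, q⟩ h
    simp only [Finset.mem_sigma, Finset.mem_range] at h
    congr 2
    exact cell_congr k x (by dsimp only; omega) fun j _ => by dsimp only; omega

noncomputable instance : Coalgebra k (Carrier k S) where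
  comul := comul k S
  counit := counit k S
  coassoc := coassoc k
  rTensor_counit_comp_comul := counit_rTensor k
  lTensor_counit_comp_comul := counit_lTensor k

theorem signInv_cell {n : ℕ} (x : Simplex S n) (m : ℕ) (f : ℕ → ℕ) :
    signInv (isInternal k) (cell k x m f) = (-1 : k) ^ m • cell k x m f := by
  rw [signInv, scaleDeg_of_mem _ _ (cell_mem k x m f), koszulSign_natCast]

theorem comul_d (a : Carrier k S) : comul k S (d k S a) =
    TensorProduct.map (d k S) LinearMap.id (comul k S a) +
      TensorProduct.map (signInv (isInternal k)) (d k S) (comul k S a) := by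
  suffices h : comul k S ∘ₗ d k S = TensorProduct.map (d k S) LinearMap.id ∘ₗ comul k S +
      TensorProduct.map (signInv (isInternal k)) (d k S) ∘ₗ comul k S from LinearMap.congr_fun h a
  refine hom_ext fun n x => ?_
  simp only [LinearMap.comp_apply, LinearMap.add_apply, d_cls, comul_cls, diag_eq, map_sum,
    TensorProduct.map_tmul, LinearMap.id_apply, signInv_cell]
  match n, x with
  | 0, x =>
    simp only [zero_add, Finset.sum_range_one, d_cell_zero, TensorProduct.zero_tmul,
      TensorProduct.tmul_zero, add_zero, Nat.sub_self]
    exact map_zero (comul k S)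
  | m + 1, x =>
    rw [bdry_succ, map_sum]
    have h0 : ∀ i ∈ Finset.range (m + 2), comul k S ((-1 : k) ^ i • cell k x m (skip i)) =
        ∑ p ∈ Finset.range (m + 1), (-1 : k) ^ i •
          (cell k x p (skip i) ⊗ₜ[k] cell k x (m - p) fun j => skip i (p + j)) := by
      intro i _
      rw [LinearMap.map_smul, comul_cell k x (valid_skip m i), Finset.smul_sum]
    rw [Finset.sum_congr rfl h0, Finset.sum_comm]
    refine Eq.trans ?_ (congrArg₂ (· + ·) (Finset.sum_range_succ' _ _)
      (Finset.sum_range_succ _ _)).symm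
    simp only [d_cell_zero, TensorProduct.zero_tmul, add_zero, Nat.sub_self, TensorProduct.tmul_zero]
    rw [← Finset.sum_add_distrib]
    refine Finset.sum_congr rfl fun p hp => ?_
    rw [Finset.mem_range] at hp
    have e1 : m + 1 - p = (m - p) + 1 := by omega
    rw [d_cell_succ k x (valid_id (by omega)), e1, d_cell_succ k x (valid_shift (by omega)),
      show m + 2 = (p + 1) + (m - p + 1) by omega, Finset.sum_range_add, TensorProduct.sum_tmul,
      TensorProduct.tmul_sum, Finset.sum_range_succ (n := p + 1),
      Finset.sum_range_succ' (n := m - p + 1)]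
    have h1 : ∀ i ∈ Finset.range (p + 1), (-1 : k) ^ i •
        (cell k x p (skip i) ⊗ₜ[k] cell k x (m - p) fun j => skip i (p + j)) =
        ((-1 : k) ^ i • cell k x p fun j => skip i j) ⊗ₜ[k]
          cell k x (m + 1 - (p + 1)) fun j => p + 1 + j := by
      intro i hi
      rw [Finset.mem_range] at hi
      rw [TensorProduct.smul_tmul']
      congr 1
      exact cell_congr k x (by omega) fun j _ => by simp only [skip]; split_ifs <;> omega
    have h2 : ∀ i ∈ Finset.range (m - p + 1), (-1 : k) ^ (p + 1 + i) •
        (cell k x p (skip (p + 1 + i)) ⊗ₜ[k] cell k x (m - p) fun j => skip (p + 1 + i) (p + j)) =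
        ((-1 : k) ^ p • cell k x p fun j => j) ⊗ₜ[k]
          ((-1 : k) ^ (i + 1) • cell k x (m - p) fun j => p + skip (i + 1) j) := by
      intro i hi
      rw [Finset.mem_range] at hi
      rw [TensorProduct.smul_tmul_smul, ← pow_add, show p + (i + 1) = p + 1 + i by omega]
      congr 2
      · exact cell_congr k x rfl fun j _ => by simp only [skip]; split_ifs <;> omega
      · exact cell_congr k x rfl fun j _ => by simp only [skip]; split_ifs <;> omega
    have h3 : ((-1 : k) ^ (p + 1) • cell k x p fun j => skip (p + 1) j) ⊗ₜ[k]
          (cell k x (m + 1 - (p + 1)) fun j => p + 1 + j) =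
        - (((-1 : k) ^ p • cell k x p fun j => j) ⊗ₜ[k]
          ((-1 : k) ^ 0 • cell k x (m - p) fun j => p + skip 0 j)) := by
      have c1 : (cell k x p fun j => skip (p + 1) j) = cell k x p fun j => j :=
        cell_congr k x rfl fun j _ => by simp only [skip]; split_ifs <;> omega
      have c2 : (cell k x (m + 1 - (p + 1)) fun j => p + 1 + j) =
          cell k x (m - p) fun j => p + skip 0 j :=
        cell_congr k x (by omega) fun j _ => by simp only [skip]; split_ifs <;> omega
      rw [pow_zero, one_smul, pow_succ, mul_neg_one, neg_smul, TensorProduct.neg_tmul, c1, c2]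
    rw [Finset.sum_congr rfl h1, Finset.sum_congr rfl h2, h3]
    abel

theorem d_mem (n : ℤ) (a : Carrier k S) (ha : a ∈ gr k S n) : d k S a ∈ gr k S (n - 1) := by
  induction ha using Submodule.span_induction with
  | mem a h =>
    obtain ⟨m, x, rfl, rfl⟩ := h
    rw [d_cls]
    match m, x with
    | 0, x => exact zero_mem _
    | m + 1, x =>
      rw [bdry_succ]
      refine sum_mem fun i _ => Submodule.smul_mem _ _ ?_
      have := cell_mem k x m (skip i)
      rwa [show ((m + 1 : ℕ) : ℤ) - 1 = m by push_cast; ring]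
  | zero => rw [map_zero]; exact zero_mem _
  | add a b _ _ ha hb => rw [map_add]; exact add_mem ha hb
  | smul c a _ ha => rw [map_smul]; exact Submodule.smul_mem _ c ha

theorem comul_mem (n : ℤ) (a : Carrier k S) (ha : a ∈ gr k S n) :
    comul k S a ∈ tensorDeg (gr k S) n := by
  induction ha using Submodule.span_induction with
  | mem a h =>
    obtain ⟨m, x, rfl, rfl⟩ := h
    rw [comul_cls, diag_eq]
    refine sum_mem fun p hp => ?_
    rw [Finset.mem_range] at hp
    exact tmul_mem_tensorDeg (by omega) (cell_mem k x p _) (cell_mem k x (m - p) _)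
  | zero => rw [map_zero]; exact zero_mem _
  | add a b _ _ ha hb => rw [map_add]; exact add_mem ha hb
  | smul c a _ ha => rw [map_smul]; exact Submodule.smul_mem _ c ha

theorem counit_of_mem (n : ℤ) (a : Carrier k S) (hn : n ≠ 0) (ha : a ∈ gr k S n) :
    counit k S a = 0 := by
  induction ha using Submodule.span_induction with
  | mem a h =>
    obtain ⟨m, x, rfl, rfl⟩ := h
    rw [counit_cls, if_neg (by omega)]
  | zero => rw [map_zero]
  | add a b _ _ ha hb => rw [map_add, ha, hb, add_zero]
  | smul c a _ ha => rw [map_smul, ha, smul_zero]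

theorem counit_d (a : Carrier k S) : counit k S (d k S a) = 0 := by
  suffices h : counit k S ∘ₗ d k S = 0 from LinearMap.congr_fun h a
  refine hom_ext fun n x => ?_
  rw [LinearMap.comp_apply, LinearMap.zero_apply, d_cls]
  match n, x with
  | 0, x => exact map_zero _
  | 1, x =>
    rw [bdry_succ, map_sum]
    simp only [map_smul, counit_cell k x (valid_skip 0 _)]
    simp [Finset.sum_range_succ]
  | n + 2, x =>
    exact counit_of_mem k (n + 1) _ (by omega) (by
      have := d_mem k _ _ (cls_mem k (n + 2) x)
      rw [d_cls] at this
      rwa [show ((n + 2 : ℕ) : ℤ) - 1 = n + 1 by push_cast; ring] at this)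

theorem vertex_groupLike (b : Simplex S 0) : IsGroupLikeElem k (cls k 0 b) where
  counit_eq_one := by
    change counit k S _ = 1
    rw [counit_cls, if_pos rfl]
  comul_eq_tmul_self := by
    change comul k S _ = _
    rw [comul_cls, diag_eq, zero_add, Finset.sum_range_one, cls_eq k b]
    congr 1
    exact cell_congr k b rfl fun j _ => by omega

theorem iterReducedComul_cls [Subsingleton (Simplex S 0)] (b : Simplex S 0) (m n : ℕ) (h : n ≤ m)
    (x : Simplex S n) : iterReducedComul (cls k 0 b) (vertex_groupLike k b) m
      ((Submodule.span k {cls k 0 b}).mkQ (cls k n x)) = 0 := by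
  have h0 : ∀ y : Simplex S 0, (Submodule.span k {cls k 0 b}).mkQ (cls k 0 y) = 0 := by
    intro y
    rw [Subsingleton.elim y b]
    simp
  induction m generalizing n with
  | zero =>
    obtain rfl : n = 0 := by omega
    rw [h0, map_zero]
  | succ m ih =>
    rw [iterReducedComul, LinearMap.comp_apply, LinearMap.comp_apply, reducedComul_mkQ]
    change LinearMap.mul' k _ (TensorProduct.map _ _
      (TensorProduct.map _ _ (comul k S (cls k n x)))) = 0
    rw [comul_cls, diag, map_sum, map_sum, map_sum]
    refine Finset.sum_eq_zero fun p _ => ?_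
    obtain ⟨p, hp⟩ := p
    rw [TensorProduct.map_tmul, TensorProduct.map_tmul, LinearMap.mul'_apply]
    match p, hp with
    | 0, hp => erw [h0]; rw [map_zero, zero_mul]
    | p + 1, hp => erw [ih (n - (p + 1)) (by omega)]; rw [mul_zero]

variable (S) in
/-- The normalized chains on a reduced simplicial set `S` (one with exactly one `0`-simplex `b`)
as a dg coalgebra. -/
noncomputable def dgc [Subsingleton (Simplex S 0)] (b : Simplex S 0) : DGC.{u, max u w} k where
  carrier := Carrier k S
  gr := gr k S
  isInternal := isInternal k
  d := d k S
  d_mem := d_mem k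
  d_d := d_d k
  comul_mem := comul_mem k
  counit_of_mem := counit_of_mem k
  comul_d := comul_d k
  counit_d := counit_d k
  one := cls k 0 b
  one_groupLike := vertex_groupLike k b
  one_mem := by simpa using cls_mem k 0 b
  d_one := d_cls k 0 b
  conilpotent a := by
    obtain ⟨a, rfl⟩ := Submodule.mkQ_surjective _ a
    have key : ∃ N, ∀ m ≥ N, iterReducedComul (cls k 0 b) (vertex_groupLike k b) m
        ((Submodule.span k {cls k 0 b}).mkQ a) = 0 := by
      induction a using induction with
      | cl n x => exact ⟨n, fun m hm => iterReducedComul_cls k b m n hm x⟩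
      | zero => exact ⟨0, fun m _ => by rw [map_zero, map_zero]⟩
      | add a c ha hc =>
        obtain ⟨N, hN⟩ := ha
        obtain ⟨M, hM⟩ := hc
        exact ⟨max N M, fun m hm => by
          rw [map_add, map_add, hN m (le_trans (le_max_left _ _) hm),
            hM m (le_trans (le_max_right _ _) hm), add_zero]⟩
      | smul r a ha =>
        obtain ⟨N, hN⟩ := ha
        exact ⟨N, fun m hm => by rw [map_smul, map_smul, hN m hm, smul_zero]⟩
    obtain ⟨N, hN⟩ := key
    exact ⟨N, hN N le_rfl⟩

end NormChains

/-! ### Pointed path-connected spaces and pointed singular chains -/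

/-- A pointed path-connected topological space. -/
structure PtdSpace where
  space : TopCat.{w}
  pt : space
  [pathConnected : PathConnectedSpace space]

namespace PtdSpace

/-- A base point preserving continuous map. -/
@[ext] structure Hom (X Y : PtdSpace.{w}) where
  map : X.space ⟶ Y.space
  map_pt : map X.pt = Y.pt

/-- The category of pointed path-connected topological spaces. -/
instance : Category PtdSpace.{w} where
  Hom := Hom
  id X := { map := 𝟙 X.space, map_pt := rfl }
  comp f g := { map := f.map ≫ g.map, map_pt := by simp [f.map_pt, g.map_pt] }

/-- A space is semi-locally simply connected if each point `x` has a neighbourhood in which all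
loops at `x` are null-homotopic in the whole space. -/
def SemilocallySimplyConnected (X : Type w) [TopologicalSpace X] : Prop :=
  ∀ x : X, ∃ U ∈ nhds x, ∀ γ : Path x x, Set.range γ ⊆ U → γ.Homotopic (Path.refl x)

/-- The spaces that are locally path-connected and semi-locally simply connected (so that they
have a universal cover). -/
def HasUniversalCover : ObjectProperty PtdSpace.{w} := fun X =>
  LocallyPathConnectedSpace X.space ∧ SemilocallySimplyConnected X.space

/-- The simplicial set `Sing(X, b)` of those singular simplices of `X` that send all vertices
of the standard simplex to the base point. -/
def sing (X : PtdSpace.{w}) : (TopCat.toSSet.obj X.space).Subcomplex where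
  obj n := {σ | ∀ i, X.space.toSSetObjEquiv n σ (stdSimplex.vertex i) = X.pt}
  map {m n} f σ hσ i := by
    have h : X.space.toSSetObjEquiv n ((TopCat.toSSet.obj X.space).map f σ)
        (stdSimplex.vertex i) = X.space.toSSetObjEquiv m σ
          (stdSimplex.map f.unop.toOrderHom (stdSimplex.vertex i)) := rfl
    rw [h, stdSimplex.map_vertex]
    exact hσ _

instance (X : PtdSpace.{w}) : Subsingleton (NormChains.Simplex X.sing.toSSet 0) where
  allEq := by
    rintro ⟨σ, hσ⟩ ⟨τ, hτ⟩
    apply Subtype.ext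
    apply (X.space.toSSetObjEquiv _).injective
    ext p
    have : p = stdSimplex.vertex (S := ℝ) (X := Fin 1) 0 := Subsingleton.elim (α := stdSimplex ℝ (Fin 1)) _ _
    rw [this]
    exact (hσ 0).trans (hτ 0).symm

/-- The constant `0`-simplex at the base point. -/
noncomputable def singPt (X : PtdSpace.{w}) : NormChains.Simplex X.sing.toSSet 0 :=
  ⟨(X.space.toSSetObjEquiv _).symm (ContinuousMap.const _ X.pt), fun i => by
    rw [Equiv.apply_symm_apply]; rfl⟩

/-- The dg coalgebra `C_*(X, b; k)` of pointed normalized singular chains. -/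
noncomputable def chains (k : Type u) [CommRing k] (X : PtdSpace.{w}) : DGC.{u, max u w} k :=
  NormChains.dgc k X.sing.toSSet X.singPt

end PtdSpace


/-!
`Ω`-quasi-isomorphic dg coalgebras have cobar constructions with isomorphic homology, compatibly
with products and augmentations. If `C` is cocommutative, then `Ω C` is a conilpotent dg bialgebra
`(B, Δ)` whose generators are primitive. Let `f` be a multiplicative functional on `H₀ B` and put
`c_f = (f ⊗ 1) Δ`, which is multiplicative on `H₀ B` as long as `B` has no homology in negative
degrees. Then `c_f = 1 + N` with `N` locally nilpotent, so for a class `e` in `H₀ B` the value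
`ε (c_fⁿ e)` is a polynomial in `n`; if `e` is idempotent, this polynomial takes only the values
`0` and `1`, hence is constant in characteristic zero. Since it is `ε e` at `n = 0` and `f e` at
`n = 1`, no multiplicative functional on `H₀ B` separates an idempotent from the augmentation.

For chains, `H₀ (Ω C_*(X, b))` is the group ring of `π₁(X, b)`. On `X = (E ∖ 0)/±1`, with `E` of
dimension three, the monodromy of the double cover `E ∖ 0 → X` is a character of `π₁(X, b)` that
sends the nontrivial loop `γ` to `-1`, and so it separates the idempotent `(1 - γ)/2` from the
augmentation.
-/

/-! ### Tensor squares of dg algebras -/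

theorem negOnePow_smul_eq_koszulSign_smul {k : Type u} [CommRing k] {M : Type v} [AddCommGroup M]
    [Module k M] (n : ℤ) (x : M) : ((-1 : ℤˣ) ^ n) • x = koszulSign k n • x := by
  rw [koszulSign, Int.cast_smul_eq_zsmul, Units.smul_def]
  congr 2

theorem tensor_graded_induction {k : Type u} [CommRing k] {V : Type v} [AddCommGroup V] [Module k V]
    {gr : ℤ → Submodule k V} (h : DirectSum.IsInternal gr) {P : V ⊗[k] V → Prop}
    (tmul : ∀ i j x y, x ∈ gr i → y ∈ gr j → P (x ⊗ₜ y))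
    (add : ∀ s t, P s → P t → P (s + t)) (t : V ⊗[k] V) : P t := by
  induction t using TensorProduct.induction_on with
  | zero => simpa only [TensorProduct.zero_tmul] using tmul 0 0 0 0 (zero_mem _) (zero_mem _)
  | add s t hs ht => exact add _ _ hs ht
  | tmul x y =>
    induction x using graded_induction h with
    | add x x' hx hx' => rw [TensorProduct.add_tmul]; exact add _ _ hx hx'
    | hom i x hx =>
      induction y using graded_induction h with
      | add y y' hy hy' => rw [TensorProduct.tmul_add]; exact add _ _ hy hy'
      | hom j y hy => exact tmul i j x y hx hy

namespace DGA

open GradedTensorProduct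

section TensorSquare

variable {k : Type u} [CommRing k] (A : DGA.{u, v} k)

noncomputable instance : GradedAlgebra A.gr where
  one_mem := A.one_mem
  mul_mem _ _ _ _ := A.mul_mem _ _ _ _
  toDecomposition := A.isInternal.chooseDecomposition

/-- The tensor product `A ⊗ A` of graded algebras, with
`(a ⊗ b) (a' ⊗ b') = (-1)^(|b| |a'|) a a' ⊗ b b'`. -/
noncomputable abbrev TensorSquare : Type v := A.gr ᵍ⊗[k] A.gr

/-- The degree `n` part of `A ⊗ A`. -/
noncomputable def tensorGr (n : ℤ) : Submodule k A.TensorSquare :=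
  (tensorDeg A.gr n).comap (GradedTensorProduct.of k A.gr A.gr).symm.toLinearMap

/-- The differential `d ⊗ 1 + 1 ⊗ d` of `A ⊗ A`, where `(1 ⊗ d) (a ⊗ b) = (-1)^|a| a ⊗ d b`. -/
noncomputable def tensorD : A.TensorSquare →ₗ[k] A.TensorSquare :=
  (GradedTensorProduct.of k A.gr A.gr).toLinearMap ∘ₗ
    (TensorProduct.map A.d LinearMap.id + TensorProduct.map (signInv A.isInternal) A.d) ∘ₗ
    (GradedTensorProduct.of k A.gr A.gr).symm.toLinearMap

/-- The map `φ ⊗ 1` on `A ⊗ A`, without a sign. -/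
noncomputable def mapLeft (φ : Module.End k A.carrier) : A.TensorSquare →ₗ[k] A.TensorSquare :=
  (GradedTensorProduct.of k A.gr A.gr).toLinearMap ∘ₗ φ.rTensor A.carrier ∘ₗ
    (GradedTensorProduct.of k A.gr A.gr).symm.toLinearMap

/-- The contraction `a ⊗ b ↦ f a • b`. -/
noncomputable def contract (f : A.carrier →ₗ[k] k) : A.TensorSquare →ₗ[k] A.carrier :=
  (TensorProduct.lid k A.carrier).toLinearMap ∘ₗ f.rTensor A.carrier ∘ₗ
    (GradedTensorProduct.of k A.gr A.gr).symm.toLinearMap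

variable {A}

theorem add_gtmul (a a' b : A.carrier) :
    ((a + a') ᵍ⊗ₜ[k] b : A.TensorSquare) = (a ᵍ⊗ₜ b : A.TensorSquare) + (a' ᵍ⊗ₜ b) := by
  rw [tmul, TensorProduct.add_tmul, map_add]

theorem gtmul_add (a b b' : A.carrier) :
    (a ᵍ⊗ₜ[k] (b + b') : A.TensorSquare) = (a ᵍ⊗ₜ b : A.TensorSquare) + (a ᵍ⊗ₜ b') := by
  rw [tmul, TensorProduct.tmul_add, map_add]

theorem smul_gtmul (r : k) (a b : A.carrier) :
    ((r • a) ᵍ⊗ₜ[k] b : A.TensorSquare) = r • (a ᵍ⊗ₜ b : A.TensorSquare) := by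
  rw [tmul, ← TensorProduct.smul_tmul', map_smul]

theorem gtmul_smul (r : k) (a b : A.carrier) :
    (a ᵍ⊗ₜ[k] (r • b) : A.TensorSquare) = r • (a ᵍ⊗ₜ b : A.TensorSquare) := by
  rw [tmul, TensorProduct.tmul_smul, map_smul]

theorem smul_tensorSquare_mul (r : k) (x y : A.TensorSquare) : (r • x) * y = r • (x * y) :=
  smul_mul_assoc r x y

theorem tensorSquare_mul_smul (r : k) (x y : A.TensorSquare) : x * (r • y) = r • (x * y) :=
  mul_smul_comm r x y

theorem gtmul_mul_gtmul {i j : ℤ} (a : A.carrier) {b a' : A.carrier} (b' : A.carrier)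
    (hb : b ∈ A.gr j) (ha' : a' ∈ A.gr i) :
    (a ᵍ⊗ₜ[k] b : A.TensorSquare) * (a' ᵍ⊗ₜ[k] b' : A.TensorSquare) =
      koszulSign k (j * i) • ((a * a') ᵍ⊗ₜ[k] (b * b') : A.TensorSquare) := by
  rw [← negOnePow_smul_eq_koszulSign_smul]
  exact tmul_coe_mul_coe_tmul A.gr A.gr a ⟨b, hb⟩ ⟨a', ha'⟩ b'

theorem tensorD_gtmul {n : ℤ} {a : A.carrier} (ha : a ∈ A.gr n) (b : A.carrier) :
    A.tensorD (a ᵍ⊗ₜ[k] b) =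
      (A.d a ᵍ⊗ₜ[k] b : A.TensorSquare) + koszulSign k n • (a ᵍ⊗ₜ A.d b : A.TensorSquare) := by
  rw [← smul_gtmul, ← scaleDeg_of_mem A.isInternal _ ha]
  rfl

theorem mapLeft_gtmul (φ : Module.End k A.carrier) (a b : A.carrier) :
    A.mapLeft φ (a ᵍ⊗ₜ[k] b) = (φ a ᵍ⊗ₜ b : A.TensorSquare) := rfl

theorem contract_gtmul (f : A.carrier →ₗ[k] k) (a b : A.carrier) :
    A.contract f (a ᵍ⊗ₜ[k] b) = f a • b := rfl

theorem contract_sub (f g : A.carrier →ₗ[k] k) :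
    A.contract (f - g) = A.contract f - A.contract g := by
  rw [contract, LinearMap.rTensor_sub, LinearMap.sub_comp, LinearMap.comp_sub]
  rfl

theorem gtmul_mem_tensorGr {p q n : ℤ} (hn : p + q = n) {a b : A.carrier} (ha : a ∈ A.gr p)
    (hb : b ∈ A.gr q) : (a ᵍ⊗ₜ[k] b : A.TensorSquare) ∈ A.tensorGr n :=
  tmul_mem_tensorDeg hn ha hb

theorem tensorGr_induction {n : ℤ} {P : ∀ x : A.TensorSquare, x ∈ A.tensorGr n → Prop}
    (zero : P 0 (zero_mem _))
    (tmul : ∀ p a b (ha : a ∈ A.gr p) (hb : b ∈ A.gr (n - p)),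
      P (a ᵍ⊗ₜ[k] b) (gtmul_mem_tensorGr (by omega) ha hb))
    (add : ∀ x y hx hy, P x hx → P y hy → P (x + y) (add_mem hx hy))
    {x : A.TensorSquare} (hx : x ∈ A.tensorGr n) : P x hx := by
  obtain ⟨t, rfl⟩ := (GradedTensorProduct.of k A.gr A.gr).surjective x
  induction (show t ∈ tensorDeg A.gr n from hx) using tensorDeg_induction with
  | hom p a b ha hb => exact tmul p a b ha hb
  | h0 => exact zero
  | add s t hs ht ihs iht => exact add _ _ hs ht (ihs hs) (iht ht)

theorem tensorSquare_induction {P : A.TensorSquare → Prop}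
    (tmul : ∀ i j a b, a ∈ A.gr i → b ∈ A.gr j → P (a ᵍ⊗ₜ[k] b))
    (add : ∀ x y, P x → P y → P (x + y)) (x : A.TensorSquare) : P x := by
  obtain ⟨t, rfl⟩ := (GradedTensorProduct.of k A.gr A.gr).surjective x
  induction t using tensor_graded_induction A.isInternal with
  | tmul i j a b ha hb => exact tmul i j a b ha hb
  | add s t hs ht => rw [map_add]; exact add _ _ hs ht

theorem mul_mem_tensorGr {m n : ℤ} {x y : A.TensorSquare} (hx : x ∈ A.tensorGr m)
    (hy : y ∈ A.tensorGr n) : x * y ∈ A.tensorGr (m + n) := by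
  induction hx using tensorGr_induction with
  | zero => rw [zero_mul]; exact zero_mem _
  | add x x' _ _ h h' => rw [add_mul]; exact add_mem h h'
  | tmul p a b ha hb =>
    induction hy using tensorGr_induction with
    | zero => rw [mul_zero]; exact zero_mem _
    | add y y' _ _ h h' => rw [mul_add]; exact add_mem h h'
    | tmul q a' b' ha' hb' =>
      rw [gtmul_mul_gtmul a b' hb ha']
      exact Submodule.smul_mem _ _ (gtmul_mem_tensorGr (by ring) (A.mul_mem _ _ _ _ ha ha')
        (A.mul_mem _ _ _ _ hb hb'))

theorem tensorD_tensorD (x : A.TensorSquare) : A.tensorD (A.tensorD x) = 0 := by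
  induction x using tensorSquare_induction with
  | add x y hx hy => simp only [map_add, hx, hy, add_zero]
  | tmul i _ a b ha _ =>
    rw [tensorD_gtmul ha, map_add, map_smul, tensorD_gtmul (A.d_mem i a ha), tensorD_gtmul ha]
    simp only [A.d_d, tmul, TensorProduct.zero_tmul, TensorProduct.tmul_zero, map_zero, smul_zero,
      zero_add, add_zero, koszulSign_sub_one, neg_smul, neg_add_cancel]

theorem tensorD_mul {n : ℤ} {x : A.TensorSquare} (hx : x ∈ A.tensorGr n) (y : A.TensorSquare) :
    A.tensorD (x * y) = A.tensorD x * y + koszulSign k n • (x * A.tensorD y) := by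
  induction hx using tensorGr_induction with
  | zero => simp only [zero_mul, map_zero, smul_zero, add_zero]
  | add x x' _ _ h h' => simp only [add_mul, map_add, smul_add, h, h']; abel
  | tmul i a b ha hb =>
    induction y using tensorSquare_induction with
    | add y y' h h' => simp only [mul_add, map_add, smul_add, h, h']; abel
    | tmul p _ a' b' ha' _ =>
      obtain ⟨j, rfl⟩ : ∃ j, n = i + j := ⟨n - i, by omega⟩
      rw [add_sub_cancel_left] at hb
      rw [gtmul_mul_gtmul a b' hb ha', map_smul, tensorD_gtmul ha, tensorD_gtmul ha',
        tensorD_gtmul (A.mul_mem _ _ _ _ ha ha'), A.leibniz _ _ _ ha, A.leibniz _ _ _ hb,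
        add_mul, mul_add, smul_tensorSquare_mul, tensorSquare_mul_smul, gtmul_mul_gtmul _ _ hb ha',
        gtmul_mul_gtmul _ _ (A.d_mem _ _ hb) ha', gtmul_mul_gtmul _ _ hb (A.d_mem _ _ ha'),
        gtmul_mul_gtmul _ _ hb ha']
      simp only [add_gtmul, gtmul_add, smul_gtmul, gtmul_smul, smul_add, smul_smul]
      rw [sub_one_mul, mul_sub_one, sub_eq_add_neg, sub_eq_add_neg]
      have koszulSign_neg (m : ℤ) : koszulSign k (-m) = koszulSign k m := by simp [koszulSign]
      simp only [koszulSign_add, koszulSign_neg]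
      match_scalars
      · ring
      · linear_combination (-koszulSign k (j * p) * koszulSign k i) * koszulSign_mul_self (k := k) j
      · ring
      · ring

end TensorSquare

end DGA

/-! ### Characters of the homology in degree zero -/

theorem exists_generalizedInverse {k : Type u} [Field k] {V : Type v} {W : Type w}
    [AddCommGroup V] [Module k V] [AddCommGroup W] [Module k W] (D : V →ₗ[k] W) :
    ∃ G : W →ₗ[k] V, ∀ x, D (G (D x)) = D x := by
  obtain ⟨s, hs⟩ := D.rangeRestrict.exists_rightInverse_of_surjective D.range_rangeRestrict
  obtain ⟨G, hG⟩ := s.exists_extend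
  refine ⟨G, fun x => ?_⟩
  have hGs : G (D x) = s (D.rangeRestrict x) := LinearMap.congr_fun hG (D.rangeRestrict x)
  rw [hGs]
  exact congrArg Subtype.val (LinearMap.congr_fun hs (D.rangeRestrict x))

namespace DGA

open GradedTensorProduct

section Cycles

variable {k : Type u} [CommRing k] {A : DGA.{u, v} k}

theorem mem_cycles {n : ℤ} {a : A.carrier} : a ∈ A.cycles n ↔ a ∈ A.gr n ∧ A.d a = 0 := Iff.rfl

theorem proj_d (n : ℤ) (a : A.carrier) :
    GradedAlgebra.proj A.gr n (A.d a) = A.d (GradedAlgebra.proj A.gr (n + 1) a) := by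
  induction a using graded_induction A.isInternal with
  | add a b ha hb => simp only [map_add, ha, hb]
  | hom m a ha =>
    simp only [GradedAlgebra.proj_apply]
    by_cases hm : m = n + 1
    · subst hm
      have hda : A.d a ∈ A.gr n := by simpa using A.d_mem _ _ ha
      rw [DirectSum.decompose_of_mem_same _ ha, DirectSum.decompose_of_mem_same _ hda]
    · rw [DirectSum.decompose_of_mem_ne _ ha hm,
        DirectSum.decompose_of_mem_ne _ (A.d_mem _ _ ha) (by omega), map_zero]

theorem mem_boundaries {n : ℤ} {a : A.carrier} :
    a ∈ A.boundaries n ↔ a ∈ A.gr n ∧ a ∈ LinearMap.range A.d := by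
  constructor
  · rintro ⟨b, hb, rfl⟩
    exact ⟨by simpa using A.d_mem _ _ hb, b, rfl⟩
  · rintro ⟨ha, b, rfl⟩
    refine ⟨GradedAlgebra.proj A.gr (n + 1) b, SetLike.coe_mem _, ?_⟩
    rw [← proj_d, GradedAlgebra.proj_apply, DirectSum.decompose_of_mem_same _ ha]

theorem boundaries_le_cycles (A : DGA.{u, v} k) (n : ℤ) : A.boundaries n ≤ A.cycles n := by
  intro a ha
  obtain ⟨hn, b, rfl⟩ := mem_boundaries.mp ha
  exact ⟨hn, A.d_d b⟩

theorem one_mem_cycles (A : DGA.{u, v} k) : 1 ∈ A.cycles 0 := by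
  have d_one := A.leibniz 0 1 1 A.one_mem
  rw [koszulSign_zero, one_smul, one_mul, one_mul, mul_one, left_eq_add] at d_one
  exact mem_cycles.mpr ⟨A.one_mem, d_one⟩

theorem mul_mem_cycles {m n : ℤ} {a b : A.carrier} (ha : a ∈ A.cycles m) (hb : b ∈ A.cycles n) :
    a * b ∈ A.cycles (m + n) := by
  rw [mem_cycles] at *
  refine ⟨A.mul_mem _ _ _ _ ha.1 hb.1, ?_⟩
  rw [A.leibniz _ _ _ ha.1, ha.2, hb.2, zero_mul, mul_zero, smul_zero, add_zero]

theorem mul_mem_boundaries_of_left {m n : ℤ} {a b : A.carrier} (ha : a ∈ A.boundaries m)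
    (hb : b ∈ A.cycles n) : a * b ∈ A.boundaries (m + n) := by
  obtain ⟨c, hc, rfl⟩ := ha
  obtain ⟨hb, hdb⟩ := mem_cycles.mp hb
  refine ⟨c * b, ?_, ?_⟩
  · rw [add_right_comm]
    exact A.mul_mem _ _ _ _ hc hb
  · rw [A.leibniz _ _ _ hc, hdb, mul_zero, smul_zero, add_zero]

theorem mul_mem_boundaries_of_right {m n : ℤ} {a b : A.carrier} (ha : a ∈ A.cycles m)
    (hb : b ∈ A.boundaries n) : a * b ∈ A.boundaries (m + n) := by
  obtain ⟨c, hc, rfl⟩ := hb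
  obtain ⟨ha, hda⟩ := mem_cycles.mp ha
  have hac : a * c ∈ A.gr (m + n + 1) := by simpa only [add_assoc] using A.mul_mem _ _ _ _ ha hc
  refine ⟨koszulSign k m • (a * c), Submodule.smul_mem _ _ hac, ?_⟩
  rw [map_smul, A.leibniz _ _ _ ha, hda, zero_mul, zero_add, smul_smul, koszulSign_mul_self,
    one_smul]

theorem mul_sub_mul_mem_boundaries {m n : ℤ} {a a' b b' : A.carrier} (ha : a ∈ A.cycles m)
    (hb' : b' ∈ A.cycles n) (haa' : a - a' ∈ A.boundaries m) (hbb' : b - b' ∈ A.boundaries n) :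
    a * b - a' * b' ∈ A.boundaries (m + n) := by
  rw [show a * b - a' * b' = a * (b - b') + (a - a') * b' by noncomm_ring]
  exact add_mem (mul_mem_boundaries_of_right ha hbb') (mul_mem_boundaries_of_left haa' hb')

/-- A dg algebra whose homology vanishes in negative degrees. -/
def IsConnective (A : DGA.{u, v} k) : Prop := ∀ n < 0, A.cycles n ≤ A.boundaries n

/-- A linear functional of degree zero that vanishes on boundaries, i.e. a chain map from `A` to
`k` placed in degree zero. -/
structure IsCocycle (A : DGA.{u, v} k) (f : A.carrier →ₗ[k] k) : Prop where
  of_mem : ∀ n a, n ≠ 0 → a ∈ A.gr n → f a = 0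
  d : ∀ a, f (A.d a) = 0

/-- A degree zero cocycle that induces a unital multiplicative functional on the homology in degree
zero. -/
structure IsCharacter (A : DGA.{u, v} k) (f : A.carrier →ₗ[k] k) : Prop extends
    A.IsCocycle f where
  one : f 1 = 1
  mul : ∀ a ∈ A.cycles 0, ∀ b ∈ A.cycles 0, f (a * b) = f a * f b

/-- The condition that `A` is connective and that some character of its homology in degree zero
takes the value `1` on an idempotent which the augmentation sends to `0`. -/
def HasSeparatedIdempotent (A : DGA.{u, v} k) : Prop :=
  A.IsConnective ∧ ∃ f, A.IsCharacter f ∧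
    ∃ e ∈ A.cycles 0, e * e - e ∈ A.boundaries 0 ∧ A.aug e = 0 ∧ f e = 1

theorem IsCocycle.contract_tensorD {f : A.carrier →ₗ[k] k} (hf : A.IsCocycle f)
    (x : A.TensorSquare) : A.contract f (A.tensorD x) = A.d (A.contract f x) := by
  induction x using tensorSquare_induction with
  | add x y hx hy => simp only [map_add, hx, hy]
  | tmul i _ a b ha _ =>
    rw [tensorD_gtmul ha, map_add, map_smul, contract_gtmul, contract_gtmul, contract_gtmul,
      map_smul, hf.d, zero_smul, zero_add]
    by_cases hi : i = 0
    · rw [hi, koszulSign_zero, one_smul]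
    · rw [hf.of_mem i a hi ha, zero_smul, smul_zero]

theorem IsCocycle.contract_mem {f : A.carrier →ₗ[k] k} (hf : A.IsCocycle f) {n : ℤ}
    {x : A.TensorSquare} (hx : x ∈ A.tensorGr n) : A.contract f x ∈ A.gr n := by
  induction hx using tensorGr_induction with
  | zero => rw [map_zero]; exact zero_mem _
  | add x y _ _ hx hy => rw [map_add]; exact add_mem hx hy
  | tmul p a b ha hb =>
    rw [contract_gtmul]
    by_cases hp : p = 0
    · rw [hp, sub_zero] at hb
      exact Submodule.smul_mem _ _ hb
    · rw [hf.of_mem p a hp ha, zero_smul]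
      exact zero_mem _

theorem IsCocycle.contract_mem_cycles {f : A.carrier →ₗ[k] k} (hf : A.IsCocycle f) {n : ℤ}
    {x : A.TensorSquare} (hx : x ∈ A.tensorGr n) (hdx : A.tensorD x = 0) :
    A.contract f x ∈ A.cycles n :=
  mem_cycles.mpr ⟨hf.contract_mem hx, by rw [← hf.contract_tensorD, hdx, map_zero]⟩

theorem mapLeft_homotopy {P h : Module.End k A.carrier}
    (hP : ∀ a, a = P a + (A.d (h a) + h (A.d a))) (hh : ∀ n a, a ∈ A.gr n → h a ∈ A.gr (n + 1))
    (x : A.TensorSquare) :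
    x = A.mapLeft P x + (A.tensorD (A.mapLeft h x) + A.mapLeft h (A.tensorD x)) := by
  induction x using tensorSquare_induction with
  | add x y hx hy =>
    conv_lhs => rw [hx, hy]
    simp only [map_add]
    abel
  | tmul i _ a b ha _ =>
    rw [mapLeft_gtmul, mapLeft_gtmul, tensorD_gtmul ha, tensorD_gtmul (hh i a ha), map_add,
      map_smul, mapLeft_gtmul, mapLeft_gtmul]
    conv_lhs => rw [hP a, add_gtmul, add_gtmul]
    have sign : koszulSign k (i + 1) = -koszulSign k i := by
      simpa using (neg_eq_iff_eq_neg.mpr (koszulSign_sub_one (k := k) (i + 1))).symm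
    rw [sign, neg_smul]
    abel

theorem mapLeft_mem_tensorGr {h : Module.End k A.carrier}
    (hh : ∀ n a, a ∈ A.gr n → h a ∈ A.gr (n + 1)) {n : ℤ} {x : A.TensorSquare}
    (hx : x ∈ A.tensorGr n) : A.mapLeft h x ∈ A.tensorGr (n + 1) := by
  induction hx using tensorGr_induction with
  | zero => rw [map_zero]; exact zero_mem _
  | add x y _ _ hx hy => rw [map_add]; exact add_mem hx hy
  | tmul p a b ha hb =>
    rw [mapLeft_gtmul]
    exact gtmul_mem_tensorGr (by omega) (hh p a ha) hb

/-- The tensors of total degree zero whose left factors are cycles of nonnegative degree. -/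
noncomputable def cycleTensors (A : DGA.{u, v} k) : Submodule k A.TensorSquare :=
  Submodule.span k {x | ∃ i ≥ 0, ∃ p ∈ A.cycles i, ∃ b ∈ A.gr (-i), p ᵍ⊗ₜ[k] b = x}

theorem cycleTensors_le_tensorGr (A : DGA.{u, v} k) : A.cycleTensors ≤ A.tensorGr 0 := by
  rw [cycleTensors, Submodule.span_le]
  rintro _ ⟨i, -, p, hp, b, hb, rfl⟩
  exact gtmul_mem_tensorGr (by omega) hp.1 hb

theorem mapLeft_mem_cycleTensors {P : Module.End k A.carrier}
    (hP : ∀ n a, a ∈ A.gr n → P a ∈ A.cycles n) (hneg : ∀ n < 0, ∀ a ∈ A.gr n, P a = 0)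
    {x : A.TensorSquare} (hx : x ∈ A.tensorGr 0) : A.mapLeft P x ∈ A.cycleTensors := by
  induction hx using tensorGr_induction with
  | zero => rw [map_zero]; exact zero_mem _
  | add x y _ _ hx hy => rw [map_add]; exact add_mem hx hy
  | tmul p a b ha hb =>
    rw [mapLeft_gtmul]
    rcases lt_or_ge p 0 with hp | hp
    · rw [hneg p hp a ha, tmul, TensorProduct.zero_tmul, map_zero]
      exact zero_mem _
    · exact Submodule.subset_span ⟨p, hp, P a, hP p a ha, b, by simpa using hb, rfl⟩

/-- Left factors of positive degree contribute nothing, and since their degrees are nonnegative,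
they cannot have a product of degree zero either. -/
theorem IsCharacter.contract_mul {f : A.carrier →ₗ[k] k} (hf : A.IsCharacter f)
    {x y : A.TensorSquare} (hx : x ∈ A.cycleTensors) (hy : y ∈ A.cycleTensors) :
    A.contract f (x * y) = A.contract f x * A.contract f y := by
  induction hx using Submodule.span_induction with
  | zero => simp only [zero_mul, map_zero]
  | add x x' _ _ hx hx' => simp only [add_mul, map_add, hx, hx']
  | smul r x _ hx => rw [smul_tensorSquare_mul, map_smul, map_smul, hx, smul_mul_assoc]
  | mem x hx =>
    obtain ⟨i, hi, p, hp, b, hb, rfl⟩ := hx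
    induction hy using Submodule.span_induction with
    | zero => simp only [mul_zero, map_zero]
    | add y y' _ _ hy hy' => simp only [mul_add, map_add, hy, hy']
    | smul r y _ hy => rw [tensorSquare_mul_smul, map_smul, map_smul, hy, mul_smul_comm]
    | mem y hy =>
      obtain ⟨j, hj, q, hq, c, -, rfl⟩ := hy
      rw [gtmul_mul_gtmul _ _ hb hq.1, map_smul, contract_gtmul, contract_gtmul, contract_gtmul,
        smul_mul_smul_comm]
      by_cases hij : i + j = 0
      · obtain ⟨rfl, rfl⟩ : i = 0 ∧ j = 0 := by omega
        rw [hf.mul p hp q hq, mul_zero, koszulSign_zero, one_smul]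
      · have hpq : f p * f q = 0 := by
          by_cases hi : i = 0
          · rw [hf.of_mem j q (by omega) hq.1, mul_zero]
          · rw [hf.of_mem i p hi hp.1, zero_mul]
        rw [hf.of_mem (i + j) _ hij (A.mul_mem _ _ _ _ hp.1 hq.1), hpq]
        simp only [zero_smul, smul_zero]

end Cycles

section Homotopy

variable {k : Type u} [Field k] {A : DGA.{u, v} k}

theorem exists_graded_generalizedInverse_d (A : DGA.{u, v} k) : ∃ g : Module.End k A.carrier,
    (∀ n a, a ∈ A.gr n → g a ∈ A.gr (n + 1)) ∧ ∀ a, A.d (g (A.d a)) = A.d a := by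
  have d_mem (n) : ∀ x ∈ A.gr (n + 1), A.d x ∈ A.gr n := fun x hx => by
    simpa using A.d_mem _ _ hx
  choose G hG using fun n => exists_generalizedInverse (A.d.restrict (d_mem n))
  let g : Module.End k A.carrier :=
    DirectSum.toModule k ℤ A.carrier (fun n => (A.gr (n + 1)).subtype ∘ₗ G n) ∘ₗ
      (sumEquiv A.isInternal).symm.toLinearMap
  have g_of_mem (n a) (ha : a ∈ A.gr n) : g a = G n ⟨a, ha⟩ := by
    simp only [g, LinearMap.comp_apply, LinearEquiv.coe_coe, sumEquiv_symm_of_mem A.isInternal ha,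
      DirectSum.toModule_lof, Submodule.subtype_apply]
  refine ⟨g, fun n a ha => g_of_mem n a ha ▸ SetLike.coe_mem _, fun a => ?_⟩
  induction a using graded_induction A.isInternal with
  | add a b ha hb => simp only [map_add, ha, hb]
  | hom n a ha =>
    obtain ⟨n, rfl⟩ : ∃ m, n = m + 1 := ⟨n - 1, by omega⟩
    rw [g_of_mem n _ (d_mem n a ha)]
    exact congrArg Subtype.val (hG n ⟨a, ha⟩)

/-- If `d g d = d`, then `Q = 1 - (d g + g d)` takes values in cycles and vanishes on boundaries.
Hence `P = Q ∘ Q` vanishes wherever the homology does. -/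
theorem IsConnective.exists_homotopy (hA : A.IsConnective) : ∃ P h : Module.End k A.carrier,
    (∀ a, a = P a + (A.d (h a) + h (A.d a))) ∧ (∀ n a, a ∈ A.gr n → P a ∈ A.cycles n) ∧
      (∀ n a, a ∈ A.gr n → h a ∈ A.gr (n + 1)) ∧ ∀ n < 0, ∀ a ∈ A.gr n, P a = 0 := by
  obtain ⟨g, g_mem, d_g_d⟩ := exists_graded_generalizedInverse_d A
  let Q : Module.End k A.carrier := LinearMap.id - (A.d ∘ₗ g + g ∘ₗ A.d)
  have Q_apply (a) : Q a = a - (A.d (g a) + g (A.d a)) := rfl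
  have Q_d (a) : Q (A.d a) = 0 := by rw [Q_apply, d_g_d, A.d_d, map_zero, add_zero, sub_self]
  have d_Q (a) : A.d (Q a) = 0 := by
    rw [Q_apply, map_sub, map_add, d_g_d, A.d_d, zero_add, sub_self]
  have Q_mem (n a) (ha : a ∈ A.gr n) : Q a ∈ A.cycles n := by
    refine ⟨sub_mem ha (add_mem ?_ ?_), d_Q a⟩
    · simpa using A.d_mem _ _ (g_mem n a ha)
    · simpa using g_mem _ _ (A.d_mem n a ha)
  refine ⟨Q ∘ₗ Q, g + Q ∘ₗ g, fun a => ?_, fun n a ha => Q_mem n _ (Q_mem n a ha).1,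
    fun n a ha => add_mem (g_mem n a ha) (Q_mem _ _ (g_mem n a ha)).1, fun n hn a ha => ?_⟩
  · have Q_Q : Q (Q a) = Q a - Q (g (A.d a)) := by
      conv_lhs => rw [Q_apply a, map_sub, map_add, Q_d, zero_add]
    simp only [LinearMap.comp_apply, LinearMap.add_apply, map_add, d_Q, add_zero]
    rw [Q_Q, Q_apply a]
    abel
  · obtain ⟨b, -, hb⟩ := hA n hn (Q_mem n a ha)
    rw [LinearMap.comp_apply, ← hb, Q_d]

theorem IsConnective.exists_cycleTensors_add_tensorD (hA : A.IsConnective) {x : A.TensorSquare}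
    (hx : x ∈ A.tensorGr 0) (hdx : A.tensorD x = 0) :
    ∃ x' ∈ A.cycleTensors, A.tensorD x' = 0 ∧ ∃ u ∈ A.tensorGr 1, x = x' + A.tensorD u := by
  obtain ⟨P, h, hP, P_mem, h_mem, P_neg⟩ := hA.exists_homotopy
  have decomposition := mapLeft_homotopy hP h_mem x
  rw [hdx, map_zero, add_zero] at decomposition
  have closed : A.tensorD (A.mapLeft P x) = 0 := by
    have tensorD_decomposition := congrArg A.tensorD decomposition
    rwa [hdx, map_add, tensorD_tensorD, add_zero, eq_comm] at tensorD_decomposition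
  have hu := mapLeft_mem_tensorGr h_mem hx
  rw [zero_add] at hu
  exact ⟨_, mapLeft_mem_cycleTensors P_mem P_neg hx, closed, _, hu, decomposition⟩

theorem IsCharacter.contract_mul_sub_mem_range_d {f : A.carrier →ₗ[k] k} (hf : A.IsCharacter f)
    (hA : A.IsConnective) {x y : A.TensorSquare} (hx : x ∈ A.tensorGr 0) (hdx : A.tensorD x = 0)
    (hy : y ∈ A.tensorGr 0) (hdy : A.tensorD y = 0) :
    A.contract f (x * y) - A.contract f x * A.contract f y ∈ LinearMap.range A.d := by
  obtain ⟨x', hx', hdx', u, hu, hxu⟩ := hA.exists_cycleTensors_add_tensorD hx hdx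
  obtain ⟨y', hy', hdy', v, hv, hyv⟩ := hA.exists_cycleTensors_add_tensorD hy hdy
  have hx'_mem := cycleTensors_le_tensorGr A hx'
  have hy'_mem := cycleTensors_le_tensorGr A hy'
  have tensors : x * y = x' * y' + A.tensorD (x' * v + u * y) := by
    rw [map_add, tensorD_mul hx'_mem, tensorD_mul hu, hdx', hdy, zero_mul, zero_add, mul_zero,
      smul_zero, add_zero, koszulSign_zero, one_smul, ← add_assoc, ← mul_add, ← hyv, ← add_mul,
      ← hxu]
  have boundary {z z' w : A.TensorSquare} (hw : w ∈ A.tensorGr 1) (hz : z = z' + A.tensorD w) :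
      A.contract f z - A.contract f z' ∈ A.boundaries 0 :=
    ⟨A.contract f w, hf.contract_mem hw, by
      rw [hz, map_add, add_sub_cancel_left, hf.contract_tensorD]⟩
  have contractions := mul_sub_mul_mem_boundaries (hf.contract_mem_cycles hx hdx)
    (hf.contract_mem_cycles hy'_mem hdy') (boundary hu hxu) (boundary hv hyv)
  have products : A.contract f (x * y) - A.contract f x' * A.contract f y' ∈
      LinearMap.range A.d := by
    rw [tensors, map_add, hf.contract_tensorD, hf.contract_mul hx' hy', add_sub_cancel_left]
    exact LinearMap.mem_range_self _ _
  simpa only [sub_sub_sub_cancel_right] using sub_mem products (mem_boundaries.mp contractions).2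

end Homotopy

end DGA

/-! ### Conilpotent dg bialgebras -/

section BinomialExpansion

open Polynomial

variable {k : Type u} [Field k] [CharZero k]

theorem exists_eval_natCast_eq_one_add_pow_apply {V : Type v} [AddCommGroup V] [Module k V]
    (N : Module.End k V) (φ : V →ₗ[k] k) {v : V} {m : ℕ} (hN : (N ^ m) v = 0) :
    ∃ P : k[X], ∀ n : ℕ, P.eval (n : k) = φ (((1 + N) ^ n) v) := by
  refine ⟨∑ i ∈ Finset.range m, C (φ ((N ^ i) v) / (i.factorial : k)) * descPochhammer k i,
    fun n => ?_⟩
  have summand (i : ℕ) : φ ((N ^ i) v) / (i.factorial : k) * (n.descFactorial i : k) =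
      n.choose i * φ ((N ^ i) v) := by
    have := Nat.cast_ne_zero (R := k).mpr i.factorial_ne_zero
    rw [Nat.descFactorial_eq_factorial_mul_choose, Nat.cast_mul]
    field_simp
  have large {i : ℕ} (hi : m ≤ i) : (N ^ i) v = 0 := by
    rw [← Nat.sub_add_cancel hi, pow_add, Module.End.mul_apply, hN, map_zero]
  calc eval (n : k) (∑ i ∈ Finset.range m, C (φ ((N ^ i) v) / (i.factorial : k)) *
          descPochhammer k i)
      = ∑ i ∈ Finset.range m, n.choose i * φ ((N ^ i) v) := by
        simp only [eval_finsetSum, eval_mul, eval_C, descPochhammer_eval_eq_descFactorial, summand]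
    _ = ∑ i ∈ Finset.range (max m (n + 1)), n.choose i * φ ((N ^ i) v) :=
        Finset.sum_subset (Finset.range_mono (le_max_left _ _)) fun i _ hi => by
          rw [large (by simpa using hi), map_zero, mul_zero]
    _ = ∑ i ∈ Finset.range (n + 1), n.choose i * φ ((N ^ i) v) :=
        (Finset.sum_subset (Finset.range_mono (le_max_right _ _)) fun i _ hi => by
          rw [Nat.choose_eq_zero_of_lt (by simpa using hi), Nat.cast_zero, zero_mul]).symm
    _ = φ (((1 + N) ^ n) v) := by
        simp only [add_comm 1 N, (Commute.one_right N).add_pow, one_pow, mul_one,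
          LinearMap.sum_apply, map_sum, Module.End.mul_apply, Module.End.natCast_apply, map_nsmul,
          nsmul_eq_mul]

theorem eval_eq_eval_of_isIdempotentElem_eval_natCast {P : k[X]}
    (hP : ∀ n : ℕ, IsIdempotentElem (P.eval (n : k))) (x y : k) : P.eval x = P.eval y := by
  have idempotent : IsIdempotentElem P := by
    refine eq_of_infinite_eval_eq _ _ ((Set.infinite_range_of_injective
      (Nat.cast_injective (R := k))).mono ?_)
    rintro _ ⟨n, rfl⟩
    exact (eval_mul ..).trans (hP n)
  rcases IsIdempotentElem.iff_eq_zero_or_one.mp idempotent with rfl | rfl <;> simp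

end BinomialExpansion

namespace DGA

/-- A conilpotent comultiplication on an augmented dg algebra: a morphism `A → A ⊗ A` of dg
algebras, with the augmentation as counit, such that contraction with any functional that vanishes
at `1` is locally nilpotent. Coassociativity is not required. -/
structure ConilpotentComul {k : Type u} [CommRing k] (A : DGA.{u, v} k) where
  comul : A.carrier →ₐ[k] A.TensorSquare
  comul_mem : ∀ n a, a ∈ A.gr n → comul a ∈ A.tensorGr n
  comul_d : ∀ a, comul (A.d a) = A.tensorD (comul a)
  contract_aug : ∀ a, A.contract A.aug (comul a) = a
  aug_contract : ∀ (f : A.carrier →ₗ[k] k) a, A.aug (A.contract f (comul a)) = f a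
  conilpotent : ∀ f : A.carrier →ₗ[k] k, f 1 = 0 → ∀ a,
    ∃ n : ℕ, ((A.contract f ∘ₗ comul.toLinearMap : Module.End k A.carrier) ^ n) a = 0

namespace ConilpotentComul

variable {k : Type u} [Field k] {A : DGA.{u, v} k} (Δ : A.ConilpotentComul)

/-- The translation `(f ⊗ 1) Δ`. -/
noncomputable def translate (f : A.carrier →ₗ[k] k) : Module.End k A.carrier :=
  A.contract f ∘ₗ Δ.comul.toLinearMap

theorem translate_apply (f : A.carrier →ₗ[k] k) (a : A.carrier) :
    Δ.translate f a = A.contract f (Δ.comul a) := rfl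

theorem tensorD_comul {n : ℤ} {a : A.carrier} (ha : a ∈ A.cycles n) :
    A.tensorD (Δ.comul a) = 0 := by
  rw [← Δ.comul_d, (mem_cycles.mp ha).2, map_zero]

theorem translate_mem_cycles {f : A.carrier →ₗ[k] k} (hf : A.IsCocycle f) {n : ℤ} {a : A.carrier}
    (ha : a ∈ A.cycles n) : Δ.translate f a ∈ A.cycles n :=
  hf.contract_mem_cycles (Δ.comul_mem n a ha.1) (Δ.tensorD_comul ha)

theorem translate_mem_boundaries {f : A.carrier →ₗ[k] k} (hf : A.IsCocycle f) {n : ℤ}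
    {a : A.carrier} (ha : a ∈ A.boundaries n) : Δ.translate f a ∈ A.boundaries n := by
  obtain ⟨b, hb, rfl⟩ := ha
  refine ⟨Δ.translate f b, hf.contract_mem (Δ.comul_mem _ b hb), ?_⟩
  rw [translate_apply, translate_apply, Δ.comul_d, hf.contract_tensorD]

theorem translate_mul_sub_mem_boundaries {f : A.carrier →ₗ[k] k} (hf : A.IsCharacter f)
    (hA : A.IsConnective) {a b : A.carrier} (ha : a ∈ A.cycles 0) (hb : b ∈ A.cycles 0) :
    Δ.translate f (a * b) - Δ.translate f a * Δ.translate f b ∈ A.boundaries 0 := by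
  refine mem_boundaries.mpr ⟨sub_mem (Δ.translate_mem_cycles hf.1 (mul_mem_cycles ha hb)).1
    (mul_mem_cycles (Δ.translate_mem_cycles hf.1 ha) (Δ.translate_mem_cycles hf.1 hb)).1, ?_⟩
  rw [translate_apply, map_mul]
  exact hf.contract_mul_sub_mem_range_d hA (Δ.comul_mem 0 a ha.1) (Δ.tensorD_comul ha)
    (Δ.comul_mem 0 b hb.1) (Δ.tensorD_comul hb)

theorem translate_pow_idempotent {f : A.carrier →ₗ[k] k} (hf : A.IsCharacter f)
    (hA : A.IsConnective) {e : A.carrier} (he : e ∈ A.cycles 0)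
    (hee : e * e - e ∈ A.boundaries 0) (n : ℕ) :
    (Δ.translate f ^ n) e ∈ A.cycles 0 ∧
      (Δ.translate f ^ n) e * (Δ.translate f ^ n) e - (Δ.translate f ^ n) e ∈ A.boundaries 0 := by
  induction n with
  | zero => exact ⟨he, hee⟩
  | succ n ih =>
    obtain ⟨cycle, idempotent⟩ := ih
    rw [pow_succ', Module.End.mul_apply]
    refine ⟨Δ.translate_mem_cycles hf.1 cycle, ?_⟩
    have translated := Δ.translate_mem_boundaries hf.1 idempotent
    rw [map_sub] at translated
    simpa only [sub_sub_sub_cancel_left] using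
      sub_mem translated (Δ.translate_mul_sub_mem_boundaries hf hA cycle cycle)

theorem translate_eq_one_add (f : A.carrier →ₗ[k] k) :
    Δ.translate f = 1 + Δ.translate (f - A.aug.toLinearMap) := by
  ext a
  have counit : A.contract A.aug.toLinearMap (Δ.comul a) = a := Δ.contract_aug a
  simp only [translate_apply, contract_sub, LinearMap.add_apply, LinearMap.sub_apply, counit,
    Module.End.one_apply, add_sub_cancel]

theorem not_hasSeparatedIdempotent [CharZero k] (Δ : A.ConilpotentComul) :
    ¬ A.HasSeparatedIdempotent := by
  rintro ⟨hA, f, hf, e, he, hee, aug_e, f_e⟩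
  obtain ⟨m, nilpotent⟩ := Δ.conilpotent (f - A.aug.toLinearMap) (by simp [hf.one]) e
  obtain ⟨P, hP⟩ := exists_eval_natCast_eq_one_add_pow_apply _ A.aug.toLinearMap nilpotent
  have eval_P (n : ℕ) : P.eval (n : k) = A.aug ((Δ.translate f ^ n) e) := by
    rw [hP, translate_eq_one_add]
    rfl
  have idempotent (n : ℕ) : IsIdempotentElem (P.eval (n : k)) := by
    obtain ⟨b, -, hb⟩ := (Δ.translate_pow_idempotent hf hA he hee n).2
    rw [eval_P, IsIdempotentElem, ← map_mul, ← sub_eq_zero, ← map_sub, ← hb, A.aug_d]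
  have constant := eval_eq_eval_of_isIdempotentElem_eval_natCast idempotent (0 : ℕ) (1 : ℕ)
  rw [eval_P, eval_P, pow_zero, pow_one, Module.End.one_apply, aug_e] at constant
  exact zero_ne_one (constant.trans ((Δ.aug_contract f e).trans f_e))

end ConilpotentComul

end DGA

/-! ### The cobar construction of a cocommutative dg coalgebra -/

namespace DGA

open GradedTensorProduct

variable {k : Type u} [CommRing k] {A : DGA.{u, v} k}

theorem mul_primitive_gtmul {m n : ℤ} {a b : A.carrier} (ha : a ∈ A.gr m) (hb : b ∈ A.gr n)
    (c : A.carrier) :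
    ((a ᵍ⊗ₜ[k] 1 : A.TensorSquare) + (1 ᵍ⊗ₜ[k] a)) * (b ᵍ⊗ₜ[k] c : A.TensorSquare) =
      ((a * b) ᵍ⊗ₜ[k] c : A.TensorSquare) +
        koszulSign k (m * n) • (b ᵍ⊗ₜ[k] (a * c) : A.TensorSquare) := by
  rw [add_mul, gtmul_mul_gtmul _ _ A.one_mem hb, gtmul_mul_gtmul _ _ ha hb, zero_mul,
    koszulSign_zero, one_smul, one_mul, one_mul]

variable (A) in
/-- The operator `a ↦ (-1)^(n |a|) a`. -/
noncomputable def twist (n : ℤ) : Module.End k A.carrier :=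
  scaleDeg A.isInternal fun i => koszulSign k (n * i)

theorem twist_of_mem (n : ℤ) {i : ℤ} {a : A.carrier} (ha : a ∈ A.gr i) :
    A.twist n a = koszulSign k (n * i) • a :=
  scaleDeg_of_mem _ _ ha

theorem contract_primitive_mul {n : ℤ} {a : A.carrier} (ha : a ∈ A.gr n) (f : A.carrier →ₗ[k] k)
    (x : A.TensorSquare) :
    A.contract f (((a ᵍ⊗ₜ[k] 1 : A.TensorSquare) + (1 ᵍ⊗ₜ[k] a)) * x) =
      A.contract (f ∘ₗ LinearMap.mulLeft k a) x + a * A.contract (f ∘ₗ A.twist n) x := by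
  induction x using tensorSquare_induction with
  | add x y hx hy =>
    simp only [mul_add, map_add, hx, hy]
    abel
  | tmul _ _ b c hb _ =>
    rw [mul_primitive_gtmul ha hb, map_add, map_smul]
    simp only [contract_gtmul, LinearMap.comp_apply, LinearMap.mulLeft_apply, twist_of_mem n hb,
      map_smul, mul_smul_comm, smul_smul, smul_eq_mul]

theorem contract_aug_gtmul (a b : A.carrier) :
    A.contract A.aug (a ᵍ⊗ₜ[k] b) = A.aug a • b := rfl

theorem contract_aug_mul (x y : A.TensorSquare) :
    A.contract A.aug (x * y) = A.contract A.aug x * A.contract A.aug y := by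
  induction x using tensorSquare_induction with
  | add x x' hx hx' => simp only [add_mul, map_add, hx, hx']
  | tmul _ j a b _ hb =>
    induction y using tensorSquare_induction with
    | add y y' hy hy' => simp only [mul_add, map_add, hy, hy']
    | tmul p _ a' b' ha' _ =>
      have sign : koszulSign k (j * p) * A.aug a' = A.aug a' := by
        obtain rfl | hp := eq_or_ne p 0
        · rw [mul_zero, koszulSign_zero, one_mul]
        · rw [A.aug_of_mem p a' hp ha', mul_zero]
      rw [gtmul_mul_gtmul a b' hb ha', map_smul]
      rw [contract_aug_gtmul, contract_aug_gtmul, contract_aug_gtmul, map_mul, smul_smul,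
        mul_left_comm, sign, smul_mul_smul_comm]

end DGA

namespace DGC

open DGA GradedTensorProduct

section CobarWords

variable {k : Type u} [CommRing k] (C : DGC.{u, v} k)

/-- The generators `s⁻¹ x` as elements of the dg algebra `Ω C`. -/
noncomputable def cobarGen : C.bar →ₗ[k] C.cobarObj.carrier :=
  C.gen

/-- The quadratic elements `x ⊗ y ↦ (-1)^|x| s⁻¹ x · s⁻¹ y`. -/
noncomputable def cobarQuad : C.bar ⊗[k] C.bar →ₗ[k] C.cobarObj.carrier :=
  LinearMap.mul' k _ ∘ₗ TensorProduct.map (C.cobarGen ∘ₗ C.barSign) C.cobarGen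

theorem d_cobarGen (x : C.bar) :
    C.cobarObj.d (C.cobarGen x) = - C.cobarGen (C.barD x) + C.cobarQuad (C.barComul x) :=
  (C.cobarD_gen x).trans (C.cobarDGen_apply x)

theorem aug_cobarGen (x : C.bar) : C.cobarObj.aug (C.cobarGen x) = 0 :=
  C.cobarAug_gen x

variable {C}

theorem cobarGen_mem {n : ℤ} {x : C.bar} (hx : x ∈ C.barGr n) :
    C.cobarGen x ∈ C.cobarObj.gr (n - 1) :=
  C.cobarGr_gen hx

theorem cobarObj_gr_induction {P : ∀ n (a : C.cobarObj.carrier), a ∈ C.cobarObj.gr n → Prop}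
    (one : P 0 1 C.cobarObj.one_mem)
    (gen_mul : ∀ m n x (w : C.cobarObj.carrier) (hx : x ∈ C.barGr m)
      (hw : w ∈ C.cobarObj.gr n), P n w hw →
      P (m - 1 + n) (C.cobarGen x * w) (C.cobarObj.mul_mem _ _ _ _ (cobarGen_mem hx) hw))
    (zero : ∀ n, P n 0 (zero_mem _))
    (add : ∀ n a b ha hb, P n a ha → P n b hb → P n (a + b) (add_mem ha hb))
    (smul : ∀ n (c : k) (a : C.cobarObj.carrier) (ha : a ∈ C.cobarObj.gr n), P n a ha →
      P n (c • a) (Submodule.smul_mem _ c ha))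
    {n : ℤ} {a : C.cobarObj.carrier} (ha : a ∈ C.cobarObj.gr n) : P n a ha := by
  induction ha using cobarGr_induction with
  | word _ hw =>
    induction hw with
    | one => exact one
    | cons hx hw ih => exact gen_mul _ _ _ _ hx (Submodule.subset_span (M := C.cobarAlg) hw) ih
  | zero => exact zero n
  | add a b ha hb iha ihb => exact add n a b ha hb iha ihb
  | smul c a ha ih => exact smul n c a ha ih

theorem cobarObj_induction {P : C.cobarObj.carrier → Prop} (one : P 1)
    (gen_mul : ∀ n x w, x ∈ C.barGr n → P w → P (C.cobarGen x * w))
    (add : ∀ a b, P a → P b → P (a + b)) (smul : ∀ (c : k) a, P a → P (c • a))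
    (a : C.cobarObj.carrier) : P a := by
  induction a using graded_induction C.cobarObj.isInternal with
  | add a b ha hb => exact add a b ha hb
  | hom n a ha =>
    induction ha using cobarObj_gr_induction with
    | one => exact one
    | gen_mul m _ x w hx _ ih => exact gen_mul m x w hx ih
    | zero => exact zero_smul k (1 : C.cobarObj.carrier) ▸ smul 0 1 one
    | add _ a b _ _ ha hb => exact add a b ha hb
    | smul _ c a _ ha => exact smul c a ha

variable (C) in
/-- The span of the words of length less than `r` in the homogeneous generators of `Ω C`. -/
noncomputable def wordFiltration : ℕ → Submodule k C.cobarObj.carrier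
  | 0 => ⊥
  | r + 1 => Submodule.span k
      ({1} ∪ {a | ∃ n, ∃ x ∈ C.barGr n, ∃ w ∈ wordFiltration r, C.cobarGen x * w = a})

theorem one_mem_wordFiltration (r : ℕ) : 1 ∈ C.wordFiltration (r + 1) :=
  Submodule.subset_span (.inl rfl)

theorem cobarGen_mul_mem_wordFiltration {n : ℤ} {x : C.bar} (hx : x ∈ C.barGr n) {r : ℕ}
    {w : C.cobarObj.carrier} (hw : w ∈ C.wordFiltration r) :
    C.cobarGen x * w ∈ C.wordFiltration (r + 1) :=
  Submodule.subset_span (.inr ⟨n, x, hx, w, hw, rfl⟩)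

theorem wordFiltration_mono : Monotone C.wordFiltration := by
  refine monotone_nat_of_le_succ fun r => ?_
  induction r with
  | zero => exact bot_le
  | succ r ih =>
    refine Submodule.span_le.mpr ?_
    rintro _ (rfl | ⟨n, x, hx, w, hw, rfl⟩)
    · exact one_mem_wordFiltration _
    · exact cobarGen_mul_mem_wordFiltration hx (ih hw)

theorem exists_mem_wordFiltration (a : C.cobarObj.carrier) : ∃ r, a ∈ C.wordFiltration r := by
  induction a using cobarObj_induction with
  | one => exact ⟨1, one_mem_wordFiltration 0⟩
  | gen_mul n x w hx ih =>
    obtain ⟨r, hr⟩ := ih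
    exact ⟨r + 1, cobarGen_mul_mem_wordFiltration hx hr⟩
  | add a b ha hb =>
    obtain ⟨r, hr⟩ := ha
    obtain ⟨s, hs⟩ := hb
    exact ⟨max r s, add_mem (wordFiltration_mono (le_max_left r s) hr)
      (wordFiltration_mono (le_max_right r s) hs)⟩
  | smul c a ha =>
    obtain ⟨r, hr⟩ := ha
    exact ⟨r, Submodule.smul_mem _ c hr⟩

end CobarWords

section CobarComul

variable {k : Type u} [CommRing k] (C : DGC.{u, v} k)

/-- The algebra map `Ω C → Ω C ⊗ Ω C` for which the generators are primitive. -/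
noncomputable def cobarComul : C.cobarObj.carrier →ₐ[k] C.cobarObj.TensorSquare :=
  TensorAlgebra.lift k
    ((includeLeft C.cobarObj.gr C.cobarObj.gr).toLinearMap ∘ₗ C.cobarGen +
      (includeRight C.cobarObj.gr C.cobarObj.gr).toLinearMap ∘ₗ C.cobarGen)

theorem cobarComul_cobarGen (x : C.bar) :
    C.cobarComul (C.cobarGen x) =
      (C.cobarGen x ᵍ⊗ₜ[k] 1 : C.cobarObj.TensorSquare) + (1 ᵍ⊗ₜ[k] C.cobarGen x) :=
  TensorAlgebra.lift_ι_apply _ x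

theorem cobarComul_mem {n : ℤ} {a : C.cobarObj.carrier} (ha : a ∈ C.cobarObj.gr n) :
    C.cobarComul a ∈ C.cobarObj.tensorGr n := by
  have one_mem : (1 : C.cobarObj.carrier) ∈ C.cobarObj.gr 0 := C.cobarObj.one_mem
  induction ha using cobarObj_gr_induction with
  | one =>
    rw [map_one]
    exact gtmul_mem_tensorGr (add_zero 0) one_mem one_mem
  | gen_mul m n x w hx _ ih =>
    rw [map_mul, cobarComul_cobarGen]
    exact mul_mem_tensorGr (add_mem (gtmul_mem_tensorGr (add_zero _) (cobarGen_mem hx) one_mem)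
      (gtmul_mem_tensorGr (zero_add _) one_mem (cobarGen_mem hx))) ih
  | zero => rw [map_zero]; exact zero_mem _
  | add n a b _ _ ha hb => rw [map_add]; exact add_mem ha hb
  | smul n c a _ ha => rw [map_smul]; exact Submodule.smul_mem _ c ha

theorem gradedSwap_barComul (hC : C.IsCocommutative) (x : C.bar) :
    gradedSwap C.barGr_isInternal (C.barComul x) = C.barComul x := by
  have swap_map (t : C.carrier ⊗[k] C.carrier) :
      gradedSwap C.barGr_isInternal (TensorProduct.map C.proj C.proj t) =
        TensorProduct.map C.proj C.proj (gradedSwap C.isInternal t) := by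
    induction t using tensor_graded_induction C.isInternal with
    | add s t hs ht => simp only [map_add, hs, ht]
    | tmul i j a b ha hb =>
      rw [gradedSwap_tmul _ ha hb, map_smul, TensorProduct.map_tmul, TensorProduct.map_tmul,
        gradedSwap_tmul _ (Submodule.mem_map_of_mem ha) (Submodule.mem_map_of_mem hb)]
  obtain ⟨x, rfl⟩ := Submodule.mkQ_surjective _ x
  rw [barComul_proj, swap_map, hC x]

/-- The mixed terms `x ⊗ y ↦ (-1)^|x| s⁻¹ x ⊗ s⁻¹ y` in the coproduct of `cobarQuad`. -/
noncomputable def cobarCross : C.bar ⊗[k] C.bar →ₗ[k] C.cobarObj.TensorSquare :=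
  (GradedTensorProduct.of k C.cobarObj.gr C.cobarObj.gr).toLinearMap ∘ₗ
    TensorProduct.map (C.cobarGen ∘ₗ C.barSign) C.cobarGen

variable {C}

theorem cobarQuad_tmul {i : ℤ} {x : C.bar} (hx : x ∈ C.barGr i) (y : C.bar) :
    C.cobarQuad (x ⊗ₜ y) = koszulSign k i • (C.cobarGen x * C.cobarGen y) := by
  rw [← smul_mul_assoc, ← map_smul, ← C.barSign_of_mem hx]
  rfl

theorem cobarCross_tmul {i : ℤ} {x : C.bar} (hx : x ∈ C.barGr i) (y : C.bar) :
    C.cobarCross (x ⊗ₜ y) =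
      koszulSign k i • (C.cobarGen x ᵍ⊗ₜ C.cobarGen y : C.cobarObj.TensorSquare) := by
  rw [← smul_gtmul, ← map_smul, ← C.barSign_of_mem hx]
  rfl

theorem cobarComul_cobarQuad (t : C.bar ⊗[k] C.bar) :
    C.cobarComul (C.cobarQuad t) =
      (C.cobarQuad t ᵍ⊗ₜ[k] 1 : C.cobarObj.TensorSquare) + (1 ᵍ⊗ₜ[k] C.cobarQuad t) +
        (C.cobarCross t - C.cobarCross (gradedSwap C.barGr_isInternal t)) := by
  induction t using tensor_graded_induction C.barGr_isInternal with
  | add s t hs ht =>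
    simp only [map_add, add_gtmul, gtmul_add, hs, ht]
    abel
  | tmul i j x y hx hy =>
    have sign : koszulSign k i * koszulSign k ((i - 1) * (j - 1)) =
        - (koszulSign k (i * j) * koszulSign k j) := by
      rw [← koszulSign_add, ← koszulSign_add, ← koszulSign_sub_one,
        show i * j + j - 1 = (i + (i - 1) * (j - 1)) + ((j - 1) + (j - 1)) by ring,
        koszulSign_add _ (j - 1 + (j - 1)), koszulSign_add (j - 1), koszulSign_mul_self, mul_one]
    have one_mem : (1 : C.cobarObj.carrier) ∈ C.cobarObj.gr 0 := C.cobarObj.one_mem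
    rw [gradedSwap_tmul _ hx hy, map_smul, cobarQuad_tmul hx, cobarCross_tmul hx,
      cobarCross_tmul hy, map_smul, map_mul, cobarComul_cobarGen, cobarComul_cobarGen, mul_add,
      mul_primitive_gtmul (cobarGen_mem hx) (cobarGen_mem hy),
      mul_primitive_gtmul (cobarGen_mem hx) one_mem, smul_gtmul, gtmul_smul, mul_one,
      mul_zero, koszulSign_zero, one_smul]
    simp only [smul_add, smul_smul, sign, neg_smul]
    abel

theorem cobarComul_d (hC : C.IsCocommutative) (a : C.cobarObj.carrier) :
    C.cobarComul (C.cobarObj.d a) = C.cobarObj.tensorD (C.cobarComul a) := by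
  have one_mem : (1 : C.cobarObj.carrier) ∈ C.cobarObj.gr 0 := C.cobarObj.one_mem
  have d_one : C.cobarObj.d 1 = 0 := (one_mem_cycles _).2
  have gtmul_zero (a : C.cobarObj.carrier) : (a ᵍ⊗ₜ[k] 0 : C.cobarObj.TensorSquare) = 0 := by
    simpa only [zero_smul] using gtmul_smul (0 : k) a 0
  have zero_gtmul (a : C.cobarObj.carrier) : (0 ᵍ⊗ₜ[k] a : C.cobarObj.TensorSquare) = 0 := by
    simpa only [zero_smul] using smul_gtmul (0 : k) 0 a
  induction a using cobarObj_induction with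
  | one =>
    rw [d_one, map_zero, map_one]
    change 0 = C.cobarObj.tensorD (1 ᵍ⊗ₜ[k] 1)
    rw [tensorD_gtmul one_mem, d_one, zero_gtmul, gtmul_zero, smul_zero, add_zero]
  | add a b ha hb => simp only [map_add, ha, hb]
  | smul c a ha => simp only [map_smul, ha]
  | gen_mul n x w hx ih =>
    have comul_d_gen : C.cobarComul (C.cobarObj.d (C.cobarGen x)) =
        C.cobarObj.tensorD (C.cobarComul (C.cobarGen x)) := by
      have neg_eq_smul {M : Type (max u v)} [AddCommGroup M] [Module k M] (y : M) :
          -y = (-1 : k) • y := (neg_one_smul k y).symm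
      rw [cobarComul_cobarGen, map_add, tensorD_gtmul (cobarGen_mem hx), tensorD_gtmul one_mem,
        d_one, zero_gtmul, gtmul_zero, koszulSign_zero, one_smul, smul_zero, add_zero, zero_add,
        d_cobarGen, map_add, map_neg, cobarComul_cobarGen, cobarComul_cobarQuad,
        gradedSwap_barComul C hC, sub_self, add_zero, add_gtmul, gtmul_add, neg_eq_smul,
        neg_eq_smul (C.cobarGen _), smul_gtmul, gtmul_smul, smul_add]
      abel
    rw [C.cobarObj.leibniz _ _ _ (cobarGen_mem hx), map_add, map_smul, map_mul, map_mul, map_mul,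
      tensorD_mul (C.cobarComul_mem (cobarGen_mem hx)), comul_d_gen, ih]

theorem contract_aug_cobarComul (a : C.cobarObj.carrier) :
    C.cobarObj.contract C.cobarObj.aug (C.cobarComul a) = a := by
  induction a using cobarObj_induction with
  | one =>
    rw [map_one]
    exact (contract_aug_gtmul 1 1).trans (by rw [map_one, one_smul])
  | add a b ha hb => simp only [map_add, ha, hb]
  | smul c a ha => simp only [map_smul, ha]
  | gen_mul _ x w _ ih =>
    rw [map_mul, contract_aug_mul, ih, cobarComul_cobarGen, map_add, contract_aug_gtmul,
      contract_aug_gtmul, aug_cobarGen, zero_smul, map_one, one_smul, zero_add]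

theorem contract_cobarComul_cobarGen_mul {n : ℤ} {x : C.bar} (hx : x ∈ C.barGr n)
    (f : C.cobarObj.carrier →ₗ[k] k) (w : C.cobarObj.carrier) :
    C.cobarObj.contract f (C.cobarComul (C.cobarGen x * w)) =
      C.cobarObj.contract (f ∘ₗ LinearMap.mulLeft k (C.cobarGen x)) (C.cobarComul w) +
        C.cobarGen x * C.cobarObj.contract (f ∘ₗ C.cobarObj.twist (n - 1)) (C.cobarComul w) := by
  rw [map_mul, cobarComul_cobarGen, contract_primitive_mul (cobarGen_mem hx)]

theorem contract_cobarComul_one (f : C.cobarObj.carrier →ₗ[k] k) :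
    C.cobarObj.contract f (C.cobarComul 1) = f 1 • 1 := by
  rw [map_one]
  rfl

theorem aug_contract_cobarComul (f : C.cobarObj.carrier →ₗ[k] k) (a : C.cobarObj.carrier) :
    C.cobarObj.aug (C.cobarObj.contract f (C.cobarComul a)) = f a := by
  induction a using cobarObj_induction generalizing f with
  | one => rw [contract_cobarComul_one, map_smul, map_one C.cobarObj.aug, smul_eq_mul, mul_one]
  | add a b ha hb => simp only [map_add, ha, hb]
  | smul c a ha => simp only [map_smul, ha]
  | gen_mul n x w hx ih =>
    rw [contract_cobarComul_cobarGen_mul hx, map_add, map_mul, ih, aug_cobarGen, zero_mul,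
      add_zero, LinearMap.comp_apply, LinearMap.mulLeft_apply]

theorem contract_cobarComul_sub_mem_wordFiltration (f : C.cobarObj.carrier →ₗ[k] k) {r : ℕ}
    {w : C.cobarObj.carrier} (hw : w ∈ C.wordFiltration r) :
    C.cobarObj.contract f (C.cobarComul w) - f 1 • w ∈ C.wordFiltration (r - 1) := by
  induction r generalizing f w with
  | zero =>
    obtain rfl : w = 0 := hw
    simp only [map_zero, smul_zero, sub_zero, zero_mem]
  | succ r ih =>
    rw [Nat.add_sub_cancel]
    induction hw using Submodule.span_induction with
    | zero => simp only [map_zero, smul_zero, sub_zero, zero_mem]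
    | add a b _ _ ha hb =>
      simpa only [map_add, smul_add, add_sub_add_comm] using add_mem ha hb
    | smul c a _ ha =>
      simpa only [map_smul, smul_comm (f 1) c, ← smul_sub] using Submodule.smul_mem _ c ha
    | mem a ha =>
      obtain rfl | ⟨n, x, hx, w, hw, rfl⟩ := ha
      · rw [contract_cobarComul_one, sub_self]
        exact zero_mem _
      have contract_mem (g : C.cobarObj.carrier →ₗ[k] k) :
          C.cobarObj.contract g (C.cobarComul w) ∈ C.wordFiltration r := by
        simpa only [sub_add_cancel] using add_mem
          (wordFiltration_mono (Nat.sub_le r 1) (ih g hw)) (Submodule.smul_mem _ (g 1) hw)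
      have cobarGen_mul_mem {u} (hu : u ∈ C.wordFiltration (r - 1)) :
          C.cobarGen x * u ∈ C.wordFiltration r := by
        cases r with
        | zero =>
          obtain rfl : u = 0 := hu
          rw [mul_zero]
          exact zero_mem _
        | succ r => exact cobarGen_mul_mem_wordFiltration hx hu
      have twist_one : (f ∘ₗ C.cobarObj.twist (n - 1)) 1 = f 1 := by
        rw [LinearMap.comp_apply, twist_of_mem _ C.cobarObj.one_mem, mul_zero, koszulSign_zero,
          one_smul]
      have lowered := cobarGen_mul_mem (ih (f ∘ₗ C.cobarObj.twist (n - 1)) hw)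
      rw [twist_one, mul_sub, mul_smul_comm] at lowered
      rw [contract_cobarComul_cobarGen_mul hx, add_sub_assoc]
      exact add_mem (contract_mem _) lowered

theorem contract_cobarComul_pow_eq_zero {f : C.cobarObj.carrier →ₗ[k] k} (hf : f 1 = 0) {r : ℕ}
    {w : C.cobarObj.carrier} (hw : w ∈ C.wordFiltration r) :
    ((C.cobarObj.contract f ∘ₗ C.cobarComul.toLinearMap) ^ r) w = 0 := by
  induction r generalizing w with
  | zero => exact hw
  | succ r ih =>
    rw [pow_succ, Module.End.mul_apply]
    refine ih ?_
    have lowered := contract_cobarComul_sub_mem_wordFiltration f hw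
    rwa [hf, zero_smul, sub_zero] at lowered

variable (C) in
/-- The conilpotent dg bialgebra structure on the cobar construction of a cocommutative dg
coalgebra. -/
noncomputable def cobarConilpotentComul (hC : C.IsCocommutative) :
    C.cobarObj.ConilpotentComul where
  comul := C.cobarComul
  comul_mem _ _ := C.cobarComul_mem
  comul_d := cobarComul_d hC
  contract_aug := contract_aug_cobarComul
  aug_contract := aug_contract_cobarComul
  conilpotent _ hf a :=
    (exists_mem_wordFiltration a).imp fun _ ha => contract_cobarComul_pow_eq_zero hf ha

end CobarComul

end DGC

/-! ### Invariance under quasi-isomorphisms -/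

namespace DGA

section Homology

variable {k : Type u} [CommRing k] {A B : DGA.{u, v} k} (φ : A ⟶ B)

theorem map_mem_cycles {n : ℤ} {a : A.carrier} (ha : a ∈ A.cycles n) :
    Hom.toAlgHom φ a ∈ B.cycles n :=
  mem_cycles.mpr ⟨Hom.map_mem φ n a ha.1, by
    rw [← Hom.map_d φ, (mem_cycles.mp ha).2, map_zero]⟩

theorem map_mem_boundaries {n : ℤ} {a : A.carrier} (ha : a ∈ A.boundaries n) :
    Hom.toAlgHom φ a ∈ B.boundaries n := by
  obtain ⟨c, hc, rfl⟩ := ha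
  exact ⟨_, Hom.map_mem φ _ c hc, (Hom.map_d φ c).symm⟩

/-- The homology class of a cycle. -/
noncomputable def homologyClass (A : DGA.{u, v} k) (n : ℤ) : A.cycles n →ₗ[k] A.homology n :=
  Submodule.mkQ _

theorem homologyClass_eq_zero_iff {n : ℤ} {a : A.cycles n} :
    A.homologyClass n a = 0 ↔ (a : A.carrier) ∈ A.boundaries n :=
  Submodule.Quotient.mk_eq_zero _

theorem homologyClass_eq_iff {n : ℤ} {a b : A.carrier} (ha : a ∈ A.cycles n)
    (hb : b ∈ A.cycles n) :
    A.homologyClass n ⟨a, ha⟩ = A.homologyClass n ⟨b, hb⟩ ↔ a - b ∈ A.boundaries n :=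
  Submodule.Quotient.eq _

theorem homologyMap_homologyClass {n : ℤ} {a : A.carrier} (ha : a ∈ A.cycles n) :
    homologyMap φ n (A.homologyClass n ⟨a, ha⟩) =
      B.homologyClass n ⟨Hom.toAlgHom φ a, map_mem_cycles φ ha⟩ :=
  rfl

variable {φ}

theorem IsQuasiIso.mem_boundaries (hφ : IsQuasiIso φ) {n : ℤ} {a : A.carrier}
    (ha : a ∈ A.cycles n) (hφa : Hom.toAlgHom φ a ∈ B.boundaries n) : a ∈ A.boundaries n := by
  refine homologyClass_eq_zero_iff.mp ((hφ n).1 (a₁ := A.homologyClass n ⟨a, ha⟩) ?_)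
  rw [map_zero, homologyMap_homologyClass]
  exact homologyClass_eq_zero_iff.mpr hφa

theorem IsQuasiIso.exists_lift (hφ : IsQuasiIso φ) {n : ℤ} {b : B.carrier}
    (hb : b ∈ B.cycles n) :
    ∃ a ∈ A.cycles n, Hom.toAlgHom φ a - b ∈ B.boundaries n := by
  obtain ⟨q, hq⟩ := (hφ n).2 (B.homologyClass n ⟨b, hb⟩)
  obtain ⟨⟨a, ha⟩, rfl⟩ := Submodule.mkQ_surjective _ q
  exact ⟨a, ha, (homologyClass_eq_iff (map_mem_cycles φ ha) hb).mp hq⟩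

theorem IsQuasiIso.isConnective_iff (hφ : IsQuasiIso φ) : A.IsConnective ↔ B.IsConnective := by
  refine ⟨fun hA n hn b hb => ?_, fun hB n hn a ha =>
    hφ.mem_boundaries ha (hB n hn (map_mem_cycles φ ha))⟩
  obtain ⟨a, ha, hab⟩ := hφ.exists_lift hb
  simpa only [sub_sub_cancel] using sub_mem (map_mem_boundaries φ (hA n hn ha)) hab

theorem IsCocycle.eq_of_sub_mem_boundaries {f : A.carrier →ₗ[k] k} (hf : A.IsCocycle f) {n : ℤ}
    {a b : A.carrier} (hab : a - b ∈ A.boundaries n) : f a = f b := by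
  obtain ⟨c, -, hc⟩ := hab
  rw [← sub_eq_zero, ← map_sub, ← hc, hf.d]

theorem IsCharacter.comp {g : B.carrier →ₗ[k] k} (hg : B.IsCharacter g) (φ : A ⟶ B) :
    A.IsCharacter (g ∘ₗ (Hom.toAlgHom φ).toLinearMap) where
  of_mem n a hn ha := hg.of_mem n _ hn (Hom.map_mem φ n a ha)
  d a := (congrArg g (Hom.map_d φ a)).trans (hg.d _)
  one := (congrArg g (map_one (Hom.toAlgHom φ))).trans hg.one
  mul a ha b hb := (congrArg g (map_mul (Hom.toAlgHom φ) a b)).trans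
    (hg.mul _ (map_mem_cycles φ ha) _ (map_mem_cycles φ hb))

theorem IsQuasiIso.hasSeparatedIdempotent_of_codomain (hφ : IsQuasiIso φ)
    (hB : B.HasSeparatedIdempotent) : A.HasSeparatedIdempotent := by
  obtain ⟨connective, g, hg, e, he, hee, aug_e, g_e⟩ := hB
  obtain ⟨a, ha, hae⟩ := hφ.exists_lift he
  refine ⟨hφ.isConnective_iff.mpr connective, _, hg.comp φ, a, ha, ?_, ?_, ?_⟩
  · refine hφ.mem_boundaries (sub_mem (mul_mem_cycles ha ha) ha) ?_
    have squares := mul_sub_mul_mem_boundaries (map_mem_cycles φ ha) he hae hae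
    have decomposition (x : B.carrier) :
        x * x - x = x * x - e * e + (e * e - e - (x - e)) := by abel
    rw [map_sub, map_mul, decomposition]
    exact add_mem squares (sub_mem hee hae)
  · obtain ⟨c, -, hc⟩ := hae
    rw [← Hom.map_aug φ, ← aug_e, ← sub_eq_zero, ← map_sub, ← hc, B.aug_d]
  · exact (hg.eq_of_sub_mem_boundaries hae).trans g_e

end Homology

section Field

variable {k : Type u} [Field k] {A B : DGA.{u, v} k} {φ : A ⟶ B}

theorem IsQuasiIso.exists_isCocycle_extending (hφ : IsQuasiIso φ) {f : A.carrier →ₗ[k] k}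
    (hf : A.IsCocycle f) :
    ∃ g, B.IsCocycle g ∧ ∀ a ∈ A.cycles 0, g (Hom.toAlgHom φ a) = f a := by
  let homologyEquiv := LinearEquiv.ofBijective (homologyMap φ 0) (hφ 0)
  let functional : A.homology 0 →ₗ[k] k :=
    Submodule.liftQ _ (f ∘ₗ (A.cycles 0).subtype) fun a ha => by
      obtain ⟨b, -, hb⟩ := ha
      exact (congrArg f hb).symm.trans (hf.d b)
  obtain ⟨g, hg⟩ := LinearMap.exists_extend
    (functional ∘ₗ homologyEquiv.symm.toLinearMap ∘ₗ B.homologyClass 0)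
  have g_cycle {b} (hb : b ∈ B.cycles 0) :
      g b = functional (homologyEquiv.symm (B.homologyClass 0 ⟨b, hb⟩)) :=
    LinearMap.congr_fun hg ⟨b, hb⟩
  refine ⟨g ∘ₗ GradedAlgebra.proj B.gr 0, ⟨fun n b hn hb => ?_, fun b => ?_⟩, fun a ha => ?_⟩
  · simp only [LinearMap.comp_apply, GradedAlgebra.proj_apply,
      DirectSum.decompose_of_mem_ne _ hb hn, map_zero]
  · have boundary : B.d (GradedAlgebra.proj B.gr (0 + 1) b) ∈ B.boundaries 0 :=
      ⟨_, SetLike.coe_mem _, rfl⟩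
    rw [LinearMap.comp_apply]
    rw [proj_d, g_cycle (boundaries_le_cycles B 0 boundary),
      homologyClass_eq_zero_iff.mpr boundary, map_zero, map_zero]
  · have class_map : B.homologyClass 0 ⟨Hom.toAlgHom φ a, map_mem_cycles φ ha⟩ =
        homologyEquiv (A.homologyClass 0 ⟨a, ha⟩) := homologyMap_homologyClass φ ha
    rw [LinearMap.comp_apply, GradedAlgebra.proj_apply,
      DirectSum.decompose_of_mem_same _ (Hom.map_mem φ 0 a ha.1), g_cycle (map_mem_cycles φ ha),
      class_map, LinearEquiv.symm_apply_apply]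
    rfl

theorem IsQuasiIso.exists_isCharacter_extending (hφ : IsQuasiIso φ) {f : A.carrier →ₗ[k] k}
    (hf : A.IsCharacter f) :
    ∃ g, B.IsCharacter g ∧ ∀ a ∈ A.cycles 0, g (Hom.toAlgHom φ a) = f a := by
  obtain ⟨g, hg, g_map⟩ := hφ.exists_isCocycle_extending hf.1
  refine ⟨g, ⟨hg, ?_, fun a ha b hb => ?_⟩, g_map⟩
  · rw [← map_one (Hom.toAlgHom φ), g_map 1 (one_mem_cycles A), hf.one]
  · obtain ⟨a', ha', haa'⟩ := hφ.exists_lift ha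
    obtain ⟨b', hb', hbb'⟩ := hφ.exists_lift hb
    have products := mul_sub_mul_mem_boundaries (map_mem_cycles φ ha') hb haa' hbb'
    rw [← hg.eq_of_sub_mem_boundaries haa', ← hg.eq_of_sub_mem_boundaries hbb',
      ← hg.eq_of_sub_mem_boundaries products, ← map_mul, g_map _ (mul_mem_cycles ha' hb'),
      g_map a' ha', g_map b' hb', hf.mul a' ha' b' hb']

theorem IsQuasiIso.hasSeparatedIdempotent_iff (hφ : IsQuasiIso φ) :
    A.HasSeparatedIdempotent ↔ B.HasSeparatedIdempotent := by
  refine ⟨?_, hφ.hasSeparatedIdempotent_of_codomain⟩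
  rintro ⟨connective, f, hf, e, he, hee, aug_e, f_e⟩
  obtain ⟨g, hg, g_map⟩ := hφ.exists_isCharacter_extending hf
  refine ⟨hφ.isConnective_iff.mp connective, g, hg, _, map_mem_cycles φ he, ?_, ?_, ?_⟩
  · rw [← map_mul, ← map_sub]
    exact map_mem_boundaries φ hee
  · rw [Hom.map_aug, aug_e]
  · rw [g_map e he, f_e]

end Field

end DGA

namespace DGC

theorem OmegaQuasiIsomorphic.hasSeparatedIdempotent_iff {k : Type u} [Field k]
    {C D : DGC.{u, v} k} (h : OmegaQuasiIsomorphic C D) :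
    C.cobarObj.HasSeparatedIdempotent ↔ D.cobarObj.HasSeparatedIdempotent := by
  induction h with
  | rel C D h => exact h.choose_spec.hasSeparatedIdempotent_iff
  | refl C => exact Iff.rfl
  | symm C D _ ih => exact ih.symm
  | trans C D E _ _ h1 h2 => exact h1.trans h2

end DGC

/-! ### Twisting cochains and normalized chains -/

theorem DGA.IsConnective.hasSeparatedIdempotent_of_d_eq {k : Type u} [CommRing k]
    [Invertible (2 : k)] {A : DGA.{u, v} k} (hA : A.IsConnective) {f : A.carrier →ₗ[k] k}
    (hf : A.IsCharacter f) {g y : A.carrier} (hg : g ∈ A.gr 0) (d_g : A.d g = 0)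
    (hy : y ∈ A.gr 1) (d_y : A.d y = -((2 : k) • g) - g * g) (aug_g : A.aug g = 0)
    (hfg : f g = -2) : A.HasSeparatedIdempotent := by
  refine ⟨hA, f, hf, -⅟(2 : k) • g, ?_, ?_, ?_, ?_⟩
  · exact Submodule.smul_mem _ _ (mem_cycles.mpr ⟨hg, d_g⟩)
  · refine ⟨-(⅟(2 : k) * ⅟2) • y, Submodule.smul_mem _ _ hy, ?_⟩
    rw [map_smul, d_y, smul_sub, smul_neg, neg_smul, neg_neg, smul_smul, mul_assoc,
      invOf_mul_self, mul_one, smul_mul_smul_comm, neg_mul_neg]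
    module
  · rw [map_smul, aug_g, smul_zero]
  · rw [map_smul, hfg, smul_eq_mul, neg_mul_neg, invOf_mul_self]

namespace DGC

open DGA

section TwistingCochains

variable {k : Type u} [CommRing k] (C : DGC.{u, v} k)

/-- The generator `s⁻¹ x̄` of `Ω C` determined by an element `x` of `C`. -/
noncomputable def desusp : C.carrier →ₗ[k] C.cobarObj.carrier :=
  C.cobarGen ∘ₗ C.proj

theorem koszulSign_one : koszulSign k 1 = -1 := by
  rw [← Nat.cast_one, koszulSign_natCast, pow_one]

theorem desusp_mem {n : ℤ} {x : C.carrier} (hx : x ∈ C.gr n) :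
    C.desusp x ∈ C.cobarObj.gr (n - 1) :=
  cobarGen_mem (Submodule.mem_map_of_mem hx)

theorem d_desusp (x : C.carrier) :
    C.cobarObj.d (C.desusp x) = -C.desusp (C.d x) +
      C.cobarQuad (TensorProduct.map C.proj C.proj (Coalgebra.comul (R := k) x)) :=
  C.d_cobarGen (C.proj x)

theorem cobarQuad_proj_tmul {n : ℤ} {x : C.carrier} (hx : x ∈ C.gr n) (y : C.carrier) :
    C.cobarQuad (C.proj x ⊗ₜ C.proj y) = koszulSign k n • (C.desusp x * C.desusp y) :=
  cobarQuad_tmul (Submodule.mem_map_of_mem hx) _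

/-- A twisting cochain of `C` with values in `k`, i.e. a functional of degree `-1` that satisfies
the Maurer–Cartan equation. -/
structure IsTwistingCochain (φ : C.carrier →ₗ[k] k) : Prop where
  of_mem : ∀ n a, n ≠ 1 → a ∈ C.gr n → φ a = 0
  d : ∀ a, φ (C.d a) + LinearMap.mul' k k (TensorProduct.map φ φ (Coalgebra.comul (R := k) a)) = 0

variable {C} {φ : C.carrier →ₗ[k] k}

/-- The Maurer–Cartan equation is trivial by degree reasons outside degree two. -/
theorem IsTwistingCochain.of_degree_two (of_mem : ∀ n a, n ≠ 1 → a ∈ C.gr n → φ a = 0)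
    (d : ∀ a ∈ C.gr 2, φ (C.d a) +
      LinearMap.mul' k k (TensorProduct.map φ φ (Coalgebra.comul (R := k) a)) = 0) :
    C.IsTwistingCochain φ where
  of_mem := of_mem
  d a := by
    induction a using graded_induction C.isInternal with
    | add a b ha hb =>
      simp only [map_add]
      rw [add_add_add_comm, ha, hb, add_zero]
    | hom n a ha =>
      by_cases hn : n = 2
      · exact d a (hn ▸ ha)
      have product_eq_zero {t : C.carrier ⊗[k] C.carrier} (ht : t ∈ tensorDeg C.gr n) :
          LinearMap.mul' k k (TensorProduct.map φ φ t) = 0 := by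
        induction ht using tensorDeg_induction with
        | h0 => simp only [map_zero]
        | add s t _ _ hs ht => rw [map_add, map_add, hs, ht, add_zero]
        | hom p x y hx hy =>
          rw [TensorProduct.map_tmul, LinearMap.mul'_apply]
          by_cases hp : p = 1
          · rw [of_mem (n - p) y (by omega) hy, mul_zero]
          · rw [of_mem p x hp hx, zero_mul]
      rw [of_mem (n - 1) _ (by omega) (C.d_mem n a ha), product_eq_zero (C.comul_mem n a ha),
        add_zero]

namespace IsTwistingCochain

variable (hφ : C.IsTwistingCochain φ)
include hφ

/-- The algebra map `Ω C → k` with `s⁻¹ x̄ ↦ φ x`. -/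
noncomputable def toAlgHom : C.cobarObj.carrier →ₐ[k] k :=
  TensorAlgebra.lift k (Submodule.liftQ _ φ (by
    rw [Submodule.span_singleton_le_iff_mem]
    exact hφ.of_mem 0 _ zero_ne_one C.one_mem))

theorem toAlgHom_desusp (x : C.carrier) : hφ.toAlgHom (C.desusp x) = φ x :=
  TensorAlgebra.lift_ι_apply _ _

theorem toAlgHom_cobarQuad (t : C.carrier ⊗[k] C.carrier) :
    hφ.toAlgHom (C.cobarQuad (TensorProduct.map C.proj C.proj t)) =
      -LinearMap.mul' k k (TensorProduct.map φ φ t) := by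
  induction t using tensor_graded_induction C.isInternal with
  | add s t hs ht => simp only [map_add, hs, ht, neg_add]
  | tmul i _ x y hx _ =>
    rw [TensorProduct.map_tmul, TensorProduct.map_tmul, cobarQuad_proj_tmul C hx, map_smul, map_mul,
      toAlgHom_desusp, toAlgHom_desusp, LinearMap.mul'_apply]
    by_cases hi : i = 1
    · rw [hi, koszulSign_one, neg_one_smul]
    · rw [hφ.of_mem i x hi hx, zero_mul, smul_zero, neg_zero]

theorem toAlgHom_d (a : C.cobarObj.carrier) : hφ.toAlgHom (C.cobarObj.d a) = 0 := by
  induction a using cobarObj_induction with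
  | one => rw [(one_mem_cycles C.cobarObj).2, map_zero]
  | add a b ha hb => rw [map_add, map_add, ha, hb, add_zero]
  | smul c a ha => rw [map_smul, map_smul, ha, smul_zero]
  | gen_mul n x w hx hw =>
    obtain ⟨x, hx, rfl⟩ := hx
    have generator : hφ.toAlgHom (C.cobarObj.d (C.desusp x)) = 0 := by
      rw [d_desusp, map_add, map_neg, toAlgHom_desusp, toAlgHom_cobarQuad, ← neg_add, hφ.d,
        neg_zero]
    change hφ.toAlgHom (C.cobarObj.d (C.desusp x * w)) = 0
    rw [C.cobarObj.leibniz _ _ w (C.desusp_mem hx), map_add, map_smul, map_mul, map_mul, hw,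
      generator, zero_mul, mul_zero, smul_zero, add_zero]

theorem toAlgHom_of_mem {n : ℤ} {a : C.cobarObj.carrier} (ha : a ∈ C.cobarObj.gr n) (hn : n ≠ 0) :
    hφ.toAlgHom a = 0 := by
  induction ha using cobarObj_gr_induction with
  | one => exact absurd rfl hn
  | zero => exact map_zero _
  | add n a b _ _ ha hb => rw [map_add, ha hn, hb hn, add_zero]
  | smul n c a _ ha => rw [map_smul, ha hn, smul_zero]
  | gen_mul m n x w hx _ ih =>
    obtain ⟨x, hx, rfl⟩ := hx
    change hφ.toAlgHom (C.desusp x * w) = 0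
    rw [map_mul, toAlgHom_desusp]
    by_cases hm : m = 1
    · rw [ih (by omega), mul_zero]
    · rw [hφ.of_mem m x hm hx, zero_mul]

theorem isCharacter : C.cobarObj.IsCharacter hφ.toAlgHom.toLinearMap where
  of_mem _ _ hn ha := hφ.toAlgHom_of_mem ha hn
  d := hφ.toAlgHom_d
  one := map_one hφ.toAlgHom
  mul _ _ _ _ := map_mul hφ.toAlgHom _ _

end IsTwistingCochain

theorem isConnective_cobarObj (hC : ∀ n ≤ 0, C.barGr n = ⊥) : C.cobarObj.IsConnective := by
  have eq_zero {n : ℤ} {a : C.cobarObj.carrier} (ha : a ∈ C.cobarObj.gr n) : n < 0 → a = 0 := by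
    induction ha using cobarObj_gr_induction with
    | one => exact fun hn => absurd hn (lt_irrefl 0)
    | zero => exact fun _ => rfl
    | add n a b _ _ ha hb => exact fun hn => by rw [ha hn, hb hn, add_zero]
    | smul n c a _ ha => exact fun hn => by rw [ha hn, smul_zero]
    | gen_mul m n x w hx _ ih =>
      intro hmn
      by_cases hm : m ≤ 0
      · rw [hC m hm, Submodule.mem_bot] at hx
        rw [hx, map_zero, zero_mul]
      · rw [ih (by omega), mul_zero]
  intro n hn a ha
  rw [eq_zero (mem_cycles.mp ha).1 hn]
  exact zero_mem _

theorem d_desusp_of_comul_eq {x : C.carrier} {t : C.carrier ⊗[k] C.carrier}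
    (hx : Coalgebra.comul (R := k) x = C.one ⊗ₜ x + t + x ⊗ₜ C.one) :
    C.cobarObj.d (C.desusp x) =
      -C.desusp (C.d x) + C.cobarQuad (TensorProduct.map C.proj C.proj t) := by
  rw [d_desusp, hx, map_add, map_add, map_add, map_add, TensorProduct.map_tmul,
    TensorProduct.map_tmul, C.proj_one, TensorProduct.zero_tmul, TensorProduct.tmul_zero, map_zero,
    zero_add, add_zero]

theorem IsTwistingCochain.hasSeparatedIdempotent [Invertible (2 : k)] (hφ : C.IsTwistingCochain φ)
    (hC : C.cobarObj.IsConnective) {x y : C.carrier} (hy : y ∈ C.gr 2)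
    (d_y : C.d y = (2 : k) • x)
    (comul_y : Coalgebra.comul (R := k) y = C.one ⊗ₜ y + x ⊗ₜ x + y ⊗ₜ C.one)
    (comul_x : Coalgebra.comul (R := k) x = C.one ⊗ₜ x + x ⊗ₜ C.one) (hφx : φ x = -2) :
    C.cobarObj.HasSeparatedIdempotent := by
  have x_eq : x = ⅟(2 : k) • C.d y := by rw [d_y, smul_smul, invOf_mul_self, one_smul]
  have hx : x ∈ C.gr 1 := x_eq ▸ Submodule.smul_mem _ _ (C.d_mem 2 y hy)
  have d_x : C.d x = 0 := by rw [x_eq, map_smul, C.d_d, smul_zero]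
  have cycle : C.cobarObj.d (C.desusp x) = 0 := by
    rw [C.d_desusp_of_comul_eq (t := 0) (by rw [comul_x, add_zero]), d_x, map_zero, map_zero,
      neg_zero, map_zero, add_zero]
  have relation : C.cobarObj.d (C.desusp y) =
      -((2 : k) • C.desusp x) - C.desusp x * C.desusp x := by
    rw [C.d_desusp_of_comul_eq comul_y, d_y, map_smul, TensorProduct.map_tmul,
      C.cobarQuad_proj_tmul hx, koszulSign_one, neg_one_smul,
      sub_eq_add_neg]
  have mem_zero : C.desusp x ∈ C.cobarObj.gr 0 := sub_self (1 : ℤ) ▸ C.desusp_mem hx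
  have mem_one : C.desusp y ∈ C.cobarObj.gr 1 :=
    (by norm_num : (2 : ℤ) - 1 = 1) ▸ C.desusp_mem hy
  exact hC.hasSeparatedIdempotent_of_d_eq hφ.isCharacter mem_zero cycle mem_one relation
    (C.aug_cobarGen _) ((hφ.toAlgHom_desusp x).trans hφx)

end TwistingCochains

end DGC

namespace NormChains

open DGC DGA

section LowDegrees

variable (k : Type u) [CommRing k] {S : SSet.{w}}

theorem d_cls_two (τ : Simplex S 2) :
    d k S (cls k 2 τ) = cls k 1 (S.δ 0 τ) - cls k 1 (S.δ 1 τ) + cls k 1 (S.δ 2 τ) := by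
  rw [d_cls, bdry, Fin.sum_univ_three]
  simp only [Fin.val_zero, Fin.val_one, Fin.val_two, pow_zero, pow_one, neg_one_sq, one_smul,
    neg_one_smul, ← sub_eq_add_neg]

variable [Subsingleton (Simplex S 0)] (b : Simplex S 0)

theorem comul_cls_one (γ : Simplex S 1) :
    comul k S (cls k 1 γ) = cls k 0 b ⊗ₜ cls k 1 γ + cls k 1 γ ⊗ₜ cls k 0 b := by
  have front_one : front 1 1 = 𝟙 (SimplexCategory.mk 1) := by ext i; fin_cases i <;> rfl
  have back_zero : back 1 0 = 𝟙 (SimplexCategory.mk 1) := by ext i; fin_cases i <;> rfl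
  have vertex (x : Simplex S 0) : cls k 0 x = cls k 0 b := by rw [Subsingleton.elim x b]
  have edge : S.map (𝟙 (SimplexCategory.mk 1)).op γ = γ := by simp
  rw [comul_cls, diag, Fin.sum_univ_two, front_one, back_zero]
  exact congrArg₂ (· + ·) (congrArg₂ (· ⊗ₜ ·) (vertex _) (congrArg _ edge))
    (congrArg₂ (· ⊗ₜ ·) (congrArg _ edge) (vertex _))

theorem comul_cls_two (τ : Simplex S 2) :
    comul k S (cls k 2 τ) = cls k 0 b ⊗ₜ cls k 2 τ +
      cls k 1 (S.δ 2 τ) ⊗ₜ cls k 1 (S.δ 0 τ) + cls k 2 τ ⊗ₜ cls k 0 b := by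
  have front_one : front 2 1 = SimplexCategory.δ 2 := by ext i; fin_cases i <;> rfl
  have back_one : back 2 1 = SimplexCategory.δ 0 := by ext i; fin_cases i <;> rfl
  have front_two : front 2 2 = 𝟙 (SimplexCategory.mk 2) := by ext i; fin_cases i <;> rfl
  have back_zero : back 2 0 = 𝟙 (SimplexCategory.mk 2) := by ext i; fin_cases i <;> rfl
  have vertex (x : Simplex S 0) : cls k 0 x = cls k 0 b := by rw [Subsingleton.elim x b]
  have triangle : S.map (𝟙 (SimplexCategory.mk 2)).op τ = τ := by simp
  rw [comul_cls, diag, Fin.sum_univ_three, front_one, back_one, front_two, back_zero]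
  exact congrArg₂ (· + ·) (congrArg₂ (· + ·) (congrArg₂ (· ⊗ₜ ·) (vertex _) (congrArg _ triangle))
    rfl) (congrArg₂ (· ⊗ₜ ·) (congrArg _ triangle) (vertex _))

end LowDegrees

/-- A multiplicative `1`-cocycle of `S`, i.e. a character of its edge path groupoid. -/
structure IsMultiplicative {k : Type u} [CommRing k] {S : SSet.{w}} (c : Simplex S 1 → k) :
    Prop where
  degenerate : ∀ γ ∈ S.degenerate 1, c γ = 1
  mul : ∀ τ : Simplex S 2, c (S.δ 1 τ) = c (S.δ 2 τ) * c (S.δ 0 τ)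

namespace IsMultiplicative

variable {k : Type u} [CommRing k] {S : SSet.{w}} {c : Simplex S 1 → k} (hc : IsMultiplicative c)
include hc

/-- The functional `c - 1` on chains of degree one, extended by zero. -/
noncomputable def cochain : Carrier k S →ₗ[k] k :=
  lift (fun n => match n with
    | 1 => fun γ => c γ - 1
    | _ => fun _ => 0) (by
    rintro (_ | _ | n) γ hγ
    · rfl
    · exact sub_eq_zero.mpr (hc.degenerate γ hγ)
    · rfl)

theorem cochain_cls_one (γ : Simplex S 1) : hc.cochain (cls k 1 γ) = c γ - 1 :=
  lift_cls _ _ _ _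

theorem cochain_of_mem {n : ℤ} {a : Carrier k S} (hn : n ≠ 1) (ha : a ∈ gr k S n) :
    hc.cochain a = 0 := by
  induction ha using Submodule.span_induction with
  | zero => exact map_zero _
  | add a a' _ _ ha ha' => rw [map_add, ha, ha', add_zero]
  | smul r a _ ha => rw [map_smul, ha, smul_zero]
  | mem a ha =>
    obtain ⟨m, γ, rfl, rfl⟩ := ha
    refine (lift_cls _ _ _ _).trans ?_
    match m, hn with
    | 0, _ => rfl
    | 1, hn => exact absurd rfl hn
    | m + 2, _ => rfl

variable [Subsingleton (Simplex S 0)] (b : Simplex S 0)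

include b in
theorem cochain_d {a : Carrier k S} (ha : a ∈ gr k S 2) : hc.cochain (d k S a) +
    LinearMap.mul' k k (TensorProduct.map hc.cochain hc.cochain (comul k S a)) = 0 := by
  induction ha using Submodule.span_induction with
  | zero => simp only [map_zero, add_zero]
  | add a a' _ _ ha ha' =>
    simp only [map_add]
    rw [add_add_add_comm, ha, ha', add_zero]
  | smul r a _ ha => simp only [map_smul, ← smul_add, ha, smul_zero]
  | mem a ha =>
    obtain ⟨m, τ, hm, rfl⟩ := ha
    obtain rfl : m = 2 := by omega
    have vertex : hc.cochain (cls k 0 b) = 0 := hc.cochain_of_mem zero_ne_one (cls_mem k 0 b)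
    rw [d_cls_two, comul_cls_two k b]
    simp only [map_add, map_sub, TensorProduct.map_tmul, LinearMap.mul'_apply, vertex,
      cochain_cls_one, hc.mul τ]
    ring

theorem isTwistingCochain : (dgc k S b).IsTwistingCochain hc.cochain :=
  .of_degree_two (fun _ _ hn ha => hc.cochain_of_mem hn ha) fun _ ha => hc.cochain_d b ha

end IsMultiplicative

section Cobar

variable (k : Type u) [CommRing k] {S : SSet.{w}} [Subsingleton (Simplex S 0)] (b : Simplex S 0)

theorem isConnective_cobarObj_dgc : (dgc k S b).cobarObj.IsConnective := by
  refine isConnective_cobarObj fun n hn => ?_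
  rw [eq_bot_iff, barGr, Submodule.map_le_iff_le_comap]
  refine Submodule.span_le.mpr ?_
  rintro _ ⟨m, x, hm, rfl⟩
  obtain rfl : m = 0 := by omega
  rw [Subsingleton.elim x b]
  exact (dgc k S b).proj_one

theorem hasSeparatedIdempotent_cobarObj_dgc [Invertible (2 : k)] {c : Simplex S 1 → k}
    (hc : IsMultiplicative c) (τ : Simplex S 2) (h0 : S.δ 0 τ = S.δ 2 τ)
    (h1 : S.δ 1 τ ∈ S.degenerate 1) (h2 : c (S.δ 2 τ) = -1) :
    (dgc k S b).cobarObj.HasSeparatedIdempotent := by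
  have boundary : d k S (cls k 2 τ) = (2 : k) • cls k 1 (S.δ 2 τ) := by
    rw [d_cls_two, h0, cls_degenerate k h1, sub_zero, two_smul]
  have diagonal : comul k S (cls k 2 τ) = cls k 0 b ⊗ₜ cls k 2 τ +
      cls k 1 (S.δ 2 τ) ⊗ₜ cls k 1 (S.δ 2 τ) + cls k 2 τ ⊗ₜ cls k 0 b := by
    rw [comul_cls_two k b, h0]
  have value : hc.cochain (cls k 1 (S.δ 2 τ)) = -2 := by
    rw [hc.cochain_cls_one, h2]
    ring
  exact (hc.isTwistingCochain b).hasSeparatedIdempotent (isConnective_cobarObj_dgc k b)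
    (cls_mem k 2 τ) boundary diagonal (comul_cls_one k b _) value

end Cobar

end NormChains

/-! ### The antipodal quotient of a punctured vector space -/

/-- The complement of the origin. -/
abbrev Punctured (E : Type w) [Zero E] : Type w := {v : E // v ≠ 0}

/-- The quotient of the complement of the origin by the antipodal map; in dimension `n + 1` it is
homotopy equivalent to the real projective space of dimension `n`. -/
abbrev AntipodalQuotient (E : Type w) [AddCommGroup E] : Type w :=
  Quotient (MulAction.orbitRel ℤˣ (Punctured E))

theorem PtdSpace.SemilocallySimplyConnected.of_simplyConnectedSpace {X : Type w}
    [TopologicalSpace X] (h : ∀ x : X, ∃ U ∈ nhds x, SimplyConnectedSpace U) :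
    SemilocallySimplyConnected X := by
  intro x
  obtain ⟨U, hU, _⟩ := h x
  refine ⟨U, hU, fun γ hγ => ?_⟩
  let x' : U := ⟨x, mem_of_mem_nhds hU⟩
  let γ' : Path x' x' :=
    { toFun := fun t => ⟨γ t, hγ ⟨t, rfl⟩⟩
      continuous_toFun := γ.continuous.subtype_mk _
      source' := Subtype.ext γ.source
      target' := Subtype.ext γ.target }
  exact (SimplyConnectedSpace.paths_homotopic γ' (Path.refl x')).map ⟨_, continuous_subtype_val⟩

namespace AntipodalQuotient

section Basic

variable {E : Type w} [AddCommGroup E]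

/-- The quotient map. -/
abbrev mk (v : Punctured E) : AntipodalQuotient E := Quotient.mk _ v

theorem mk_eq_mk_iff {u v : Punctured E} : mk u = mk v ↔ u.1 = v.1 ∨ u.1 = -v.1 := by
  have coe_smul (g : ℤˣ) : (g • v).1 = (g : ℤ) • v.1 := rfl
  rw [Quotient.eq, MulAction.orbitRel_apply, MulAction.mem_orbit_iff]
  constructor
  · rintro ⟨g, rfl⟩
    rcases Int.units_eq_one_or g with rfl | rfl <;> simp [coe_smul]
  · rintro (h | h)
    · exact ⟨1, Subtype.ext (by simp [h])⟩
    · exact ⟨-1, Subtype.ext (by simp [coe_smul, h])⟩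

end Basic

section Topology

variable (E : Type w) [NormedAddCommGroup E] [NormedSpace ℝ E]

instance : LocallyPathConnectedSpace (AntipodalQuotient E) := by
  have : LocallyPathConnectedSpace (Punctured E) :=
    IsOpen.locallyPathConnectedSpace (U := {v : E | v ≠ 0}) isOpen_ne
  exact inferInstanceAs (LocallyPathConnectedSpace (Quot _))

theorem pathConnectedSpace (h : 1 < Module.rank ℝ E) :
    PathConnectedSpace (AntipodalQuotient E) := by
  have : PathConnectedSpace (Punctured E) :=
    isPathConnected_iff_pathConnectedSpace.mp (isPathConnected_compl_singleton_of_one_lt_rank h 0)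
  infer_instance

instance : ContinuousConstSMul ℤˣ (Punctured E) :=
  ⟨fun g => ((continuous_const_smul (g : ℤ)).comp continuous_subtype_val).subtype_mk _⟩

omit [NormedSpace ℝ E] in
theorem isOpenMap_mk : IsOpenMap (mk : Punctured E → _) :=
  isOpenMap_quotient_mk'_mul

theorem isCoveringMap_mk [LocallyCompactSpace E] : IsCoveringMap (mk : Punctured E → _) := by
  have : LocallyCompactSpace (Punctured E) :=
    IsOpen.locallyCompactSpace (s := {v : E | v ≠ 0}) isOpen_ne
  have : IsCancelSMul ℤˣ (Punctured E) := isCancelSMul_iff_eq_one_of_smul_eq.mpr fun g v h => by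
    rcases Int.units_eq_one_or g with rfl | rfl
    · rfl
    · have neg_eq : ((-1 : ℤˣ) : ℤ) • v.1 = v.1 := congrArg Subtype.val h
      rw [Units.val_neg, Units.val_one, neg_smul, one_smul] at neg_eq
      have midpoint_eq := midpoint_self_neg (R := ℝ) v.1
      rw [neg_eq, midpoint_self] at midpoint_eq
      exact absurd midpoint_eq v.2
  exact (isQuotientCoveringMap_quotientMk_of_properlyDiscontinuousSMul
    (G := ℤˣ) (E := Punctured E)).isCoveringMap

variable {E}

omit [NormedSpace ℝ E] in
theorem ball_norm_subset (v : E) : Metric.ball v ‖v‖ ⊆ {u | u ≠ 0} := by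
  rintro _ hu rfl
  rw [Metric.mem_ball, dist_zero_left] at hu
  exact lt_irrefl _ hu

theorem neg_notMem_ball_norm {u v : E} (hu : u ∈ Metric.ball v ‖v‖) :
    -u ∉ Metric.ball v ‖v‖ := fun hu' => by
  have midpoint_mem := (convex_ball v ‖v‖).midpoint_mem hu hu'
  rw [midpoint_self_neg] at midpoint_mem
  exact ball_norm_subset v midpoint_mem rfl

/-- The restriction of the quotient map to the ball around `v` that touches the origin. -/
def ofBall (v : E) (u : Metric.ball v ‖v‖) : AntipodalQuotient E :=
  mk (Set.inclusion (ball_norm_subset v) u)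

theorem isOpenEmbedding_ofBall (v : E) : Topology.IsOpenEmbedding (ofBall v) := by
  refine .of_continuous_injective_isOpenMap ?_ ?_ ?_
  · exact continuous_quotient_mk'.comp (continuous_inclusion (ball_norm_subset v))
  · intro u u' h
    rcases mk_eq_mk_iff.mp h with h | h
    · exact Subtype.ext h
    · exact absurd (h ▸ u.2 : -u'.1 ∈ Metric.ball v ‖v‖) (neg_notMem_ball_norm u'.2)
  · exact (isOpenMap_mk E).comp (Metric.isOpen_ball.isOpenMap_inclusion (ball_norm_subset v))

theorem semilocallySimplyConnected : PtdSpace.SemilocallySimplyConnected (AntipodalQuotient E) := by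
  refine .of_simplyConnectedSpace fun x => ?_
  obtain ⟨v, rfl⟩ := Quotient.exists_rep x
  have center_mem : v.1 ∈ Metric.ball v.1 ‖v.1‖ := Metric.mem_ball_self (norm_pos_iff.mpr v.2)
  have embedding := isOpenEmbedding_ofBall v.1
  refine ⟨Set.range (ofBall v.1), embedding.isOpen_range.mem_nhds ⟨⟨v.1, center_mem⟩, rfl⟩, ?_⟩
  have := (convex_ball v.1 ‖v.1‖).contractibleSpace ⟨v.1, center_mem⟩
  have := embedding.isEmbedding.toHomeomorph.symm.contractibleSpace
  infer_instance

end Topology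

end AntipodalQuotient

/-! ### Lifting pointed singular simplices -/

section StdSimplex

instance (n : ℕ) : LocallyPathConnectedSpace (stdSimplex ℝ (Fin (n + 1))) :=
  (convex_stdSimplex ℝ _).locallyPathConnectedSpace

instance (n : ℕ) : ContractibleSpace (stdSimplex ℝ (Fin (n + 1))) :=
  (convex_stdSimplex ℝ _).contractibleSpace ⟨_, single_mem_stdSimplex ℝ 0⟩

theorem stdSimplex_map_succAbove_self {n : ℕ} (i : Fin (n + 1)) (t : stdSimplex ℝ (Fin n)) :
    stdSimplex.map i.succAbove t i = 0 := by
  rw [stdSimplex.map_coe, FunOnFinite.linearMap_apply_apply]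
  refine Finset.sum_eq_zero fun j hj => ?_
  exact absurd (Finset.mem_filter.mp hj).2 (Fin.succAbove_ne i j)

theorem stdSimplex_map_succAbove_apply {n : ℕ} (i : Fin (n + 1)) (t : stdSimplex ℝ (Fin n))
    (j : Fin n) : stdSimplex.map i.succAbove t (i.succAbove j) = t j := by
  rw [stdSimplex.map_coe, FunOnFinite.linearMap_apply_apply, Finset.sum_eq_single j]
  · exact fun l hl hlj => absurd (Fin.succAbove_right_injective (Finset.mem_filter.mp hl).2) hlj
  · simp

end StdSimplex

namespace PtdSpace

/-- The singular simplices of `X` that send all vertices to the base point. -/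
abbrev SingSimplex (X : PtdSpace.{w}) (n : ℕ) : Type w := NormChains.Simplex X.sing.toSSet n

namespace SingSimplex

variable {X : PtdSpace.{w}} {m n : ℕ}

/-- The continuous map underlying a pointed singular simplex. -/
noncomputable def toMap (σ : X.SingSimplex n) : C(stdSimplex ℝ (Fin (n + 1)), X.space) :=
  X.space.toSSetObjEquiv (op (SimplexCategory.mk n)) σ.1

theorem toMap_vertex (σ : X.SingSimplex n) (i : Fin (n + 1)) :
    σ.toMap (stdSimplex.vertex i) = X.pt := σ.2 i

theorem toMap_map (φ : SimplexCategory.mk m ⟶ SimplexCategory.mk n) (σ : X.SingSimplex n)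
    (t : stdSimplex ℝ (Fin (m + 1))) :
    toMap (X.sing.toSSet.map φ.op σ) t = σ.toMap (stdSimplex.map φ.toOrderHom t) := rfl

theorem toMap_δ (i : Fin (n + 2)) (σ : X.SingSimplex (n + 1)) (t : stdSimplex ℝ (Fin (n + 1))) :
    toMap (X.sing.toSSet.δ i σ : X.SingSimplex n) t = σ.toMap (stdSimplex.map i.succAbove t) := rfl

theorem toMap_injective : Function.Injective (toMap (X := X) (n := n)) := fun _ _ h =>
  Subtype.ext ((X.space.toSSetObjEquiv _).injective h)

/-- The pointed singular simplex determined by a continuous map. -/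
noncomputable def ofMap (f : C(stdSimplex ℝ (Fin (n + 1)), X.space))
    (hf : ∀ i, f (stdSimplex.vertex i) = X.pt) : X.SingSimplex n :=
  ⟨(X.space.toSSetObjEquiv (op (SimplexCategory.mk n))).symm f, fun i => by
    rw [Equiv.apply_symm_apply]; exact hf i⟩

theorem toMap_ofMap (f : C(stdSimplex ℝ (Fin (n + 1)), X.space))
    (hf : ∀ i, f (stdSimplex.vertex i) = X.pt) : (ofMap f hf).toMap = f :=
  Equiv.apply_symm_apply _ _

theorem mem_degenerate_of_const {σ : X.SingSimplex 1} (hσ : ∀ t, σ.toMap t = X.pt) :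
    σ ∈ X.sing.toSSet.degenerate 1 := by
  refine ⟨0, zero_lt_one, SimplexCategory.σ 0, X.singPt, toMap_injective ?_⟩
  ext t
  rw [toMap_map, hσ]
  exact DFunLike.congr_fun (Equiv.apply_symm_apply (X.space.toSSetObjEquiv _) _) _

end SingSimplex

end PtdSpace

/-! ### The sign character of the projective plane -/

namespace AntipodalQuotient

open PtdSpace

/-- A three-dimensional real vector space in an arbitrary universe. -/
abbrev Space3 : Type w := ULift.{w} (Fin 3) → ℝ

/-- The vector with the given coordinates. -/
def vec (x y z : ℝ) : Space3.{w} := fun i => ![x, y, z] i.down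

theorem neg_vec (x y z : ℝ) : -vec.{w} x y z = vec (-x) (-y) (-z) := by
  funext ⟨j⟩
  fin_cases j <;> rfl

/-- The base point of the double cover of the projective plane. -/
def base : Punctured Space3.{w} :=
  ⟨vec 1 0 0, fun h => one_ne_zero (congrFun h ⟨0⟩ : (1 : ℝ) = 0)⟩

/-- A space homotopy equivalent to the real projective plane. -/
noncomputable def projectivePlane : PtdSpace.{w} where
  space := TopCat.of (AntipodalQuotient Space3.{w})
  pt := mk base
  pathConnected := pathConnectedSpace _ (by simp)

theorem hasUniversalCover_projectivePlane : HasUniversalCover projectivePlane.{w} :=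
  ⟨inferInstanceAs (LocallyPathConnectedSpace (AntipodalQuotient Space3.{w})),
    semilocallySimplyConnected⟩

/-- The map `F` to the double cover is a lift of the singular simplex `σ`. -/
def IsLift {n : ℕ} (σ : projectivePlane.{w}.SingSimplex n)
    (F : C(stdSimplex ℝ (Fin (n + 1)), Punctured Space3.{w})) : Prop :=
  ∀ t, mk (F t) = σ.toMap t

theorem exists_isLift {n : ℕ} (σ : projectivePlane.{w}.SingSimplex n) : ∃ F, IsLift σ F := by
  obtain ⟨F, ⟨_, hF⟩, _⟩ := (isCoveringMap_mk Space3.{w}).existsUnique_continuousMap_lifts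
    σ.toMap (stdSimplex.vertex 0) base (σ.toMap_vertex 0).symm
  exact ⟨F, fun t => congrFun hF t⟩

namespace IsLift

variable {m n : ℕ} {σ : projectivePlane.{w}.SingSimplex n}
  {F G : C(stdSimplex ℝ (Fin (n + 1)), Punctured Space3.{w})}

theorem mk_vertex (hF : IsLift σ F) (i : Fin (n + 1)) :
    mk (F (stdSimplex.vertex i)) = mk base := (hF _).trans (σ.toMap_vertex i)

theorem map (hF : IsLift σ F) (φ : SimplexCategory.mk m ⟶ SimplexCategory.mk n) :
    IsLift (projectivePlane.{w}.sing.toSSet.map φ.op σ : projectivePlane.SingSimplex m)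
      (F.comp ⟨stdSimplex.map φ.toOrderHom, stdSimplex.continuous_map _⟩) :=
  fun _ => hF _

theorem eq_or_eq_neg (hF : IsLift σ F) (hG : IsLift σ G) :
    (∀ t, (F t).1 = (G t).1) ∨ ∀ t, (F t).1 = -(G t).1 := by
  have cover := isCoveringMap_mk Space3.{w}
  rcases mk_eq_mk_iff.mp ((hF.mk_vertex 0).trans (hG.mk_vertex 0).symm) with h | h
  · have F_eq := cover.eq_of_comp_eq F.continuous G.continuous
      (funext fun t => (hF t).trans (hG t).symm) _ (Subtype.ext h)
    exact .inl fun t => congrArg Subtype.val (congrFun F_eq t)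
  · let G' : stdSimplex ℝ (Fin (n + 1)) → Punctured Space3.{w} :=
      fun t => ⟨-(G t).1, neg_ne_zero.mpr (G t).2⟩
    have mk_G' (t) : mk (G' t) = mk (G t) := mk_eq_mk_iff.mpr (.inr rfl)
    have F_eq := cover.eq_of_comp_eq F.continuous
      ((continuous_subtype_val.comp G.continuous).neg.subtype_mk _ : Continuous G')
      (funext fun t => (hF t).trans ((mk_G' t).trans (hG t)).symm) _ (Subtype.ext h)
    exact .inr fun t => congrArg Subtype.val (congrFun F_eq t)

end IsLift

section Monodromy

variable (k : Type u) [CommRing k]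

/-- The sign of the first coordinate; it distinguishes the two points over the base point. -/
noncomputable def sgn (v : Space3.{w}) : k := if 0 < v ⟨0⟩ then 1 else -1

variable {k}

theorem sgn_mul_self (v : Space3.{w}) : sgn k v * sgn k v = 1 := by
  rw [sgn]
  split_ifs
  · exact one_mul 1
  · exact (neg_mul_neg 1 1).trans (one_mul 1)

theorem sgn_neg {v : Punctured Space3.{w}} (hv : mk v = mk base) : sgn k (-v.1) = -sgn k v.1 := by
  rcases mk_eq_mk_iff.mp hv with hv | hv
  · simp [sgn, hv, base, vec]
  · simp [sgn, hv, base, vec, zero_lt_one.not_gt]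

/-- The monodromy of the double cover along a loop, with values in `{1, -1}`. -/
noncomputable def monodromy (k : Type u) [CommRing k] (γ : projectivePlane.{w}.SingSimplex 1) : k :=
  sgn k ((exists_isLift γ).choose (stdSimplex.vertex 0)).1 *
    sgn k ((exists_isLift γ).choose (stdSimplex.vertex 1)).1

theorem IsLift.monodromy_eq {γ : projectivePlane.{w}.SingSimplex 1}
    {F : C(stdSimplex ℝ (Fin 2), Punctured Space3.{w})} (hF : IsLift γ F) :
    monodromy k γ =
      sgn k (F (stdSimplex.vertex 0)).1 * sgn k (F (stdSimplex.vertex 1)).1 := by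
  have hG := (exists_isLift γ).choose_spec
  rw [monodromy]
  rcases hG.eq_or_eq_neg hF with h | h
  · rw [h, h]
  · rw [h, h, sgn_neg (hF.mk_vertex 0), sgn_neg (hF.mk_vertex 1), neg_mul_neg]

theorem IsLift.monodromy_map {n : ℕ} {σ : projectivePlane.{w}.SingSimplex n}
    {F : C(stdSimplex ℝ (Fin (n + 1)), Punctured Space3.{w})} (hF : IsLift σ F)
    (φ : SimplexCategory.mk 1 ⟶ SimplexCategory.mk n) :
    monodromy k (projectivePlane.{w}.sing.toSSet.map φ.op σ) =
      sgn k (F (stdSimplex.vertex (φ.toOrderHom 0))).1 *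
        sgn k (F (stdSimplex.vertex (φ.toOrderHom 1))).1 := by
  rw [(hF.map φ).monodromy_eq]
  simp only [ContinuousMap.comp_apply, ContinuousMap.coe_mk, stdSimplex.map_vertex]

theorem IsLift.monodromy_δ {τ : projectivePlane.{w}.SingSimplex 2}
    {F : C(stdSimplex ℝ (Fin 3), Punctured Space3.{w})} (hF : IsLift τ F) (i : Fin 3) :
    monodromy k (projectivePlane.{w}.sing.toSSet.δ i τ) =
      sgn k (F (stdSimplex.vertex (i.succAbove 0))).1 *
        sgn k (F (stdSimplex.vertex (i.succAbove 1))).1 :=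
  hF.monodromy_map (SimplexCategory.δ i)

theorem isMultiplicative_monodromy :
    NormChains.IsMultiplicative (S := projectivePlane.{w}.sing.toSSet) (monodromy k) where
  degenerate := by
    rintro _ ⟨m, hm, φ, x, rfl⟩
    obtain rfl : m = 0 := Nat.lt_one_iff.mp hm
    obtain ⟨F, hF⟩ := exists_isLift x
    rw [hF.monodromy_map φ, Subsingleton.elim (α := Fin 1) (φ.toOrderHom 1) (φ.toOrderHom 0),
      sgn_mul_self]
  mul τ := by
    obtain ⟨F, hF⟩ := exists_isLift τ
    rw [hF.monodromy_δ, hF.monodromy_δ, hF.monodromy_δ]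
    change sgn k (F (stdSimplex.vertex 0)).1 * sgn k (F (stdSimplex.vertex 2)).1 =
      sgn k (F (stdSimplex.vertex 0)).1 * sgn k (F (stdSimplex.vertex 1)).1 *
        (sgn k (F (stdSimplex.vertex 1)).1 * sgn k (F (stdSimplex.vertex 2)).1)
    linear_combination (-sgn k (F (stdSimplex.vertex 0)).1 * sgn k (F (stdSimplex.vertex 2)).1) *
      sgn_mul_self (k := k) (F (stdSimplex.vertex 1)).1

end Monodromy

/-! ### A triangle with two equal faces and a constant one -/

theorem triangle_vec_ne_zero (t : stdSimplex ℝ (Fin 3)) :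
    vec.{w} (1 - 2 * t 1) (t 1 * (t 0 - t 2)) (t 0 * t 1 * t 2) ≠ 0 := by
  intro h
  have first : 1 - 2 * t 1 = 0 := congrFun h ⟨0⟩
  have second : t 1 * (t 0 - t 2) = 0 := congrFun h ⟨1⟩
  have third : t 0 * t 1 * t 2 = 0 := congrFun h ⟨2⟩
  have sum_eq : t 0 + t 1 + t 2 = 1 := (Fin.sum_univ_three _).symm.trans (stdSimplex.sum_eq_one t)
  have t_one : t 1 = 1 / 2 := by linarith
  rw [t_one] at second third sum_eq
  have t_zero : t 0 = 1 / 4 := by linarith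
  have t_two : t 2 = 1 / 4 := by linarith
  rw [t_zero, t_two] at third
  norm_num at third

/-- The lift of the triangle. It is constant on the edge `t 1 = 0`, and antipodal on the edges
`t 2 = 0` and `t 0 = 0`, both of which it traverses between `(1, 0, 0)` and `(-1, 0, 0)`. The third
coordinate vanishes on the boundary and serves to avoid the origin inside. -/
noncomputable def triangleLift : C(stdSimplex ℝ (Fin 3), Punctured Space3.{w}) where
  toFun t := ⟨vec (1 - 2 * t 1) (t 1 * (t 0 - t 2)) (t 0 * t 1 * t 2), triangle_vec_ne_zero t⟩
  continuous_toFun := by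
    have coord (i) : Continuous fun t : stdSimplex ℝ (Fin 3) => t i :=
      (continuous_apply i).comp continuous_subtype_val
    refine Continuous.subtype_mk (continuous_pi fun ⟨i⟩ => ?_) _
    fin_cases i
    · exact continuous_const.sub (continuous_const.mul (coord 1))
    · exact (coord 1).mul ((coord 0).sub (coord 2))
    · exact ((coord 0).mul (coord 1)).mul (coord 2)

theorem triangleLift_coe (t : stdSimplex ℝ (Fin 3)) :
    (triangleLift.{w} t).1 = vec (1 - 2 * t 1) (t 1 * (t 0 - t 2)) (t 0 * t 1 * t 2) := rfl

theorem mk_triangleLift_vertex (i : Fin 3) :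
    mk (triangleLift.{w} (stdSimplex.vertex i)) = mk base := by
  rw [mk_eq_mk_iff, triangleLift_coe, base, neg_vec]
  fin_cases i
  · left; congr 1 <;> simp
  · right; congr 1 <;> simp; norm_num
  · left; congr 1 <;> simp

/-- The map from the standard triangle to the projective plane that lifts to `triangleLift`. -/
noncomputable def triangleMap : C(stdSimplex ℝ (Fin 3), AntipodalQuotient Space3.{w}) :=
  ⟨fun t => mk (triangleLift.{w} t), continuous_quotient_mk'.comp triangleLift.{w}.continuous⟩

/-- The pointed singular simplex given by `triangleMap`. -/
noncomputable def triangle : projectivePlane.{w}.SingSimplex 2 :=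
  SingSimplex.ofMap (X := projectivePlane.{w}) (n := 2) triangleMap mk_triangleLift_vertex

theorem isLift_triangle : IsLift triangle.{w} triangleLift.{w} := fun t =>
  (DFunLike.congr_fun (SingSimplex.toMap_ofMap (X := projectivePlane.{w}) (n := 2) triangleMap
    mk_triangleLift_vertex) t).symm

theorem triangle_δ_zero : (projectivePlane.{w}.sing.toSSet.δ 0 triangle : SingSimplex _ 1) =
    projectivePlane.{w}.sing.toSSet.δ 2 triangle := by
  refine SingSimplex.toMap_injective (ContinuousMap.ext fun t => ?_)
  rw [SingSimplex.toMap_δ, SingSimplex.toMap_δ, ← isLift_triangle, ← isLift_triangle]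
  refine mk_eq_mk_iff.mpr (.inr ?_)
  let face (i j : Fin 3) : ℝ := stdSimplex.map i.succAbove t j
  have sum_eq := stdSimplex.add_eq_one t
  have zero_zero : face 0 0 = 0 := stdSimplex_map_succAbove_self 0 t
  have zero_one : face 0 1 = t 0 := stdSimplex_map_succAbove_apply 0 t 0
  have zero_two : face 0 2 = t 1 := stdSimplex_map_succAbove_apply 0 t 1
  have two_zero : face 2 0 = t 0 := stdSimplex_map_succAbove_apply 2 t 0
  have two_one : face 2 1 = t 1 := stdSimplex_map_succAbove_apply 2 t 1
  have two_two : face 2 2 = 0 := stdSimplex_map_succAbove_self 2 t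
  rw [triangleLift_coe, triangleLift_coe, neg_vec]
  refine congr (congrArg₂ vec ?_ ?_) ?_
  · linarith
  · change face 0 1 * (face 0 0 - face 0 2) = -(face 2 1 * (face 2 0 - face 2 2))
    rw [zero_zero, zero_one, zero_two, two_zero, two_one, two_two]
    ring
  · change face 0 0 * face 0 1 * face 0 2 = -(face 2 0 * face 2 1 * face 2 2)
    rw [zero_zero, two_two, zero_mul, zero_mul, mul_zero, neg_zero]

theorem triangle_δ_one_mem_degenerate :
    projectivePlane.{w}.sing.toSSet.δ 1 triangle ∈
      projectivePlane.{w}.sing.toSSet.degenerate 1 := by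
  refine SingSimplex.mem_degenerate_of_const fun t => ?_
  rw [SingSimplex.toMap_δ, ← isLift_triangle]
  refine mk_eq_mk_iff.mpr (.inl ?_)
  have middle : stdSimplex.map (Fin.succAbove (1 : Fin 3)) t 1 = 0 :=
    stdSimplex_map_succAbove_self 1 t
  rw [triangleLift_coe, middle, base]
  congr 1 <;> ring

theorem monodromy_triangle_δ_two (k : Type u) [CommRing k] :
    monodromy k (projectivePlane.{w}.sing.toSSet.δ 2 triangle) = -1 := by
  have sgn_zero : sgn k (triangleLift.{w} (stdSimplex.vertex 0)).1 = 1 :=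
    if_pos (by rw [triangleLift_coe]; simp [vec])
  have sgn_one : sgn k (triangleLift.{w} (stdSimplex.vertex 1)).1 = -1 :=
    if_neg (by rw [triangleLift_coe]; norm_num [vec])
  rw [isLift_triangle.monodromy_δ]
  change sgn k (triangleLift (stdSimplex.vertex 0)).1 *
    sgn k (triangleLift (stdSimplex.vertex 1)).1 = -1
  rw [sgn_zero, sgn_one, one_mul]

theorem hasSeparatedIdempotent_chains (k : Type u) [CommRing k] [Invertible (2 : k)] :
    (projectivePlane.{w}.chains k).cobarObj.HasSeparatedIdempotent :=
  NormChains.hasSeparatedIdempotent_cobarObj_dgc k _ isMultiplicative_monodromy triangle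
    triangle_δ_zero triangle_δ_one_mem_degenerate (monodromy_triangle_δ_two k)

end AntipodalQuotient

theorem DGC.not_omegaQuasiIsomorphic_chains_projectivePlane {k : Type u} [Field k] [CharZero k]
    {C : DGC.{u, max u w} k} (hC : C.IsCocommutative) :
    ¬ OmegaQuasiIsomorphic C (AntipodalQuotient.projectivePlane.{w}.chains k) := fun h => by
  have : Invertible (2 : k) := invertibleOfNonzero two_ne_zero
  exact (cobarConilpotentComul C hC).not_hasSeparatedIdempotent
    (h.hasSeparatedIdempotent_iff.mpr (AntipodalQuotient.hasSeparatedIdempotent_chains k))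

theorem mainTheorem2 (k : Type u) [Field k] [CharZero k] :
    (¬ ∃ F : PtdSpace.{w} ⥤ CDGC.{u, max u w} k,
      ∀ X : PtdSpace.{w}, DGC.OmegaQuasiIsomorphic (F.obj X).obj (X.chains k)) ∧
    (¬ ∃ F : PtdSpace.HasUniversalCover.{w}.FullSubcategory ⥤ CDGC.{u, max u w} k,
      ∀ X : PtdSpace.HasUniversalCover.{w}.FullSubcategory,
        DGC.OmegaQuasiIsomorphic (F.obj X).obj (X.obj.chains k)) := by
  refine ⟨fun ⟨F, hF⟩ => ?_, fun ⟨F, hF⟩ => ?_⟩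
  · exact DGC.not_omegaQuasiIsomorphic_chains_projectivePlane (F.obj _).property
      (hF AntipodalQuotient.projectivePlane)
  · exact DGC.not_omegaQuasiIsomorphic_chains_projectivePlane (F.obj _).property
      (hF ⟨_, AntipodalQuotient.hasUniversalCover_projectivePlane⟩)
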